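/- **Theorem (Performance of the Generalized Weighted Shortest Path Algorithm).** *Network.* Let $\mathcal N,\mathcal M,\mathcal L$ be finite index sets, and let $\Omega(t)=(\omega(t),\phi(t))$, $t=0,1,2,\dots$, be i.i.d., where $\omega(t)$ has a fixed law on a measurable space and $\phi(t)\in\{0,1\}$ is independent of $\omega(t)$ with $\Pr[\phi(t)=1]=\phi\in(0,1]$. The state $z(t)$ lives in a countable set $\mathcal Z$ with a distinguished state $0$, and $z(0)=0$. In slot $t$ the controller, knowing the whole history and $\Omega(t)$, chooses (possibly at random) an action $I(t)\in\mathcal I_{\Omega(t),z(t)}$ and a vector $\gamma(t)\in\mathbb R^{\mathcal M}$ with $x_m^{\min}-\alpha\le\gamma_m(t)\le x_m^{\max}+\alpha$ for all $m$ $(*)$; then $z(t+1)$ is drawn from the transition probabilities $P_{z(t),\cdot}(I(t),\Omega(t))$, which send the state to $0$ when $\phi(t)=1$. The penalties $x_m(t)$, services $\mu_n(t)$ and arrivals $R_n(t)$ are measurable functions of $(I(t),\Omega(t),z(t))$ with $x_m^{\min}\le x_m(t)\le x_m^{\max}$, $0\le\mu_n(t)\le\mu_n^{\max}$, $0\le R_n(t)\le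 R_n^{\max}$; put $d_n=\mu_n-R_n$. A *$(z,\Omega)$-only policy* chooses $I(t)$ by a fixed, possibly randomized rule from $(z(t),\Omega(t))$ alone. *Functions and queues.* Let $f$ and $h_l$ ($l\in\mathcal L$) be convex and Lipschitz on the set of vectors satisfying $(*)$, with $f_{\min}\le f\le f_{\max}$ there; let $c_l\in\mathbb R$, $V\ge0$, $\alpha\ge0$. The queues $\Theta=(Q,Y,W)$ evolve by $$Q_n(t+1)=\max[Q_n(t)-\mu_n(t),0]+R_n(t),\quad Y_l(t+1)=\max[Y_l(t)-c_l+h_l(\gamma(t)),0],\quad W_m(t+1)=W_m(t)-\gamma_m(t)+x_m(t).$$ The initial $\Theta(0)$ is random with $Q_n(0),Y_l(0)\ge0$ and $E\{L(\Theta(0))\}<\infty$, where $L(\Theta)=\frac12\big[\sum_nQ_n^2+\sum_lY_l^2+\sum_mW_m^2\big]$. *Renewals.* A renewal definition decides at each time $t$ from the history of the slots before $t$ whether $t$ is a renewal time; time $0$ is one, renewals occur only when $z(t)=0$, and: (i) the first and second moments of the inter-renewal times are bounded by finite constants under every policy, regardless of the past; (ii) under a $(z,\Omega)$-only policy, the inter-renewal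 times together with the outcomes, actions and states over the renewal intervals have the same law on every renewal interval, regardless of the past (and of the choice of a constant $\gamma$). Let $0=t_0<t_1<\cdots$ be the renewal times. *Type-2* renewals are time $0$ and the times $t+1$ with $\phi(t)=1$ (and $z(t+1)=0$, which then holds almost surely). For $\epsilon\ge0$ let $\Gamma_\epsilon$ be the set of all $\gamma\in\mathbb R^{\mathcal M}$ with $h_l(\gamma)\le c_l$ for all $l$ for which there is a $(z,\Omega)$-only policy such that for every renewal time $t_g$, with $T^*$ the length of the renewal interval starting there, $$\frac{E\{\sum_{\tau=0}^{T^*-1}x_m^*(t_g+\tau)\}}{E\{T^*\}}=\gamma_m\ \ (m\in\mathcal M),\qquad \frac{E\{\sum_{\tau=0}^{T^*-1}d_n^*(t_g+\tau)\}}{E\{T^*\}}\ge\epsilon\ \ (n\in\mathcal N).$$ *Assumption 3:* $\Gamma_0\neq\emptyset$. Put $f^{opt}=\inf_{\gamma\in\Gamma_0}f(\gamma)$ (the infimum need not be attained). *Assumption 4 for $\epsilon>0$:* $\Gamma_\epsilon\neq\emptyset$. *Algorithm.* Suppose a policy is used which implements an optimal solution of the weighted stochastic shortest path problem in every renewal interval: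 for every renewal time $t_g$, with $T$ the time until the next renewal, it minimizes, over all policies for choosing $I$ and $\gamma$ and almost surely given the history at $t_g$, the conditional expectation of $$-\sum_nQ_n(t_g)\sum_{\tau<T}d_n(t_g+\tau)-\sum_mW_m(t_g)\sum_{\tau<T}[\gamma_m-x_m](t_g+\tau)-\sum_lY_l(t_g)\sum_{\tau<T}[c_l-h_l(\gamma(t_g+\tau))]+V\sum_{\tau<T}f(\gamma(t_g+\tau)).$$ Let $B_2>0$ satisfy, for every history at a renewal time and all admissible values of $\mu_n,R_n,x_m,\gamma$ in one slot, $$B_2\ge\tfrac12E\{T^2\mid\text{history}\}\Big[\sum_n(\mu_n^2+R_n^2)+\sum_m(\gamma_m-x_m)^2+\sum_l(h_l(\gamma)-c_l)^2\Big].$$ Let $\overline x(t)=\frac1t\sum_{\tau=0}^{t-1}E\{x(\tau)\}$. Then, under Assumption 3: (a) $\displaystyle\lim_{t\to\infty}\frac{E\{Q_n(t)\}}t=\lim_{t\to\infty}\frac{E\{Y_l(t)\}}t=\lim_{t\to\infty}\frac{E\{|W_m(t)|\}}t=0$ for all $n\in\mathcal N$, $l\in\mathcal L$, $m\in\mathcal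 M$. (b) $\limsup_{t\to\infty}h_l(\overline x(t))\le c_l$ for all $l\in\mathcal L$. (c) If renewals are type-2 and $V>0$, then $\limsup_{t\to\infty}f(\overline x(t))\le f^{opt}+\phi B_2/V$. (d) If renewals are type-2 and Assumption 4 holds for some $\epsilon>0$, then every $Q_n$ is strongly stable, $\limsup_{t\to\infty}\frac1t\sum_{\tau=0}^{t-1}E\{Q_n(\tau)\}<\infty$, and for every positive integer $G$ $$\frac1G\sum_{g=0}^{G-1}\sum_{n\in\mathcal N}E\{Q_n(t_g)\}\le\frac{\phi B_2+V(f_{\max}-f_{\min})}{\epsilon}+\frac{\phi E\{L(\Theta(0))\}}{\epsilon G}.$$ -/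

import Mathlib

open MeasureTheory ProbabilityTheory Filter Topology Preorder
open scoped ENNReal NNReal

universe u

namespace MarkovNet

/-! ### The network model -/

/-- A Markov modulated network with `φ`-forced renewals.

* `N` indexes the queues to be stabilized, `M` the penalties `x_1, …, x_M`;
* `W` is the space of the outcomes `ω(t)`, and `Ω(t) = (ω(t), φ(t)) : W × Bool`, where
  `φ(t) = true` is a forced renewal event;
* `A` is the space in which the control actions live, `Z` the (countable) state space.

The functions that depend on the action, the outcome and the state take the triple
`(I, Ω, z) : A × (W × Bool) × Z`. -/
structure Network (N M W A Z : Type u) [MeasurableSpace W] [MeasurableSpace A]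
    [MeasurableSpace Z] where
  /-- the set of feasible actions under the outcome `Ω` in the state `z` -/
  actions : W × Bool → Z → Set A
  /-- the law of `ω(t)` -/
  lawω : Measure W
  lawω_prob : IsProbabilityMeasure lawω
  /-- the forced renewal probability -/
  φ : unitInterval
  φ_pos : 0 < φ
  /-- the state `0` -/
  zero : Z
  /-- `trans (I, Ω, y) {z}` is the transition probability `P_{yz}(I, Ω)` -/
  trans : Kernel (A × (W × Bool) × Z) Z
  trans_markov : IsMarkovKernel trans
  /-- a forced renewal event sends the state to `0` -/
  forced : ∀ ω y, ∀ I ∈ actions (ω, true) y, trans (I, (ω, true), y) = Measure.dirac zero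
  /-- service rates -/
  μhat : N → A × (W × Bool) × Z → ℝ
  /-- arrivals -/
  Rhat : N → A × (W × Bool) × Z → ℝ
  /-- penalties -/
  xhat : M → A × (W × Bool) × Z → ℝ
  μhat_meas : ∀ n, Measurable (μhat n)
  Rhat_meas : ∀ n, Measurable (Rhat n)
  xhat_meas : ∀ m, Measurable (xhat m)
  μmax : N → ℝ
  Rmax : N → ℝ
  xmin : M → ℝ
  xmax : M → ℝ
  μhat_bd : ∀ n Ω z, ∀ I ∈ actions Ω z, 0 ≤ μhat n (I, Ω, z) ∧ μhat n (I, Ω, z) ≤ μmax n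
  Rhat_bd : ∀ n Ω z, ∀ I ∈ actions Ω z, 0 ≤ Rhat n (I, Ω, z) ∧ Rhat n (I, Ω, z) ≤ Rmax n
  xhat_bd : ∀ m Ω z, ∀ I ∈ actions Ω z,
    xmin m ≤ xhat m (I, Ω, z) ∧ xhat m (I, Ω, z) ≤ xmax m

section

variable {N M L W A Z : Type u} [MeasurableSpace W] [MeasurableSpace A] [MeasurableSpace Z]

/-- `d̂_n = μ̂_n - R̂_n`. -/
def Network.dhat (S : Network N M W A Z) (n : N) (q : A × (W × Bool) × Z) : ℝ :=
  S.μhat n q - S.Rhat n q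

/-- The law of `Ω(t) = (ω(t), φ(t))`: the components are independent and `φ(t)` is Bernoulli. -/
noncomputable def Network.lawΩ (S : Network N M W A Z) : Measure (W × Bool) :=
  S.lawω.prod (bernoulliMeasure true false S.φ)

instance (S : Network N M W A Z) : IsProbabilityMeasure S.lawΩ := by
  have := S.lawω_prob
  unfold Network.lawΩ
  infer_instance

instance (S : Network N M W A Z) : IsMarkovKernel S.trans := S.trans_markov

/-- The vectors allowed as auxiliary variables. -/
def Network.box (S : Network N M W A Z) (α : ℝ) : Set (M → ℝ) :=
  {γ | ∀ m, S.xmin m - α ≤ γ m ∧ γ m ≤ S.xmax m + α}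

/-- The data of the convex program: minimize `f` of the time average penalty vector subject to
`h_l ≤ c_l`, with the parameters `V` and `α` of the algorithm. The functions are convex and
Lipschitz (for the Euclidean norm) on the set of allowed auxiliary vectors. -/
structure Program [Fintype M] (S : Network N M W A Z) (L : Type u) where
  f : (M → ℝ) → ℝ
  h : L → (M → ℝ) → ℝ
  c : L → ℝ
  V : ℝ
  V_nonneg : 0 ≤ V
  α : ℝ
  α_nonneg : 0 ≤ α
  f_convex : ConvexOn ℝ (S.box α) f
  h_convex : ∀ l, ConvexOn ℝ (S.box α) (h l)
  fmin : ℝ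
  fmax : ℝ
  f_bd : ∀ γ ∈ S.box α, fmin ≤ f γ ∧ f γ ≤ fmax
  β : ℝ
  f_lip : ∀ γ ∈ S.box α, ∀ γ' ∈ S.box α, |f γ - f γ'| ≤ β * ‖WithLp.toLp 2 (γ - γ')‖
  h_lip : ∀ l, ∀ γ ∈ S.box α, ∀ γ' ∈ S.box α,
    |h l γ - h l γ'| ≤ β * ‖WithLp.toLp 2 (γ - γ')‖

/-! ### Trajectories -/

/-- A vector `Θ = (Q, Y, W)` of queue backlogs. -/
abbrev Backlog (N M L : Type u) : Type u := (N → ℝ) × (L → ℝ) × (M → ℝ)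

/-- What happens in a slot `t`: `((Ω(t), (I(t), γ(t))), z(t+1))`. -/
abbrev Slot (M W A Z : Type u) : Type u := ((W × Bool) × (A × (M → ℝ))) × Z

/-- The coordinates of a trajectory: coordinate `0` is the initial backlog `Θ(0)`, coordinate
`t + 1` is the record of the slot `t`. -/
def Coord (N M L W A Z : Type u) : ℕ → Type u
  | 0 => Backlog N M L
  | _ + 1 => Slot M W A Z

instance : (n : ℕ) → MeasurableSpace (Coord N M L W A Z n)
  | 0 => inferInstanceAs (MeasurableSpace (Backlog N M L))
  | _ + 1 => inferInstanceAs (MeasurableSpace (Slot M W A Z))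

/-- The record of a slot, as an element of `Slot`. -/
def slotRec {t : ℕ} (x : Coord N M L W A Z (t + 1)) : Slot M W A Z := x

theorem measurable_slotRec (t : ℕ) :
    Measurable (slotRec (N := N) (M := M) (L := L) (W := W) (A := A) (Z := Z) (t := t)) :=
  measurable_id

/-- A trajectory of the system. -/
abbrev Path (N M L W A Z : Type u) : Type u := (n : ℕ) → Coord N M L W A Z n

/-- The history at the beginning of the slot `t`: the initial backlog and the record of the slots
`0, …, t - 1`. -/
abbrev Hist (N M L W A Z : Type u) (t : ℕ) : Type u :=
  (i : Finset.Iic t) → Coord N M L W A Z i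

/-- The outcome `Ω(t)`. -/
def outcome (p : Path N M L W A Z) (t : ℕ) : W × Bool :=
  (slotRec (p (t + 1))).1.1

/-- The action `I(t)`. -/
def action (p : Path N M L W A Z) (t : ℕ) : A :=
  (slotRec (p (t + 1))).1.2.1

/-- The auxiliary vector `γ(t)`. -/
def aux (p : Path N M L W A Z) (t : ℕ) : M → ℝ :=
  (slotRec (p (t + 1))).1.2.2

/-- The state `z(t)`, with `z(0) = 0`. -/
def state (S : Network N M W A Z) (p : Path N M L W A Z) : ℕ → Z
  | 0 => S.zero
  | t + 1 => (slotRec (p (t + 1))).2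

/-- The state `z(t)` as a function of the history at the beginning of the slot `t`. -/
def histState (S : Network N M W A Z) : (t : ℕ) → Hist N M L W A Z t → Z
  | 0, _ => S.zero
  | t + 1, h => (slotRec (t := t) (h ⟨t + 1, Finset.mem_Iic.2 le_rfl⟩)).2

theorem measurable_histState (S : Network N M W A Z) (t : ℕ) :
    Measurable (histState (L := L) S t) := by
  cases t with
  | zero => exact measurable_const
  | succ t =>
    exact measurable_snd.comp ((measurable_slotRec t).comp
      (measurable_pi_apply (X := fun i : Finset.Iic (t + 1) => Coord N M L W A Z i)
        ⟨t + 1, Finset.mem_Iic.2 le_rfl⟩))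

/-- The triple `(I(t), Ω(t), z(t))`. -/
def point (S : Network N M W A Z) (p : Path N M L W A Z) (t : ℕ) : A × (W × Bool) × Z :=
  (action p t, outcome p t, state S p t)

/-- The backlogs `Θ(t) = (Q(t), Y(t), W(t))`, given by the queue update equations. -/
noncomputable def backlog [Fintype M] (S : Network N M W A Z) (C : Program S L)
    (p : Path N M L W A Z) : ℕ → Backlog N M L
  | 0 => p 0
  | t + 1 =>
    (fun n => max ((backlog S C p t).1 n - S.μhat n (point S p t)) 0 + S.Rhat n (point S p t),
     fun l => max ((backlog S C p t).2.1 l - C.c l + C.h l (aux p t)) 0,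
     fun m => (backlog S C p t).2.2 m - aux p t m + S.xhat m (point S p t))

/-- The quadratic Lyapunov function `L₂`. -/
noncomputable def lyapunov [Fintype N] [Fintype M] [Fintype L] (θ : Backlog N M L) : ℝ :=
  (1 / 2) * (∑ n, θ.1 n ^ 2 + ∑ l, θ.2.1 l ^ 2 + ∑ m, θ.2.2 m ^ 2)

/-! ### Control policies -/

/-- A (causal, possibly randomized and history dependent) control policy: in each slot `t` it
observes the history and `Ω(t)` and chooses a feasible action `I(t)` and an allowed `γ(t)`. -/
structure Policy [Fintype M] (S : Network N M W A Z) (C : Program S L) where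
  act : (t : ℕ) → Kernel (Hist N M L W A Z t × (W × Bool)) (A × (M → ℝ))
  act_markov : ∀ t, IsMarkovKernel (act t)
  act_mem : ∀ t (h : Hist N M L W A Z t) (Ω : W × Bool), ∀ᵐ d ∂(act t (h, Ω)),
    d.1 ∈ S.actions Ω (histState S t h) ∧ d.2 ∈ S.box C.α

/-- A `(z, Ω)`-only policy: a stationary, possibly randomized choice of `I(t)` based only on the
current `z(t)` and `Ω(t)`. -/
structure StatPolicy (S : Network N M W A Z) where
  act : Kernel (Z × (W × Bool)) A
  act_markov : IsMarkovKernel act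
  act_mem : ∀ z Ω, ∀ᵐ I ∂(act (z, Ω)), I ∈ S.actions Ω z

/-- The policy that takes its actions by the `(z, Ω)`-only policy `σ` and always uses the constant
auxiliary vector `γ₀`. -/
noncomputable def StatPolicy.toPolicy [Fintype M] {S : Network N M W A Z} (C : Program S L)
    (σ : StatPolicy S) (γ₀ : S.box C.α) : Policy S C where
  act t :=
    haveI := σ.act_markov
    (σ.act.comap (fun q : Hist N M L W A Z t × (W × Bool) => (histState S t q.1, q.2))
        (((measurable_histState S t).comp measurable_fst).prodMk measurable_snd)) ×ₖ
      Kernel.const _ (Measure.dirac (γ₀ : M → ℝ))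
  act_markov t := by
    have := σ.act_markov
    infer_instance
  act_mem t h Ω := by
    have := σ.act_markov
    rw [Kernel.prod_apply, Kernel.comap_apply, Kernel.const_apply]
    have h1 := (measurePreserving_fst (μ := σ.act (histState S t h, Ω))
      (ν := Measure.dirac (γ₀ : M → ℝ))).quasiMeasurePreserving.ae (σ.act_mem (histState S t h) Ω)
    have h2 : ∀ᵐ d ∂((σ.act (histState S t h, Ω)).prod (Measure.dirac (γ₀ : M → ℝ))),
        d.2 ∈ S.box C.α :=
      (measurePreserving_snd (μ := σ.act (histState S t h, Ω))
        (ν := Measure.dirac (γ₀ : M → ℝ))).quasiMeasurePreserving.ae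
        (p := fun γ => γ ∈ S.box C.α) (ae_iff.2 (by
          rw [Measure.dirac_apply]
          exact Set.indicator_of_notMem (by simp) _))
    filter_upwards [h1, h2] with d h1 h2 using ⟨h1, h2⟩

section

variable [Fintype M] {S : Network N M W A Z} {C : Program S L}

/-- The law of the record of the slot `t` given the history: `Ω(t)` is independent of the history,
then `(I(t), γ(t))` is chosen by the policy, then `z(t+1)` by the transition probabilities. -/
noncomputable def Policy.step (π : Policy S C) (t : ℕ) :
    Kernel (Hist N M L W A Z t) (Coord N M L W A Z (t + 1)) :=
  haveI := π.act_markov t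
  show Kernel (Hist N M L W A Z t) (Slot M W A Z) from
    ((Kernel.const (Hist N M L W A Z t) S.lawΩ) ⊗ₖ π.act t) ⊗ₖ
      S.trans.comap
        (fun q : Hist N M L W A Z t × ((W × Bool) × (A × (M → ℝ))) =>
          (q.2.2.1, q.2.1, histState S t q.1))
        (measurable_snd.snd.fst.prodMk
          (measurable_snd.fst.prodMk ((measurable_histState S t).comp measurable_fst)))

instance (π : Policy S C) (t : ℕ) : IsMarkovKernel (π.step t) := by
  have := π.act_markov t
  change IsMarkovKernel (((Kernel.const (Hist N M L W A Z t) S.lawΩ) ⊗ₖ π.act t) ⊗ₖ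
    S.trans.comap _ _)
  infer_instance

/-- The conditional law of the trajectory given the history `h` at the beginning of the slot `t`,
when the policy `π` is used from then on. -/
noncomputable def Policy.lawFrom (π : Policy S C) (t : ℕ) (h : Hist N M L W A Z t) :
    Measure (Path N M L W A Z) :=
  Kernel.traj π.step t h

/-- The law of the trajectory under the policy `π`, when `Θ(0)` has the law `ρ`. -/
noncomputable def Policy.law (π : Policy S C) (ρ : Measure (Backlog N M L)) :
    Measure (Path N M L W A Z) :=
  Kernel.trajMeasure (X := Coord N M L W A Z) ρ π.step

end

/-! ### Renewals -/

/-- A renewal definition: `R t` is the set of the histories at which a renewal occurs at `t`. -/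
abbrev RenewalRule (N M L W A Z : Type u) : Type u := (t : ℕ) → Set (Hist N M L W A Z t)

/-- A renewal occurs at the time `t` of the trajectory `p`. -/
def RenewsAt (R : RenewalRule N M L W A Z) (p : Path N M L W A Z) (t : ℕ) : Prop :=
  frestrictLe (π := Coord N M L W A Z) t p ∈ R t

/-- The duration from the time `t` until the next renewal (`⊤` if there is none). -/
noncomputable def frameLength (R : RenewalRule N M L W A Z) (t : ℕ) (p : Path N M L W A Z) : ℕ∞ :=
  ⨅ (k : ℕ) (_ : 1 ≤ k ∧ RenewsAt R p (t + k)), (k : ℕ∞)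

/-- The time `t_g` of the `g`-th renewal, with `t_0 = 0`. -/
noncomputable def renewalTime (R : RenewalRule N M L W A Z) (p : Path N M L W A Z) : ℕ → ℕ∞
  | 0 => 0
  | g + 1 => renewalTime R p g + frameLength R (renewalTime R p g).toNat p

/-- The sum of `F` over the renewal interval that starts at `t`. -/
noncomputable def frameSum (R : RenewalRule N M L W A Z) (t : ℕ) (p : Path N M L W A Z)
    (F : ℕ → ℝ) : ℝ :=
  ∑ τ ∈ Finset.range (frameLength R t p).toNat, F (t + τ)

/-- The outcomes, actions and next states in the `k` slots that follow the time `t`. -/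
def segment (t k : ℕ) (p : Path N M L W A Z) : Fin k → ((W × Bool) × A) × Z :=
  fun i => ((outcome p (t + i), action p (t + i)), (slotRec (p (t + i + 1))).2)

/-- The renewal requirements. Renewals occur only in the state `0`, time `0` is a renewal time,
and:

* the first and second moments of the inter-renewal times are bounded by finite constants under
  every policy, regardless of the past;
* under a `(z, Ω)`-only policy the inter-renewal time and the sequence of outcomes, decisions and
  states over the renewal interval (hence also of the penalties) have the same law for every
  renewal and every past, i.e. they are i.i.d. over the renewal intervals. The auxiliary
  variables, which are no part of the network, have no influence on this law. -/
structure IsRenewalDefinition [Fintype M] (S : Network N M W A Z) (C : Program S L)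
    (R : RenewalRule N M L W A Z) : Prop where
  meas : ∀ t, MeasurableSet (R t)
  start : R 0 = Set.univ
  state_zero : ∀ t, ∀ h ∈ R t, histState S t h = S.zero
  moments : ∃ m₁ m₂ : ℝ≥0, ∀ (π : Policy S C) (t : ℕ), ∀ h ∈ R t,
    ∫⁻ p, (frameLength R t p : ℝ≥0∞) ∂(π.lawFrom t h) ≤ m₁ ∧
    ∫⁻ p, (frameLength R t p : ℝ≥0∞) ^ 2 ∂(π.lawFrom t h) ≤ m₂
  iid : ∀ (σ : StatPolicy S) (γ₀ γ₁ : S.box C.α) (t s : ℕ), ∀ h ∈ R t, ∀ h' ∈ R s,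
    ∀ (k : ℕ) (B : Set (Fin k → ((W × Bool) × A) × Z)), MeasurableSet B →
      (σ.toPolicy C γ₀).lawFrom t h {p | frameLength R t p = k ∧ segment t k p ∈ B} =
      (σ.toPolicy C γ₁).lawFrom s h' {p | frameLength R s p = k ∧ segment s k p ∈ B}

/-- Type-2 renewals: time `0` and the ends of the slots with a forced renewal event. -/
def typeTwoRenewals (S : Network N M W A Z) : RenewalRule N M L W A Z
  | 0 => Set.univ
  | t + 1 => {h | histState S (t + 1) h = S.zero ∧
      (slotRec (t := t) (h ⟨t + 1, Finset.mem_Iic.2 le_rfl⟩)).1.1.2 = true}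

/-! ### Feasible vectors and the optimal value -/

section

variable [Fintype M] {S : Network N M W A Z}

/-- There is a `(z, Ω)`-only policy with the average penalty vector `γ` over every renewal interval
and with `E{∑ d_n} / E{T} ≥ ε` for all `n`, and `h_l(γ) ≤ c_l` for all `l`. (The constant auxiliary
vector `γ₀` plays no role.) -/
def Attains (C : Program S L) (R : RenewalRule N M L W A Z) (ε : ℝ) (γ : M → ℝ) : Prop :=
  (∃ σ : StatPolicy S, ∀ (γ₀ : S.box C.α) (t : ℕ), ∀ h ∈ R t,
    (∀ m, (∫ p, frameSum R t p (fun τ => S.xhat m (point S p τ))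
          ∂((σ.toPolicy C γ₀).lawFrom t h)) /
        (∫⁻ p, (frameLength R t p : ℝ≥0∞) ∂((σ.toPolicy C γ₀).lawFrom t h)).toReal = γ m) ∧
    (∀ n, ε ≤ (∫ p, frameSum R t p (fun τ => S.dhat n (point S p τ))
          ∂((σ.toPolicy C γ₀).lawFrom t h)) /
        (∫⁻ p, (frameLength R t p : ℝ≥0∞) ∂((σ.toPolicy C γ₀).lawFrom t h)).toReal)) ∧
  ∀ l, C.h l γ ≤ C.c l

/-- `f^opt`: the infimum of `f` over the feasible average penalty vectors of `(z, Ω)`-only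
policies. -/
noncomputable def optimalValue (C : Program S L) (R : RenewalRule N M L W A Z) : ℝ :=
  sInf (C.f '' {γ | Attains C R 0 γ})

/-! ### The weighted stochastic shortest path problem -/

variable [Fintype N] [Fintype L]

/-- The drift-plus-penalty expression `D₂(Θ(t)) + V E{∑ f(γ)}` over the renewal interval that
starts at the time `t` with the history `h`, when the policy `π` is used. -/
noncomputable def driftPlusPenalty (R : RenewalRule N M L W A Z) {C : Program S L}
    (π : Policy S C) (t : ℕ) (h : Hist N M L W A Z t) : ℝ :=
  ∫ p,
    (- ∑ n, (backlog S C p t).1 n * frameSum R t p (fun τ => S.dhat n (point S p τ))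
     - ∑ m, (backlog S C p t).2.2 m *
          frameSum R t p (fun τ => aux p τ m - S.xhat m (point S p τ))
     - ∑ l, (backlog S C p t).2.1 l * frameSum R t p (fun τ => C.c l - C.h l (aux p τ))
     + C.V * frameSum R t p (fun τ => C.f (aux p τ))) ∂(π.lawFrom t h)

/-- The policy `π` implements an optimal solution of the weighted stochastic shortest path problem
in every renewal interval: given the history at the start of the interval, no other policy
has a smaller drift-plus-penalty expression over the interval. -/
def SolvesShortestPath (R : RenewalRule N M L W A Z) {C : Program S L} (π : Policy S C)
    (ρ : Measure (Backlog N M L)) : Prop :=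
  ∀ (π' : Policy S C) (t : ℕ), ∀ᵐ p ∂(π.law ρ), RenewsAt R p t →
    driftPlusPenalty R π t (frestrictLe (π := Coord N M L W A Z) t p) ≤
      driftPlusPenalty R π' t (frestrictLe (π := Coord N M L W A Z) t p)

/-- `B₂` is a valid drift constant for the policy `π`. -/
def IsDriftConstant (R : RenewalRule N M L W A Z) {C : Program S L} (π : Policy S C)
    (B₂ : ℝ) : Prop :=
  0 < B₂ ∧ ∀ (t : ℕ), ∀ h ∈ R t, ∀ (Ω : W × Bool) (z : Z), ∀ I ∈ S.actions Ω z,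
    ∀ γ ∈ S.box C.α,
      (∫⁻ p, (frameLength R t p : ℝ≥0∞) ^ 2 ∂(π.lawFrom t h)) / 2 *
        ENNReal.ofReal (∑ n, (S.μhat n (I, Ω, z) ^ 2 + S.Rhat n (I, Ω, z) ^ 2) +
          ∑ m, (γ m - S.xhat m (I, Ω, z)) ^ 2 + ∑ l, (C.h l γ - C.c l) ^ 2) ≤
      ENNReal.ofReal B₂

/-- The expected time average penalty vector `x̄(t)`. -/
noncomputable def avgPenalty {C : Program S L} (π : Policy S C) (ρ : Measure (Backlog N M L))
    (t : ℕ) : M → ℝ :=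
  fun m => (1 / (t : ℝ)) * ∑ τ ∈ Finset.range t, ∫ p, S.xhat m (point S p τ) ∂(π.law ρ)

end

end

end MarkovNet

/-!
The proof compares the algorithm, over one renewal interval, with a stationary policy attaining a
feasible `γ`. Along a sample path the change of the Lyapunov function over an interval of length
`T` is at most `T²/2` times the largest cost of a slot, plus an expression that is linear in the
backlogs at the start of the interval. The expectation of the former is at most `B₂`; the latter,
penalty included, is what the algorithm minimizes, and for the stationary policy it is at most
`(V f(γ) - ε ∑ Qₙ) E{T}`.

Telescoping over the renewals gives `E{L(Θ(t))} = O(t)`, so all queues are `O(√t)` in mean. Rate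
stability of `W` makes the averages of `x` and of `γ` asymptotically equal, and convexity of `h`
and `f` (Jensen) then turns rate stability of `Y` and the telescoped penalty bound into bounds at
the average penalty.

For type-2 renewals the length of an interval is geometric with mean `1/φ` under every policy.
Furthermore, the forced renewal in a slot is independent of the backlog at the start of the slot,
so a bound on the queues at the renewal times yields a bound at all times.
-/

namespace MarkovNet

/-! ### The Markov property -/

section MarkovProperty

variable {X : ℕ → Type*} [∀ n, MeasurableSpace (X n)]
  {κ : (n : ℕ) → Kernel ((i : Finset.Iic n) → X i) (X (n + 1))}

theorem measurable_piLE_eval {s t : ℕ} (hst : s ≤ t) :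
    Measurable[Filtration.piLE (X := X) t] fun p : (n : ℕ) → X n => p s := by
  rw [Filtration.piLE_eq_comap_frestrictLe]
  exact (measurable_pi_apply (X := fun i : Finset.Iic t => X i) ⟨s, Finset.mem_Iic.2 hst⟩).comp
    (comap_measurable _)

variable [∀ n, IsMarkovKernel (κ n)]

/-- From the time `t` on, a trajectory with the law `μ` evolves by the kernels `κ`: at each time
`τ ≥ t` the conditional law of the whole trajectory given its past is `Kernel.traj κ τ`. -/
def EvolvesFrom (κ : (n : ℕ) → Kernel ((i : Finset.Iic n) → X i) (X (n + 1)))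
    [∀ n, IsMarkovKernel (κ n)] (t : ℕ) (μ : Measure ((n : ℕ) → X n)) : Prop :=
  ∀ τ, t ≤ τ → μ.map (fun p => (frestrictLe τ p, p)) = μ.map (frestrictLe τ) ⊗ₘ Kernel.traj κ τ

theorem evolvesFrom_bind_traj (t : ℕ) (ν : Measure ((i : Finset.Iic t) → X i)) [SFinite ν] :
    EvolvesFrom κ t (ν.bind (Kernel.traj κ t)) := fun τ hτ => by
  rw [Measure.compProd_eq_comp_prod, Measure.map_comp _ _ (by fun_prop),
    Measure.map_comp _ _ (by fun_prop), Kernel.traj_map_frestrictLe, Measure.comp_assoc]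
  congr with h : 1
  rw [Kernel.comp_apply, ← Measure.compProd_eq_comp_prod, Kernel.map_apply _ (by fun_prop),
    Kernel.partialTraj_compProd_traj hτ]

theorem evolvesFrom_traj (t : ℕ) (h : (i : Finset.Iic t) → X i) :
    EvolvesFrom κ t (Kernel.traj κ t h) := fun τ hτ => by
  rw [Kernel.traj_map_frestrictLe_apply, Kernel.partialTraj_compProd_traj hτ]

theorem evolvesFrom_trajMeasure (ρ : Measure (X 0)) [IsProbabilityMeasure ρ] :
    EvolvesFrom κ 0 (Kernel.trajMeasure ρ κ) := by
  let e : X 0 → (i : Finset.Iic 0) → X i :=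
    (MeasurableEquiv.piUnique fun i : Finset.Iic 0 => X i).symm
  have he : Measurable e := (MeasurableEquiv.piUnique fun i : Finset.Iic 0 => X i).symm.measurable
  have := Measure.isProbabilityMeasure_map (μ := ρ) he.aemeasurable
  exact evolvesFrom_bind_traj 0 (ρ.map e)

namespace EvolvesFrom

variable {t τ : ℕ} {μ : Measure ((n : ℕ) → X n)} [IsProbabilityMeasure μ]

theorem map_prodMk_eval_succ (hμ : EvolvesFrom κ t μ) (hτ : t ≤ τ) :
    μ.map (fun p => (frestrictLe τ p, p (τ + 1))) = μ.map (frestrictLe τ) ⊗ₘ κ τ := by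
  have hcomp : (fun p : (n : ℕ) → X n => (frestrictLe τ p, p (τ + 1))) =
      Prod.map id (fun p => p (τ + 1)) ∘ fun p => (frestrictLe τ p, p) := rfl
  rw [hcomp, ← Measure.map_map (by fun_prop) (by fun_prop), hμ τ hτ,
    ← Measure.compProd_map (by fun_prop), Kernel.map_traj_succ_self]

theorem ae_succ (hμ : EvolvesFrom κ t μ) (hτ : t ≤ τ)
    {P : ((i : Finset.Iic τ) → X i) × X (τ + 1) → Prop} (hPm : MeasurableSet {x | P x})
    (hP : ∀ h, ∀ᵐ x ∂κ τ h, P (h, x)) : ∀ᵐ p ∂μ, P (frestrictLe τ p, p (τ + 1)) := by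
  have hm : Measurable fun p : (n : ℕ) → X n => (frestrictLe τ p, p (τ + 1)) := by fun_prop
  rw [← ae_map_iff hm.aemeasurable hPm, hμ.map_prodMk_eval_succ hτ]
  exact (Measure.ae_compProd_iff hPm).2 (ae_of_all _ hP)

theorem setLIntegral (hμ : EvolvesFrom κ t μ) (hτ : t ≤ τ) {E : Set ((n : ℕ) → X n)}
    (hE : MeasurableSet[Filtration.piLE (X := X) τ] E) {G : ((n : ℕ) → X n) → ℝ≥0∞}
    (hG : Measurable G) :
    ∫⁻ p in E, G p ∂μ = ∫⁻ p in E, ∫⁻ q, G q ∂Kernel.traj κ τ (frestrictLe τ p) ∂μ := by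
  rw [Filtration.piLE_eq_comap_frestrictLe] at hE
  obtain ⟨E, hE, rfl⟩ := hE
  have hpair : Measurable fun p : (n : ℕ) → X n => (frestrictLe τ p, p) := by fun_prop
  have hmap := setLIntegral_map (μ := μ) (hE.prod .univ) (hG.comp measurable_snd) hpair
  rw [hμ τ hτ, Measure.setLIntegral_compProd (hG.comp measurable_snd) hE .univ] at hmap
  rw [← setLIntegral_map hE (f := fun h => ∫⁻ q, G q ∂Kernel.traj κ τ h) hG.lintegral_kernel
    (measurable_frestrictLe τ)]
  simpa [Set.mk_preimage_prod] using hmap.symm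

theorem lintegral (hμ : EvolvesFrom κ t μ) (hτ : t ≤ τ) {G : ((n : ℕ) → X n) → ℝ≥0∞}
    (hG : Measurable G) :
    ∫⁻ p, G p ∂μ = ∫⁻ p, ∫⁻ q, G q ∂Kernel.traj κ τ (frestrictLe τ p) ∂μ := by
  simpa using hμ.setLIntegral hτ .univ hG

end EvolvesFrom

theorem ae_traj_frestrictLe_mem {t : ℕ} {E : Set ((i : Finset.Iic t) → X i)}
    (hE : MeasurableSet E) {h : (i : Finset.Iic t) → X i} (hh : h ∈ E) :
    ∀ᵐ q ∂Kernel.traj κ t h, frestrictLe t q ∈ E := by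
  refine ae_of_ae_map (p := (· ∈ E)) (measurable_frestrictLe t).aemeasurable ?_
  rw [Kernel.traj_map_frestrictLe_apply, Kernel.partialTraj_self, Kernel.id_apply]
  exact (ae_dirac_iff hE).2 hh

theorem ae_traj_mem_of_mem {t : ℕ} {E : Set ((n : ℕ) → X n)}
    (hE : MeasurableSet[Filtration.piLE (X := X) t] E) {p : (n : ℕ) → X n} (hp : p ∈ E) :
    ∀ᵐ q ∂Kernel.traj κ t (frestrictLe t p), q ∈ E := by
  rw [Filtration.piLE_eq_comap_frestrictLe] at hE
  obtain ⟨E, hE, rfl⟩ := hE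
  exact ae_traj_frestrictLe_mem hE hp

theorem ae_traj_eq {t : ℕ} {β : Type*} [MeasurableSpace β] [MeasurableSingletonClass β]
    {g : ((n : ℕ) → X n) → β} (hg : Measurable[Filtration.piLE (X := X) t] g)
    (p : (n : ℕ) → X n) : ∀ᵐ q ∂Kernel.traj κ t (frestrictLe t p), g q = g p :=
  ae_traj_mem_of_mem (hg (measurableSet_singleton (g p))) rfl

end MarkovProperty

section Trajectories

variable {N M L W A Z : Type u}

/-- The history of the trajectory `p` at the beginning of the slot `t`. -/
abbrev past (t : ℕ) (p : Path N M L W A Z) : Hist N M L W A Z t :=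
  frestrictLe (π := Coord N M L W A Z) t p

variable [MeasurableSpace W] [MeasurableSpace A] [MeasurableSpace Z]

theorem state_eq_histState (S : Network N M W A Z) (p : Path N M L W A Z) (t : ℕ) :
    state S p t = histState S t (past t p) := by
  cases t <;> rfl

theorem measurable_slot {s t : ℕ} (hst : s < t) :
    Measurable[Filtration.piLE t] fun p : Path N M L W A Z => slotRec (p (s + 1)) :=
  (measurable_slotRec s).comp (measurable_piLE_eval hst)

theorem measurable_outcome {s t : ℕ} (hst : s < t) :
    Measurable[Filtration.piLE t] fun p : Path N M L W A Z => outcome p s :=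
  (measurable_slot hst).fst.fst

theorem measurable_action {s t : ℕ} (hst : s < t) :
    Measurable[Filtration.piLE t] fun p : Path N M L W A Z => action p s :=
  (measurable_slot hst).fst.snd.fst

theorem measurable_aux {s t : ℕ} (hst : s < t) :
    Measurable[Filtration.piLE t] fun p : Path N M L W A Z => aux p s :=
  (measurable_slot hst).fst.snd.snd

theorem measurable_state (S : Network N M W A Z) {s t : ℕ} (hst : s ≤ t) :
    Measurable[Filtration.piLE t] fun p : Path N M L W A Z => state S p s := by
  cases s with
  | zero => exact measurable_const
  | succ s => exact (measurable_slot hst).snd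

theorem measurable_point (S : Network N M W A Z) {s t : ℕ} (hst : s < t) :
    Measurable[Filtration.piLE t] fun p : Path N M L W A Z => point S p s :=
  (measurable_action hst).prodMk ((measurable_outcome hst).prodMk (measurable_state S hst.le))

variable [Fintype M] {S : Network N M W A Z} {C : Program S L}

theorem measurable_backlog (hC : ∀ l, Measurable (C.h l)) (t : ℕ) :
    Measurable[Filtration.piLE t] fun p : Path N M L W A Z => backlog S C p t := by
  induction t with
  | zero => exact measurable_piLE_eval le_rfl
  | succ t ih =>
    have hp := measurable_point (L := L) S t.lt_succ_self
    have hγ := measurable_aux (N := N) (M := M) (L := L) (W := W) (A := A) (Z := Z) t.lt_succ_self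
    have hΘ := ih.mono (Filtration.piLE.mono t.le_succ) le_rfl
    refine Measurable.prodMk ?_ (Measurable.prodMk ?_ ?_) <;>
      refine @measurable_pi_lambda _ _ _ (Filtration.piLE (t + 1)) _ _ fun i => ?_
    · exact ((((measurable_pi_apply i).comp hΘ.fst).sub ((S.μhat_meas i).comp hp)).max
        measurable_const).add ((S.Rhat_meas i).comp hp)
    · exact ((((measurable_pi_apply i).comp hΘ.snd.fst).sub measurable_const).add
        ((hC i).comp hγ)).max measurable_const
    · exact (((measurable_pi_apply i).comp hΘ.snd.snd).sub ((measurable_pi_apply i).comp hγ)).add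
        ((S.xhat_meas i).comp hp)

end Trajectories

section Laws

variable {N M L W A Z : Type u} [Fintype M] [MeasurableSpace W] [MeasurableSpace A]
  [MeasurableSpace Z] {S : Network N M W A Z} {C : Program S L}

instance (π : Policy S C) (t : ℕ) (h : Hist N M L W A Z t) :
    IsProbabilityMeasure (π.lawFrom t h) := by
  unfold Policy.lawFrom
  infer_instance

instance (π : Policy S C) (ρ : Measure (Backlog N M L)) [IsProbabilityMeasure ρ] :
    IsProbabilityMeasure (π.law ρ) := by
  let ρ₀ : Measure (Coord N M L W A Z 0) := ρ
  have : IsProbabilityMeasure ρ₀ := ‹IsProbabilityMeasure ρ›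
  exact inferInstanceAs (IsProbabilityMeasure (Kernel.trajMeasure ρ₀ π.step))

theorem Policy.evolvesFrom_lawFrom (π : Policy S C) (t : ℕ) (h : Hist N M L W A Z t) :
    EvolvesFrom π.step t (π.lawFrom t h) :=
  evolvesFrom_traj t h

theorem Policy.evolvesFrom_law (π : Policy S C) (ρ : Measure (Backlog N M L))
    [IsProbabilityMeasure ρ] : EvolvesFrom π.step 0 (π.law ρ) :=
  let ρ₀ : Measure (Coord N M L W A Z 0) := ρ
  have : IsProbabilityMeasure ρ₀ := ‹IsProbabilityMeasure ρ›
  evolvesFrom_trajMeasure ρ₀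

theorem Policy.ae_step (π : Policy S C) {t : ℕ} {h : Hist N M L W A Z t}
    {P : Slot M W A Z → Prop} (hPm : MeasurableSet {x | P x})
    (hP : ∀ Ω, ∀ᵐ d ∂π.act t (h, Ω), ∀ᵐ z ∂S.trans (d.1, Ω, histState S t h), P ((Ω, d), z)) :
    ∀ᵐ x ∂π.step t h, P (slotRec x) := by
  have := π.act_markov t
  refine Kernel.ae_compProd_of_ae_ae hPm ?_
  have hPm' : MeasurableSet {b : (W × Bool) × A × (M → ℝ) |
      ∀ᵐ z ∂S.trans (b.2.1, b.1, histState S t h), P (b, z)} :=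
    Kernel.measurable_kernel_prodMk_left (κ := S.trans.comap
      (fun b : (W × Bool) × A × (M → ℝ) => (b.2.1, b.1, histState S t h)) (by fun_prop))
      hPm.compl (measurableSet_singleton 0)
  exact Kernel.ae_compProd_of_ae_ae hPm' (ae_of_all _ hP)

end Laws

section Box

variable {N M W A Z : Type u} [MeasurableSpace W] [MeasurableSpace A] [MeasurableSpace Z]
  (S : Network N M W A Z) (α : ℝ)

theorem Network.box_eq_Icc : S.box α = Set.Icc (fun m => S.xmin m - α) fun m => S.xmax m + α := by
  ext γ
  simp only [Network.box, Set.mem_ofPred_eq, Set.mem_Icc, Pi.le_def, forall_and]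

theorem Network.isCompact_box : IsCompact (S.box α) :=
  S.box_eq_Icc α ▸ isCompact_Icc

theorem Network.convex_box : Convex ℝ (S.box α) :=
  S.box_eq_Icc α ▸ convex_Icc _ _

theorem Network.measurableSet_box [Countable M] : MeasurableSet (S.box α) :=
  (S.isCompact_box α).isClosed.measurableSet

end Box

theorem continuousOn_of_abs_sub_le_mul_norm {ι : Type*} [Fintype ι] {s : Set (ι → ℝ)}
    {g : (ι → ℝ) → ℝ} {β : ℝ}
    (hg : ∀ x ∈ s, ∀ y ∈ s, |g x - g y| ≤ β * ‖WithLp.toLp 2 (x - y)‖) : ContinuousOn g s := by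
  intro x hx
  have hcont : Continuous fun y : ι → ℝ => β * ‖WithLp.toLp 2 (y - x)‖ :=
    continuous_const.mul ((PiLp.continuous_toLp 2 _).comp (continuous_id.sub continuous_const)).norm
  have hlim : Tendsto (fun y : ι → ℝ => β * ‖WithLp.toLp 2 (y - x)‖) (𝓝[s] x) (𝓝 0) := by
    simpa using (hcont.tendsto x).mono_left nhdsWithin_le_nhds
  refine tendsto_iff_dist_tendsto_zero.2
    (squeeze_zero' (Eventually.of_forall fun _ => dist_nonneg) ?_ hlim)
  filter_upwards [self_mem_nhdsWithin] with y hy using hg y hy x hx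

namespace Program

variable {N M L W A Z : Type u} [Fintype M] [MeasurableSpace W] [MeasurableSpace A]
  [MeasurableSpace Z] {S : Network N M W A Z} (C : Program S L)

theorem continuousOn_f : ContinuousOn C.f (S.box C.α) :=
  continuousOn_of_abs_sub_le_mul_norm C.f_lip

theorem continuousOn_h (l : L) : ContinuousOn (C.h l) (S.box C.α) :=
  continuousOn_of_abs_sub_le_mul_norm (C.h_lip l)

theorem exists_abs_h_le (l : L) : ∃ b, ∀ γ ∈ S.box C.α, |C.h l γ| ≤ b :=
  (S.isCompact_box _).exists_bound_of_continuousOn (C.continuousOn_h l)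

/-- The program with `f` and `h_l` replaced by `0` outside of the set of allowed auxiliary vectors.
This changes no trajectory that can occur and makes the two functions, hence the backlogs,
measurable. -/
noncomputable def zeroExtend : Program S L where
  f := (S.box C.α).indicator C.f
  h l := (S.box C.α).indicator (C.h l)
  c := C.c
  V := C.V
  V_nonneg := C.V_nonneg
  α := C.α
  α_nonneg := C.α_nonneg
  f_convex := C.f_convex.congr fun _ hγ => (Set.indicator_of_mem hγ _).symm
  h_convex l := (C.h_convex l).congr fun _ hγ => (Set.indicator_of_mem hγ _).symm
  fmin := C.fmin
  fmax := C.fmax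
  f_bd γ hγ := by
    rw [Set.indicator_of_mem hγ]
    exact C.f_bd γ hγ
  β := C.β
  f_lip γ hγ γ' hγ' := by
    rw [Set.indicator_of_mem hγ, Set.indicator_of_mem hγ']
    exact C.f_lip γ hγ γ' hγ'
  h_lip l γ hγ γ' hγ' := by
    rw [Set.indicator_of_mem hγ, Set.indicator_of_mem hγ']
    exact C.h_lip l γ hγ γ' hγ'

variable {C} in
theorem zeroExtend_f {γ : M → ℝ} (hγ : γ ∈ S.box C.α) : C.zeroExtend.f γ = C.f γ :=
  Set.indicator_of_mem hγ _

variable {C} in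
theorem zeroExtend_h (l : L) {γ : M → ℝ} (hγ : γ ∈ S.box C.α) :
    C.zeroExtend.h l γ = C.h l γ :=
  Set.indicator_of_mem hγ _

theorem measurable_zeroExtend_f : Measurable C.zeroExtend.f := by
  classical
  rw [show C.zeroExtend.f = _ from (Set.piecewise_eq_indicator (f := C.f)).symm]
  exact C.continuousOn_f.measurable_piecewise continuousOn_const (S.measurableSet_box _)

theorem measurable_zeroExtend_h (l : L) : Measurable (C.zeroExtend.h l) := by
  classical
  rw [show C.zeroExtend.h l = _ from (Set.piecewise_eq_indicator (f := C.h l)).symm]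
  exact (C.continuousOn_h l).measurable_piecewise continuousOn_const (S.measurableSet_box _)

end Program

section Admissible

variable {N M L W A Z : Type u} [MeasurableSpace W] [MeasurableSpace A] [MeasurableSpace Z]

/-- The bounds obeyed by the auxiliary vector `γ` and by the services, arrivals and penalties at
`q = (I, Ω, z)` when `I` is feasible. Unlike feasibility itself, they define a measurable set. -/
def Network.Admissible (S : Network N M W A Z) (α : ℝ) (q : A × (W × Bool) × Z) (γ : M → ℝ) :
    Prop :=
  γ ∈ S.box α ∧ (∀ n, 0 ≤ S.μhat n q ∧ S.μhat n q ≤ S.μmax n) ∧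
    (∀ n, 0 ≤ S.Rhat n q ∧ S.Rhat n q ≤ S.Rmax n) ∧
    ∀ m, S.xmin m ≤ S.xhat m q ∧ S.xhat m q ≤ S.xmax m

theorem Network.measurableSet_admissible [Countable N] [Countable M] (S : Network N M W A Z)
    (α : ℝ) : MeasurableSet {x : (A × (W × Bool) × Z) × (M → ℝ) | S.Admissible α x.1 x.2} := by
  have between (g : A × (W × Bool) × Z → ℝ) (hg : Measurable g) (a b : ℝ) :
      Measurable fun x : (A × (W × Bool) × Z) × (M → ℝ) => a ≤ g x.1 ∧ g x.1 ≤ b :=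
    have hg' := hg.comp (measurable_fst (β := M → ℝ))
    (measurableSet_le measurable_const hg').mem.and (measurableSet_le hg' measurable_const).mem
  exact ((measurable_snd (S.measurableSet_box α)).mem.and
    ((Measurable.forall fun n => between _ (S.μhat_meas n) _ _).and
      ((Measurable.forall fun n => between _ (S.Rhat_meas n) _ _).and
        (Measurable.forall fun m => between _ (S.xhat_meas m) _ _)))).setOf

variable [Fintype M] {S : Network N M W A Z} {C : Program S L} {π : Policy S C} {t : ℕ}
  {μ : Measure (Path N M L W A Z)} [IsProbabilityMeasure μ]

theorem EvolvesFrom.ae_slot (hμ : EvolvesFrom π.step t μ) {P : Z × Slot M W A Z → Prop}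
    (hPm : MeasurableSet {x | P x})
    (hP : ∀ (τ : ℕ) (h : Hist N M L W A Z τ) (Ω : W × Bool), ∀ᵐ d ∂π.act τ (h, Ω),
      ∀ᵐ z ∂S.trans (d.1, Ω, histState S τ h), P (histState S τ h, ((Ω, d), z))) :
    ∀ᵐ p ∂μ, ∀ τ, t ≤ τ → P (state S p τ, slotRec (p (τ + 1))) := by
  refine ae_all_iff.2 fun τ => ?_
  by_cases hτ : t ≤ τ
  swap
  · exact ae_of_all _ fun p h => absurd h hτ
  have hm : Measurable fun x : Hist N M L W A Z τ × Coord N M L W A Z (τ + 1) =>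
      (histState S τ x.1, slotRec x.2) :=
    ((measurable_histState S τ).comp measurable_fst).prodMk
      ((measurable_slotRec τ).comp measurable_snd)
  have hstep := hμ.ae_succ hτ (P := fun x => P (histState S τ x.1, slotRec x.2)) (hm hPm)
    fun h => π.ae_step (P := fun x => P (histState S τ h, x)) (measurable_prodMk_left hPm) (hP τ h)
  filter_upwards [hstep] with p hp _
  rwa [state_eq_histState]

theorem EvolvesFrom.ae_admissible [Countable N] (hμ : EvolvesFrom π.step t μ) :
    ∀ᵐ p ∂μ, ∀ τ, t ≤ τ → S.Admissible C.α (point S p τ) (aux p τ) := by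
  refine hμ.ae_slot (P := fun x => S.Admissible C.α (x.2.1.2.1, x.2.1.1, x.1) x.2.1.2.2)
    ?_ fun τ h Ω => ?_
  · have hm : Measurable fun x : Z × Slot M W A Z =>
        (((x.2.1.2.1, x.2.1.1, x.1), x.2.1.2.2) : (A × (W × Bool) × Z) × (M → ℝ)) := by fun_prop
    exact hm (S.measurableSet_admissible C.α)
  · filter_upwards [π.act_mem τ h Ω] with d hd
    exact ae_of_all _ fun _ => ⟨hd.2, fun n => S.μhat_bd n _ _ _ hd.1,
      fun n => S.Rhat_bd n _ _ _ hd.1, fun m => S.xhat_bd m _ _ _ hd.1⟩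

theorem EvolvesFrom.ae_state_succ_eq_zero (hμ : EvolvesFrom π.step t μ)
    (hZ : MeasurableSet {S.zero}) :
    ∀ᵐ p ∂μ, ∀ τ, t ≤ τ → (outcome p τ).2 = true → state S p (τ + 1) = S.zero := by
  refine hμ.ae_slot (P := fun x => x.2.1.1.2 = true → x.2.2 = S.zero) ?_ fun τ h Ω => ?_
  · have hφ : Measurable fun x : Z × Slot M W A Z => x.2.1.1.2 := by fun_prop
    exact MeasurableSet.imp (hφ (measurableSet_singleton true)) (measurable_snd.snd hZ)
  · obtain ⟨ω, b⟩ := Ω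
    filter_upwards [π.act_mem τ h (ω, b)] with d hd
    rcases b with _ | _
    · exact ae_of_all _ fun _ hφ => absurd hφ Bool.false_ne_true
    · rw [S.forced ω _ d.1 hd.1]
      filter_upwards [(ae_dirac_iff (p := fun z => z = S.zero) hZ).2 rfl] with z hz _ using hz

end Admissible

/-! ### Lyapunov drift along a sample path -/

section QueueRecursions

theorem sq_sum_range_le (a : ℕ → ℝ) (k : ℕ) :
    (∑ i ∈ Finset.range k, a i) ^ 2 ≤ k * ∑ i ∈ Finset.range k, a i ^ 2 := by
  simpa using sq_sum_le_card_mul_sum_sq (s := Finset.range k) (f := a)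

theorem sq_max_zero_le (x : ℝ) : max x 0 ^ 2 ≤ x ^ 2 :=
  sq_le_sq.2 (by simpa using abs_max_sub_max_le_abs x 0 0)

theorem queue_bounds {q a b : ℕ → ℝ} {k : ℕ} (h0 : 0 ≤ q 0) (ha : ∀ i < k, 0 ≤ a i)
    (hb : ∀ i < k, 0 ≤ b i) (hq : ∀ i < k, q (i + 1) = max (q i - a i) 0 + b i) :
    0 ≤ q k ∧ q 0 - ∑ i ∈ Finset.range k, a i ≤ q k ∧ q k ≤ q 0 + ∑ i ∈ Finset.range k, b i := by
  induction k with
  | zero => simp [h0]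
  | succ k ih =>
    obtain ⟨hnonneg, hlower, hupper⟩ := ih (fun i hi => ha i (by lia)) (fun i hi => hb i (by lia))
      fun i hi => hq i (by lia)
    have hak := ha k k.lt_succ_self
    have hbk := hb k k.lt_succ_self
    simp only [Finset.sum_range_succ, hq k k.lt_succ_self]
    have hmax := max_le (a := q k - a k) (b := 0) (c := q k) (by linarith) hnonneg
    have := le_max_left (q k - a k) 0
    have := le_max_right (q k - a k) 0
    exact ⟨by linarith, by linarith, by linarith⟩

theorem queue_sq_le {q a b : ℕ → ℝ} {k : ℕ} (h0 : 0 ≤ q 0) (ha : ∀ i < k, 0 ≤ a i)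
    (hb : ∀ i < k, 0 ≤ b i) (hq : ∀ i < k, q (i + 1) = max (q i - a i) 0 + b i) :
    q k ^ 2 ≤ q 0 ^ 2 - 2 * (q 0 * ∑ i ∈ Finset.range k, (a i - b i)) +
      k * ∑ i ∈ Finset.range k, (a i ^ 2 + b i ^ 2) := by
  suffices hsq : q k ^ 2 ≤ q 0 ^ 2 - 2 * (q 0 * ∑ i ∈ Finset.range k, (a i - b i)) +
      (∑ i ∈ Finset.range k, a i) ^ 2 + (∑ i ∈ Finset.range k, b i) ^ 2 by
    rw [Finset.sum_add_distrib, mul_add]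
    linarith [sq_sum_range_le a k, sq_sum_range_le b k]
  induction k with
  | zero => simp
  | succ k ih =>
    have ha' : ∀ i < k, 0 ≤ a i := fun i hi => ha i (by lia)
    have hb' : ∀ i < k, 0 ≤ b i := fun i hi => hb i (by lia)
    have hq' : ∀ i < k, q (i + 1) = max (q i - a i) 0 + b i := fun i hi => hq i (by lia)
    obtain ⟨hnonneg, hlower, hupper⟩ := queue_bounds h0 ha' hb' hq'
    have hsq := ih ha' hb' hq'
    have hak := ha k k.lt_succ_self
    have hbk := hb k k.lt_succ_self
    simp only [Finset.sum_range_succ, hq k k.lt_succ_self]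
    have hmax : max (q k - a k) 0 ≤ q k := max_le (by linarith) hnonneg
    nlinarith [mul_le_mul_of_nonneg_right hmax hbk, mul_nonneg (sub_nonneg.2 hupper) hbk,
      mul_nonneg (sub_nonneg.2 hlower) hak, sq_max_zero_le (q k - a k)]

theorem reflected_sq_le {y a : ℕ → ℝ} {k : ℕ} (h0 : 0 ≤ y 0)
    (hy : ∀ i < k, y (i + 1) = max (y i - a i) 0) :
    y k ^ 2 ≤ y 0 ^ 2 - 2 * (y 0 * ∑ i ∈ Finset.range k, a i) +
      k * ∑ i ∈ Finset.range k, a i ^ 2 := by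
  suffices H : 0 ≤ y k ∧ |y k - y 0| ≤ ∑ i ∈ Finset.range k, |a i| ∧
      y k ^ 2 ≤ y 0 ^ 2 - 2 * (y 0 * ∑ i ∈ Finset.range k, a i) +
        (∑ i ∈ Finset.range k, |a i|) ^ 2 by
    have := sq_sum_range_le (fun i => |a i|) k
    simp only [sq_abs] at this
    linarith [H.2.2]
  induction k with
  | zero => simp [h0]
  | succ k ih =>
    obtain ⟨hnonneg, hdist, hsq⟩ := ih fun i hi => hy i (by lia)
    simp only [Finset.sum_range_succ, hy k k.lt_succ_self]
    refine ⟨le_max_right _ _, ?_, ?_⟩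
    · have hstep : |max (y k - a k) 0 - y k| ≤ |a k| := by
        simpa [max_eq_left hnonneg] using abs_max_sub_max_le_abs (y k - a k) (y k) 0
      linarith [abs_sub_le (max (y k - a k) 0) (y k) (y 0)]
    · have hcross : -((y k - y 0) * a k) ≤ (∑ i ∈ Finset.range k, |a i|) * |a k| :=
        (neg_le_abs _).trans (by rw [abs_mul]; gcongr)
      nlinarith [sq_abs (a k), sq_max_zero_le (y k - a k)]

theorem balance_sq_le {w a : ℕ → ℝ} {k : ℕ} (hw : ∀ i < k, w (i + 1) = w i - a i) :
    w k ^ 2 ≤ w 0 ^ 2 - 2 * (w 0 * ∑ i ∈ Finset.range k, a i) +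
      k * ∑ i ∈ Finset.range k, a i ^ 2 := by
  have hsum : w k = w 0 - ∑ i ∈ Finset.range k, a i := by
    have := Finset.sum_congr rfl fun i hi => hw i (Finset.mem_range.1 hi)
    have htele := Finset.sum_range_sub w k
    rw [Finset.sum_sub_distrib, this, Finset.sum_sub_distrib] at htele
    linarith
  rw [hsum]
  nlinarith [sq_sum_range_le a k]

theorem abs_le_abs_add_of_step {g : ℕ → ℝ} {b : ℝ} {s : ℕ}
    (hg : ∀ τ, s ≤ τ → |g (τ + 1) - g τ| ≤ b) {t : ℕ} (hst : s ≤ t) :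
    |g s| ≤ |g t| + ((t - s : ℕ) : ℝ) * b := by
  induction t, hst using Nat.le_induction with
  | base => simp
  | succ t ht ih =>
    have hstep : |g t| ≤ |g (t + 1)| + b := by
      linarith [hg t ht, abs_sub_abs_le_abs_sub (g t) (g (t + 1)), abs_sub_comm (g t) (g (t + 1))]
    rw [Nat.succ_sub ht]
    push_cast
    linarith

theorem sum_le_of_forall_le_sub_add {ι : Type*} [Fintype ι] {u v w : ι → ℝ} {e : ι → ℕ → ℝ}
    {k : ℕ} (h : ∀ j, u j ≤ v j - 2 * w j + k * ∑ i ∈ Finset.range k, e j i) :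
    ∑ j, u j ≤ ∑ j, v j - 2 * ∑ j, w j + k * ∑ i ∈ Finset.range k, ∑ j, e j i := by
  rw [Finset.sum_comm (s := Finset.range k), Finset.mul_sum, Finset.mul_sum,
    ← Finset.sum_sub_distrib, ← Finset.sum_add_distrib]
  exact Finset.sum_le_sum fun j _ => h j

end QueueRecursions

section Backlog

variable {N M L W A Z : Type u} [MeasurableSpace W] [MeasurableSpace A] [MeasurableSpace Z]
  [Fintype M] {S : Network N M W A Z} {C : Program S L} {p : Path N M L W A Z}

theorem backlog_zeroExtend {t : ℕ} (hp : ∀ τ < t, aux p τ ∈ S.box C.α) :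
    backlog S C.zeroExtend p t = backlog S C p t := by
  induction t with
  | zero => rfl
  | succ t ih =>
    simp only [backlog, ih fun τ hτ => hp τ (by lia), C.zeroExtend_h _ (hp t t.lt_succ_self)]
    rfl

theorem backlog_nonneg (h0 : (∀ n, 0 ≤ (p 0 : Backlog N M L).1 n) ∧
    ∀ l, 0 ≤ (p 0 : Backlog N M L).2.1 l) {t : ℕ}
    (hp : ∀ τ < t, S.Admissible C.α (point S p τ) (aux p τ)) :
    (∀ n, 0 ≤ (backlog S C p t).1 n) ∧ ∀ l, 0 ≤ (backlog S C p t).2.1 l := by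
  cases t with
  | zero => exact h0
  | succ t =>
    exact ⟨fun n => add_nonneg (le_max_right _ _) ((hp t t.lt_succ_self).2.2.1 n).1,
      fun l => le_max_right _ _⟩

theorem abs_queue_step_le {t : ℕ} (hp : S.Admissible C.α (point S p t) (aux p t)) {n : N}
    (h0 : 0 ≤ (backlog S C p t).1 n) :
    |(backlog S C p (t + 1)).1 n - (backlog S C p t).1 n| ≤ S.μmax n + S.Rmax n := by
  obtain ⟨hμ0, hμ⟩ := hp.2.1 n
  obtain ⟨hR0, hR⟩ := hp.2.2.1 n
  simp only [backlog]
  rcases max_cases ((backlog S C p t).1 n - S.μhat n (point S p t)) 0 with ⟨h, _⟩ | ⟨h, _⟩ <;>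
    rw [h, abs_le] <;> constructor <;> linarith

theorem queue_le_succ_add {t : ℕ} (hp : S.Admissible C.α (point S p t) (aux p t)) (n : N) :
    (backlog S C p t).1 n ≤ (backlog S C p (t + 1)).1 n + S.μmax n := by
  simp only [backlog]
  linarith [(hp.2.1 n).2, (hp.2.2.1 n).1,
    le_max_left ((backlog S C p t).1 n - S.μhat n (point S p t)) 0]

theorem abs_virtual_step_le {t : ℕ} {l : L} {b : ℝ} (hb : ∀ γ ∈ S.box C.α, |C.h l γ| ≤ b)
    (hp : aux p t ∈ S.box C.α) (h0 : 0 ≤ (backlog S C p t).2.1 l) :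
    |(backlog S C p (t + 1)).2.1 l - (backlog S C p t).2.1 l| ≤ |C.c l| + b := by
  set y := (backlog S C p t).2.1 l
  have hstep := abs_max_sub_max_le_abs (y - C.c l + C.h l (aux p t)) y 0
  rw [max_eq_left h0, show y - C.c l + C.h l (aux p t) - y = C.h l (aux p t) - C.c l by ring]
    at hstep
  calc |max (y - C.c l + C.h l (aux p t)) 0 - y| ≤ |C.h l (aux p t) - C.c l| := hstep
    _ ≤ |C.h l (aux p t)| + |C.c l| := abs_sub _ _
    _ ≤ |C.c l| + b := by linarith [hb _ hp]

theorem abs_aux_sub_le {t : ℕ} (hp : S.Admissible C.α (point S p t) (aux p t)) (m : M) :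
    |aux p t m - S.xhat m (point S p t)| ≤ S.xmax m - S.xmin m + C.α := by
  obtain ⟨hγmin, hγmax⟩ := hp.1 m
  obtain ⟨hxmin, hxmax⟩ := hp.2.2.2 m
  exact abs_le.2 ⟨by linarith, by linarith⟩

end Backlog

section Lyapunov

variable {N M L : Type u} [Fintype N] [Fintype M] [Fintype L] (θ : Backlog N M L)

theorem lyapunov_nonneg : 0 ≤ lyapunov θ := by
  unfold lyapunov
  positivity

theorem sq_queue_le_two_mul_lyapunov (n : N) : θ.1 n ^ 2 ≤ 2 * lyapunov θ := by
  have := Finset.single_le_sum (fun i _ => sq_nonneg (θ.1 i)) (Finset.mem_univ n)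
  have : 0 ≤ ∑ l, θ.2.1 l ^ 2 + ∑ m, θ.2.2 m ^ 2 := by positivity
  unfold lyapunov
  linarith

theorem sq_virtual_le_two_mul_lyapunov (l : L) : θ.2.1 l ^ 2 ≤ 2 * lyapunov θ := by
  have := Finset.single_le_sum (fun i _ => sq_nonneg (θ.2.1 i)) (Finset.mem_univ l)
  have : 0 ≤ ∑ n, θ.1 n ^ 2 + ∑ m, θ.2.2 m ^ 2 := by positivity
  unfold lyapunov
  linarith

theorem sq_balance_le_two_mul_lyapunov (m : M) : θ.2.2 m ^ 2 ≤ 2 * lyapunov θ := by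
  have := Finset.single_le_sum (fun i _ => sq_nonneg (θ.2.2 i)) (Finset.mem_univ m)
  have : 0 ≤ ∑ n, θ.1 n ^ 2 + ∑ l, θ.2.1 l ^ 2 := by positivity
  unfold lyapunov
  linarith

end Lyapunov

section SamplePathDrift

variable {N M L W A Z : Type u} [MeasurableSpace W] [MeasurableSpace A] [MeasurableSpace Z]
  [Fintype N] [Fintype M] [Fintype L] {S : Network N M W A Z} {C : Program S L}

/-- The expression in square brackets in the definition of the drift constant `B₂`: a bound
for the sum of the squared changes of all queues in one slot. -/
noncomputable def slotCost (S : Network N M W A Z) (C : Program S L) (q : A × (W × Bool) × Z)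
    (γ : M → ℝ) : ℝ :=
  ∑ n, (S.μhat n q ^ 2 + S.Rhat n q ^ 2) + ∑ m, (γ m - S.xhat m q) ^ 2 +
    ∑ l, (C.h l γ - C.c l) ^ 2

/-- The part of the Lyapunov drift over the slots `s, …, s + k - 1` which is linear in the backlogs
at the time `s`, i.e. the drift-plus-penalty expression without the penalty. -/
noncomputable def driftTerm (S : Network N M W A Z) (C : Program S L) (p : Path N M L W A Z)
    (s k : ℕ) : ℝ :=
  - ∑ n, (backlog S C p s).1 n * ∑ i ∈ Finset.range k, S.dhat n (point S p (s + i))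
    - ∑ m, (backlog S C p s).2.2 m *
        ∑ i ∈ Finset.range k, (aux p (s + i) m - S.xhat m (point S p (s + i)))
    - ∑ l, (backlog S C p s).2.1 l * ∑ i ∈ Finset.range k, (C.c l - C.h l (aux p (s + i)))

theorem measurable_slotCost {β : Type*} [MeasurableSpace β] (hC : ∀ l, Measurable (C.h l))
    {q : β → A × (W × Bool) × Z} (hq : Measurable q) {γ : β → M → ℝ} (hγ : Measurable γ) :
    Measurable fun x => slotCost S C (q x) (γ x) := by
  have hμ := S.μhat_meas
  have hR := S.Rhat_meas
  have hx := S.xhat_meas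
  unfold slotCost
  fun_prop

variable {p : Path N M L W A Z} {s k : ℕ}

theorem lyapunov_add_le_sum_slotCost
    (hp : ∀ i < k, S.Admissible C.α (point S p (s + i)) (aux p (s + i)))
    (hQ : ∀ n, 0 ≤ (backlog S C p s).1 n) (hY : ∀ l, 0 ≤ (backlog S C p s).2.1 l) :
    lyapunov (backlog S C p (s + k)) ≤ lyapunov (backlog S C p s) + driftTerm S C p s k +
      k * (∑ i ∈ Finset.range k, slotCost S C (point S p (s + i)) (aux p (s + i))) / 2 := by
  have hqueue := sum_le_of_forall_le_sub_add fun n =>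
    queue_sq_le (q := fun i => (backlog S C p (s + i)).1 n)
      (hQ n) (fun i hi => ((hp i hi).2.1 n).1) (fun i hi => ((hp i hi).2.2.1 n).1) fun i _ => rfl
  have hvirtual := sum_le_of_forall_le_sub_add fun l =>
    reflected_sq_le (y := fun i => (backlog S C p (s + i)).2.1 l)
      (a := fun i => C.c l - C.h l (aux p (s + i))) (k := k) (hY l) fun i _ => by
        rw [← sub_add]
        rfl
  have hbalance := sum_le_of_forall_le_sub_add fun m =>
    balance_sq_le (w := fun i => (backlog S C p (s + i)).2.2 m)
      (a := fun i => aux p (s + i) m - S.xhat m (point S p (s + i))) (k := k) fun i _ => by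
        rw [← sub_add]
        rfl
  have hcost : ∑ i ∈ Finset.range k, slotCost S C (point S p (s + i)) (aux p (s + i)) =
      ∑ i ∈ Finset.range k, ∑ n, (S.μhat n (point S p (s + i)) ^ 2 +
        S.Rhat n (point S p (s + i)) ^ 2) +
      ∑ i ∈ Finset.range k, ∑ m, (aux p (s + i) m - S.xhat m (point S p (s + i))) ^ 2 +
      ∑ i ∈ Finset.range k, ∑ l, (C.c l - C.h l (aux p (s + i))) ^ 2 := by
    simp only [slotCost, Finset.sum_add_distrib, sub_sq_comm (C.c _)]
  simp only [add_zero] at hqueue hvirtual hbalance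
  simp only [hcost, lyapunov, driftTerm, Network.dhat]
  linarith

theorem lyapunov_add_le_driftTerm {κ : ℝ}
    (hp : ∀ i < k, S.Admissible C.α (point S p (s + i)) (aux p (s + i)))
    (hQ : ∀ n, 0 ≤ (backlog S C p s).1 n) (hY : ∀ l, 0 ≤ (backlog S C p s).2.1 l)
    (hκ : ∀ i < k, slotCost S C (point S p (s + i)) (aux p (s + i)) ≤ κ) :
    lyapunov (backlog S C p (s + k)) ≤
      lyapunov (backlog S C p s) + driftTerm S C p s k + κ * (k : ℝ) ^ 2 / 2 := by
  have hsum : ∑ i ∈ Finset.range k, slotCost S C (point S p (s + i)) (aux p (s + i)) ≤ k * κ := by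
    simpa using Finset.sum_le_sum fun i hi => hκ i (Finset.mem_range.1 hi)
  nlinarith [lyapunov_add_le_sum_slotCost hp hQ hY, mul_le_mul_of_nonneg_left hsum k.cast_nonneg]

end SamplePathDrift

/-! ### Renewal intervals -/

theorem enat_coe_eq_tsum_indicator (n : ℕ∞) :
    (n : ℝ≥0∞) = ∑' k : ℕ, {k : ℕ | (k : ℕ∞) < n}.indicator 1 k := by
  induction n with
  | top => simp
  | coe n =>
    have hset : {k : ℕ | (k : ℕ∞) < n} = Finset.range n := by
      ext k
      simp
    rw [hset, ← sum_eq_tsum_indicator]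
    simp

theorem lintegral_enat_eq_tsum {α : Type*} [MeasurableSpace α] (μ : Measure α) {T : α → ℕ∞}
    (hT : Measurable T) : ∫⁻ x, (T x : ℝ≥0∞) ∂μ = ∑' k : ℕ, μ {x | (k : ℕ∞) < T x} := by
  have hlt (k : ℕ) : MeasurableSet {x | (k : ℕ∞) < T x} :=
    hT (MeasurableSet.of_discrete (s := Set.Ioi (k : ℕ∞)))
  have hsum (x : α) : (T x : ℝ≥0∞) = ∑' k : ℕ, {x | (k : ℕ∞) < T x}.indicator 1 x :=
    enat_coe_eq_tsum_indicator (T x)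
  simp only [hsum]
  rw [lintegral_tsum fun k => (measurable_one.indicator (hlt k)).aemeasurable]
  exact tsum_congr fun k => lintegral_indicator_one (hlt k)

theorem measurable_comp_nat {α β : Type*} [MeasurableSpace α] [MeasurableSpace β] {ν : α → ℕ}
    (hν : Measurable ν) {g : ℕ → α → β} (hg : ∀ s, Measurable (g s)) :
    Measurable fun x => g (ν x) x :=
  (measurable_from_prod_countable_right (f := fun y : ℕ × α => g y.1 y.2) hg).comp
    (hν.prodMk measurable_id)

section RenewalIntervals

variable {N M L W A Z : Type u} {R : RenewalRule N M L W A Z} {p : Path N M L W A Z} {t : ℕ}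

theorem frameLength_le {k : ℕ} (hk : 1 ≤ k) (hp : RenewsAt R p (t + k)) :
    frameLength R t p ≤ k :=
  iInf₂_le k ⟨hk, hp⟩

theorem coe_lt_frameLength_iff {k : ℕ} :
    (k : ℕ∞) < frameLength R t p ↔ ∀ j, 1 ≤ j → j ≤ k → ¬ RenewsAt R p (t + j) := by
  refine ⟨fun hk j hj hjk hp => ?_, fun hk => ?_⟩
  · exact absurd (hk.trans_le (frameLength_le hj hp)) (by simpa using hjk)
  · rw [← ENat.add_one_le_iff (ENat.natCast_ne_top k)]
    refine le_iInf₂ fun j hj => ?_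
    have : k < j := not_le.1 fun hjk => hk j hj.1 hjk hj.2
    exact_mod_cast this

theorem frameLength_ne_zero : frameLength R t p ≠ 0 :=
  have : ((0 : ℕ) : ℕ∞) < frameLength R t p := coe_lt_frameLength_iff.2 fun j hj hj0 => by lia
  this.ne'

theorem frameLength_eq_succ_iff {k : ℕ} : frameLength R t p = (k + 1 : ℕ) ↔
    (k : ℕ∞) < frameLength R t p ∧ RenewsAt R p (t + (k + 1)) := by
  refine ⟨fun hk => ?_, fun ⟨hk, hp⟩ => le_antisymm (frameLength_le k.succ_pos hp) ?_⟩
  · have hlt : (k : ℕ∞) < frameLength R t p := hk ▸ by exact_mod_cast k.lt_succ_self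
    refine ⟨hlt, by_contra fun hp => ?_⟩
    have : ((k + 1 : ℕ) : ℕ∞) < frameLength R t p := coe_lt_frameLength_iff.2 fun j hj hjk =>
      (Nat.le_succ_iff.1 hjk).elim (coe_lt_frameLength_iff.1 hlt j hj) fun hjk => hjk ▸ hp
    exact this.ne' hk
  · exact_mod_cast (ENat.add_one_le_iff (ENat.natCast_ne_top k)).2 hk

/-- The length of the renewal interval that starts at `t` as a natural number, with the value `0`
if the interval is infinite. -/
noncomputable def frameNat (R : RenewalRule N M L W A Z) (t : ℕ) (p : Path N M L W A Z) : ℕ :=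
  (frameLength R t p).toNat

theorem toReal_frameLength : (frameLength R t p : ℝ≥0∞).toReal = frameNat R t p := by
  unfold frameNat
  induction frameLength R t p with
  | top => simp
  | coe k => simp

theorem coe_frameNat (hp : frameLength R t p < ⊤) : (frameNat R t p : ℕ∞) = frameLength R t p :=
  ENat.natCast_toNat hp.ne

theorem one_le_frameNat (hp : frameLength R t p < ⊤) : 1 ≤ frameNat R t p :=
  Nat.one_le_iff_ne_zero.2 fun h0 => frameLength_ne_zero (by rw [← coe_frameNat hp, h0]; rfl)

theorem frameNat_eq_succ_iff {k : ℕ} (hp : frameLength R t p < ⊤) : frameNat R t p = k + 1 ↔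
    (k : ℕ∞) < frameLength R t p ∧ RenewsAt R p (t + (k + 1)) := by
  rw [← frameLength_eq_succ_iff, ← coe_frameNat hp, ENat.natCast_inj]

theorem renewsAt_add_frameNat (hp : frameLength R t p < ⊤) : RenewsAt R p (t + frameNat R t p) := by
  obtain ⟨k, hk⟩ := Nat.exists_eq_add_of_le' (one_le_frameNat hp)
  exact hk ▸ ((frameNat_eq_succ_iff hp).1 hk).2

theorem frameNat_eq_one (hp : RenewsAt R p (t + 1)) : frameNat R t p = 1 := by
  have hle := frameLength_le le_rfl hp
  exact (frameNat_eq_succ_iff (hle.trans_lt (ENat.natCast_lt_top 1))).2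
    ⟨pos_iff_ne_zero.2 frameLength_ne_zero, hp⟩

theorem frameNat_eq_frameNat_succ_add_one (hfin : frameLength R (t + 1) p < ⊤)
    (hp : ¬ RenewsAt R p (t + 1)) : frameNat R t p = frameNat R (t + 1) p + 1 := by
  obtain ⟨k, hk⟩ := Nat.exists_eq_add_of_le' (one_le_frameNat hfin)
  obtain ⟨hlt, hren⟩ := (frameNat_eq_succ_iff hfin).1 hk
  rw [add_right_comm, add_assoc] at hren
  have hle := frameLength_le (by lia) hren
  rw [hk, frameNat_eq_succ_iff (hle.trans_lt (ENat.natCast_lt_top _)), coe_lt_frameLength_iff]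
  refine ⟨fun j hj hjk => ?_, hren⟩
  obtain ⟨i, rfl⟩ := Nat.exists_eq_add_of_le hj
  rcases i.eq_zero_or_pos with rfl | hi
  · exact hp
  · rw [← add_assoc]
    exact coe_lt_frameLength_iff.1 hlt i hi (by lia)

/-- The first renewal time which is not smaller than `t`, if `0` is a renewal time. -/
noncomputable def nextRenewal (R : RenewalRule N M L W A Z) (p : Path N M L W A Z) : ℕ → ℕ
  | 0 => 0
  | t + 1 => t + frameNat R t p

theorem le_nextRenewal (hfin : ∀ s, frameLength R s p < ⊤) : t ≤ nextRenewal R p t := by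
  cases t with
  | zero => exact le_rfl
  | succ t => exact Nat.add_le_add_left (one_le_frameNat (hfin t)) t

theorem nextRenewal_of_renewsAt (hp : RenewsAt R p t) : nextRenewal R p t = t := by
  cases t with
  | zero => rfl
  | succ t => rw [nextRenewal, frameNat_eq_one hp]

theorem nextRenewal_succ_of_not_renewsAt (h0 : RenewsAt R p 0)
    (hfin : ∀ s, frameLength R s p < ⊤) (hp : ¬ RenewsAt R p t) :
    nextRenewal R p (t + 1) = nextRenewal R p t := by
  cases t with
  | zero => exact absurd h0 hp
  | succ t =>
    rw [nextRenewal, nextRenewal, frameNat_eq_frameNat_succ_add_one (hfin _) hp]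
    lia

variable [MeasurableSpace W] [MeasurableSpace A] [MeasurableSpace Z]

theorem measurableSet_renewsAt (hR : ∀ t, MeasurableSet (R t)) {s t : ℕ} (hst : s ≤ t) :
    MeasurableSet[Filtration.piLE t] {p : Path N M L W A Z | RenewsAt R p s} := by
  refine Filtration.piLE.mono hst _ ?_
  rw [Filtration.piLE_eq_comap_frestrictLe]
  exact ⟨R s, hR s, rfl⟩

theorem measurableSet_coe_lt_frameLength (hR : ∀ t, MeasurableSet (R t)) (t k : ℕ) :
    MeasurableSet[Filtration.piLE (t + k)]
      {p : Path N M L W A Z | (k : ℕ∞) < frameLength R t p} := by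
  simp only [coe_lt_frameLength_iff, Set.ofPred_forall]
  exact MeasurableSet.iInter fun j => MeasurableSet.iInter fun _ => MeasurableSet.iInter fun hj =>
    (measurableSet_renewsAt hR (Nat.add_le_add_left hj t)).compl

theorem measurable_frameLength (hR : ∀ t, MeasurableSet (R t)) (t : ℕ) :
    Measurable (frameLength R t) := by
  refine ENat.measurable_iff.2 fun k => ?_
  cases k with
  | zero =>
    convert MeasurableSet.empty
    exact Set.eq_empty_of_forall_notMem fun p hp => frameLength_ne_zero hp
  | succ k =>
    have hset : frameLength R t ⁻¹' {((k + 1 : ℕ) : ℕ∞)} =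
        {p | (k : ℕ∞) < frameLength R t p} ∩ {p | RenewsAt R p (t + (k + 1))} :=
      Set.ext fun p => frameLength_eq_succ_iff
    rw [hset]
    exact (Filtration.piLE.le _ _ (measurableSet_coe_lt_frameLength hR t k)).inter
      (Filtration.piLE.le _ _ (measurableSet_renewsAt hR le_rfl))

theorem measurable_frameNat (hR : ∀ t, MeasurableSet (R t)) (t : ℕ) : Measurable (frameNat R t) :=
  (measurable_of_countable ENat.toNat).comp (measurable_frameLength hR t)

theorem measurable_coe_frameLength (hR : ∀ t, MeasurableSet (R t)) (t : ℕ) :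
    Measurable fun p => (frameLength R t p : ℝ≥0∞) :=
  (measurable_of_countable ENat.toENNReal).comp (measurable_frameLength hR t)

theorem measurable_nextRenewal (hR : ∀ t, MeasurableSet (R t)) (t : ℕ) :
    Measurable fun p => nextRenewal R p t := by
  cases t with
  | zero => exact measurable_const
  | succ t => exact measurable_const.add (measurable_frameNat hR t)

end RenewalIntervals

/-- Renewals at measurably decided times, the first of them at time `0`, such that the second
moment, hence also the mean, of the time until the next renewal is bounded under every policy,
regardless of the past. -/
structure HasBoundedMoments {N M L W A Z : Type u} [Fintype M] [MeasurableSpace W]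
    [MeasurableSpace A] [MeasurableSpace Z] (S : Network N M W A Z) (C : Program S L)
    (R : RenewalRule N M L W A Z) : Prop where
  meas : ∀ t, MeasurableSet (R t)
  start : R 0 = Set.univ
  second_moment : ∃ m : ℝ≥0, ∀ (π : Policy S C) (t : ℕ), ∀ h ∈ R t,
    ∫⁻ p, (frameLength R t p : ℝ≥0∞) ^ 2 ∂π.lawFrom t h ≤ m

theorem IsRenewalDefinition.hasBoundedMoments {N M L W A Z : Type u} [Fintype M]
    [MeasurableSpace W] [MeasurableSpace A] [MeasurableSpace Z] {S : Network N M W A Z}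
    {C : Program S L} {R : RenewalRule N M L W A Z} (hR : IsRenewalDefinition S C R) :
    HasBoundedMoments S C R where
  meas := hR.meas
  start := hR.start
  second_moment := by
    obtain ⟨_, m, hm⟩ := hR.moments
    exact ⟨m, fun π t h hh => (hm π t h hh).2⟩

namespace HasBoundedMoments

variable {N M L W A Z : Type u} [Fintype M] [MeasurableSpace W] [MeasurableSpace A]
  [MeasurableSpace Z] {S : Network N M W A Z} {C : Program S L} {R : RenewalRule N M L W A Z}

theorem renewsAt_zero (hR : HasBoundedMoments S C R) (p : Path N M L W A Z) : RenewsAt R p 0 := by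
  rw [RenewsAt, hR.start]
  trivial

variable {t : ℕ} {h : Hist N M L W A Z t}

theorem ae_frameLength_lt_top (hR : HasBoundedMoments S C R) (π : Policy S C) (hh : h ∈ R t) :
    ∀ᵐ p ∂π.lawFrom t h, frameLength R t p < ⊤ := by
  obtain ⟨m, hm⟩ := hR.second_moment
  have hfin := ae_lt_top ((measurable_coe_frameLength hR.meas t).pow_const 2)
    ((hm π t h hh).trans_lt ENNReal.coe_lt_top).ne
  filter_upwards [hfin] with p hp
  exact ENat.toENNReal_lt_top.1 ((ENNReal.pow_lt_top_iff.1 hp).resolve_right two_ne_zero)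

theorem ae_frameLength_lt_top_of_evolvesFrom (hR : HasBoundedMoments S C R) {π : Policy S C}
    {μ : Measure (Path N M L W A Z)} [IsProbabilityMeasure μ] (hμ : EvolvesFrom π.step 0 μ) :
    ∀ᵐ p ∂μ, ∀ t, frameLength R t p < ⊤ := by
  have hren (t : ℕ) : ∀ᵐ p ∂μ, RenewsAt R p t → frameLength R t p < ⊤ := by
    have htop : MeasurableSet {p | frameLength R t p = ⊤} :=
      measurable_frameLength hR.meas t (measurableSet_singleton ⊤)
    have hE := measurableSet_renewsAt hR.meas (le_refl t)
    have hzero := hμ.setLIntegral t.zero_le hE (measurable_one.indicator htop)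
    rw [lintegral_indicator_one htop, Measure.restrict_apply htop,
      setLIntegral_congr_fun (g := 0) (Filtration.piLE.le t _ hE), lintegral_zero_fun] at hzero
    swap
    · intro p hp
      have hlt := hR.ae_frameLength_lt_top π (h := past t p) hp
      simp only [ae_iff, not_lt, top_le_iff] at hlt
      exact (lintegral_indicator_one htop).trans hlt
    rw [ae_iff]
    convert hzero using 2
    ext p
    simp [and_comm]
  filter_upwards [ae_all_iff.2 hren] with p hp t
  induction t with
  | zero => exact hp 0 (hR.renewsAt_zero p)
  | succ t ih =>
    by_cases hpt : RenewsAt R p (t + 1)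
    · exact hp _ hpt
    · have hren := renewsAt_add_frameNat ih
      obtain ⟨k, hk⟩ := Nat.exists_eq_add_of_le (one_le_frameNat ih)
      rw [hk, ← add_assoc] at hren
      have hk0 : 1 ≤ k := Nat.one_le_iff_ne_zero.2 fun h0 => hpt (by simpa [h0] using hren)
      exact (frameLength_le hk0 hren).trans_lt (ENat.natCast_lt_top k)

theorem integrable_frameNat_sq (hR : HasBoundedMoments S C R) (π : Policy S C) (hh : h ∈ R t) :
    Integrable (fun p => (frameNat R t p : ℝ) ^ 2) (π.lawFrom t h) := by
  obtain ⟨m, hm⟩ := hR.second_moment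
  simpa only [ENNReal.toReal_pow, toReal_frameLength] using integrable_toReal_of_lintegral_ne_top
    ((measurable_coe_frameLength hR.meas t).pow_const 2).aemeasurable
    ((hm π t h hh).trans_lt ENNReal.coe_lt_top).ne

theorem integrable_frameNat (hR : HasBoundedMoments S C R) (π : Policy S C) (hh : h ∈ R t) :
    Integrable (fun p => (frameNat R t p : ℝ)) (π.lawFrom t h) := by
  refine (hR.integrable_frameNat_sq π hh).mono'
    (measurable_from_nat.comp (measurable_frameNat hR.meas t)).aestronglyMeasurable
    (ae_of_all _ fun p => ?_)
  rw [Real.norm_natCast]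
  exact_mod_cast Nat.le_self_pow two_ne_zero (frameNat R t p)

theorem integral_frameNat_sq (hR : HasBoundedMoments S C R) (π : Policy S C) (hh : h ∈ R t) :
    ∫ p, (frameNat R t p : ℝ) ^ 2 ∂π.lawFrom t h =
      (∫⁻ p, (frameLength R t p : ℝ≥0∞) ^ 2 ∂π.lawFrom t h).toReal := by
  rw [← integral_toReal ((measurable_coe_frameLength hR.meas t).pow_const 2).aemeasurable]
  · simp only [ENNReal.toReal_pow, toReal_frameLength]
  · filter_upwards [hR.ae_frameLength_lt_top π hh] with p hp
    exact ENNReal.pow_lt_top (ENat.toENNReal_lt_top.2 hp)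

theorem integral_frameNat (hR : HasBoundedMoments S C R) (π : Policy S C) (hh : h ∈ R t) :
    ∫ p, (frameNat R t p : ℝ) ∂π.lawFrom t h =
      (∫⁻ p, (frameLength R t p : ℝ≥0∞) ∂π.lawFrom t h).toReal := by
  rw [← integral_toReal (measurable_coe_frameLength hR.meas t).aemeasurable]
  · simp only [toReal_frameLength]
  · filter_upwards [hR.ae_frameLength_lt_top π hh] with _ hp using ENat.toENNReal_lt_top.2 hp

theorem one_le_integral_frameNat (hR : HasBoundedMoments S C R) (π : Policy S C)
    (hh : h ∈ R t) : 1 ≤ ∫ p, (frameNat R t p : ℝ) ∂π.lawFrom t h := by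
  have hmono : ∫ _, (1 : ℝ) ∂π.lawFrom t h ≤ ∫ p, (frameNat R t p : ℝ) ∂π.lawFrom t h := by
    refine integral_mono_ae (integrable_const 1) (hR.integrable_frameNat π hh) ?_
    filter_upwards [hR.ae_frameLength_lt_top π hh] with p hp
    exact_mod_cast one_le_frameNat hp
  simpa using hmono

theorem integral_frameNat_le_integral_sq (hR : HasBoundedMoments S C R) (π : Policy S C)
    (hh : h ∈ R t) :
    ∫ p, (frameNat R t p : ℝ) ∂π.lawFrom t h ≤ ∫ p, (frameNat R t p : ℝ) ^ 2 ∂π.lawFrom t h := by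
  refine integral_mono (hR.integrable_frameNat π hh) (hR.integrable_frameNat_sq π hh) fun p => ?_
  change (frameNat R t p : ℝ) ≤ (frameNat R t p : ℝ) ^ 2
  exact_mod_cast Nat.le_self_pow two_ne_zero (frameNat R t p)

theorem one_le_integral_frameNat_sq (hR : HasBoundedMoments S C R) (π : Policy S C)
    (hh : h ∈ R t) : 1 ≤ ∫ p, (frameNat R t p : ℝ) ^ 2 ∂π.lawFrom t h :=
  (hR.one_le_integral_frameNat π hh).trans (hR.integral_frameNat_le_integral_sq π hh)

end HasBoundedMoments

section ForcedRenewals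

variable {N M L W A Z : Type u} [MeasurableSpace W] [MeasurableSpace A] [MeasurableSpace Z]
  {S : Network N M W A Z}

theorem Network.lawΩ_forced (S : Network N M W A Z) :
    S.lawΩ {Ω | Ω.2 = true} = ENNReal.ofReal S.φ := by
  have := S.lawω_prob
  have hset : {Ω : W × Bool | Ω.2 = true} = Set.univ ×ˢ {true} := by
    ext Ω
    simp
  rw [hset, Network.lawΩ, Measure.prod_prod, measure_univ, one_mul,
    bernoulliMeasure_apply_of_mem_of_notMem _ (measurableSet_singleton true) rfl (by simp),
    ← ENNReal.ofReal_coe_nnreal]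
  rfl

variable [Fintype M] {C : Program S L}

theorem Policy.fst_fst_step (π : Policy S C) (t : ℕ) :
    (Kernel.fst (π.step t : Kernel (Hist N M L W A Z t) (Slot M W A Z))).fst =
      Kernel.const _ S.lawΩ := by
  have := π.act_markov t
  change (Kernel.fst (((Kernel.const (Hist N M L W A Z t) S.lawΩ) ⊗ₖ π.act t) ⊗ₖ
    S.trans.comap _ _)).fst = _
  rw [Kernel.fst_compProd, Kernel.fst_compProd]

theorem Policy.lawFrom_forced (π : Policy S C) (t : ℕ) (h : Hist N M L W A Z t) :
    π.lawFrom t h {p | (outcome p t).2 = true} = ENNReal.ofReal S.φ := by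
  have hΩ : MeasurableSet {Ω : W × Bool | Ω.2 = true} := measurable_snd (measurableSet_singleton _)
  have hmap : (π.lawFrom t h).map (fun p => p (t + 1)) = π.step t h := by
    rw [← Kernel.map_traj_succ_self (κ := π.step),
      Kernel.map_apply _ (measurable_pi_apply (t + 1))]
    rfl
  have hforced : π.step t h {x | (slotRec x).1.1.2 = true} = ENNReal.ofReal S.φ := by
    have hfst := Kernel.fst_apply' (Kernel.fst (π.step t : Kernel _ (Slot M W A Z))) h hΩ
    rw [π.fst_fst_step, Kernel.const_apply, S.lawΩ_forced] at hfst
    exact (hfst.trans (Kernel.fst_apply' _ _ (measurable_fst hΩ))).symm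
  rw [← hforced, ← hmap]
  exact (Measure.map_apply (measurable_pi_apply (t + 1))
    ((measurable_fst.fst.comp (measurable_slotRec t)) hΩ)).symm

theorem HasBoundedMoments.measurableSet_zero (hR : HasBoundedMoments S C (typeTwoRenewals S))
    (π : Policy S C) : MeasurableSet {S.zero} := by
  let ρ : Measure (Backlog N M L) := Measure.dirac 0
  obtain ⟨p⟩ : Nonempty (Path N M L W A Z) := (π.law ρ).nonempty_of_neZero
  let e : Z → Hist N M L W A Z 1 := fun z => Function.update (past 1 p)
    ⟨1, Finset.mem_Iic.2 le_rfl⟩ ((((outcome p 0).1, true), action p 0, aux p 0), z)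
  have he : Measurable e := (measurable_update _).comp measurable_prodMk_left
  convert he (hR.meas 1)
  ext z
  have hez : slotRec (t := 0) (e z ⟨1, Finset.mem_Iic.2 le_rfl⟩) =
      ((((outcome p 0).1, true), action p 0, aux p 0), z) := rfl
  change z = S.zero ↔ (slotRec (t := 0) (e z ⟨1, _⟩)).2 = S.zero ∧
    (slotRec (t := 0) (e z ⟨1, _⟩)).1.1.2 = true
  rw [hez]
  exact (and_iff_left rfl).symm

variable {π : Policy S C} {s τ : ℕ} {μ : Measure (Path N M L W A Z)} [IsProbabilityMeasure μ]

theorem EvolvesFrom.ae_renewsAt_typeTwo (hμ : EvolvesFrom π.step s μ)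
    (hZ : MeasurableSet {S.zero}) : ∀ᵐ p ∂μ, ∀ τ, s ≤ τ →
      (RenewsAt (typeTwoRenewals S) p (τ + 1) ↔ (outcome p τ).2 = true) := by
  filter_upwards [hμ.ae_state_succ_eq_zero hZ] with p hp τ hτ
  exact ⟨fun h => h.2, fun h => ⟨hp τ hτ h, h⟩⟩

theorem EvolvesFrom.setLIntegral_typeTwo (hμ : EvolvesFrom π.step s μ)
    (hZ : MeasurableSet {S.zero}) (hτ : s ≤ τ) {g : Path N M L W A Z → ℝ≥0∞}
    (hg : Measurable[Filtration.piLE τ] g) :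
    ∫⁻ p in {p | RenewsAt (typeTwoRenewals S) p (τ + 1)}, g p ∂μ =
      ENNReal.ofReal S.φ * ∫⁻ p, g p ∂μ := by
  have hforced : MeasurableSet {p : Path N M L W A Z | (outcome p τ).2 = true} :=
    (measurable_fst.fst.comp ((measurable_slotRec τ).comp (measurable_pi_apply (τ + 1)))).snd
      (measurableSet_singleton true)
  have hg' : Measurable g := hg.mono (Filtration.piLE.le τ) le_rfl
  have hset : {p | RenewsAt (typeTwoRenewals S) p (τ + 1)} =ᵐ[μ] {p | (outcome p τ).2 = true} := by
    filter_upwards [hμ.ae_renewsAt_typeTwo hZ] with p hp using propext (hp τ hτ)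
  rw [setLIntegral_congr hset, ← lintegral_indicator hforced, hμ.lintegral hτ
    (hg'.indicator hforced), ← lintegral_const_mul _ hg']
  refine lintegral_congr fun p => ?_
  have hconst : {p | (outcome p τ).2 = true}.indicator g =ᵐ[π.lawFrom τ (past τ p)]
      {p | (outcome p τ).2 = true}.indicator fun _ => g p := by
    filter_upwards [ae_traj_eq hg p] with q hq
    by_cases hforcedq : (outcome q τ).2 = true <;> simp [hforcedq, hq]
  refine (lintegral_congr_ae hconst).trans ?_
  rw [lintegral_indicator_const hforced, π.lawFrom_forced, mul_comm]

namespace HasBoundedMoments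

variable {t : ℕ} {h : Hist N M L W A Z t}

theorem forced_mul_measure_lt_frameLength_typeTwo
    (hR : HasBoundedMoments S C (typeTwoRenewals S)) (π : Policy S C) (t : ℕ)
    (h : Hist N M L W A Z t) (k : ℕ) :
    ENNReal.ofReal S.φ * π.lawFrom t h {p | (k : ℕ∞) < frameLength (typeTwoRenewals S) t p} =
      π.lawFrom t h {p | frameLength (typeTwoRenewals S) t p = (k + 1 : ℕ)} := by
  have hlt := measurableSet_coe_lt_frameLength hR.meas t k
  have hlt' := Filtration.piLE.le _ _ hlt
  have hset := (π.evolvesFrom_lawFrom t h).setLIntegral_typeTwo (hR.measurableSet_zero π)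
    (Nat.le_add_right t k) ((measurable_const (a := (1 : ℝ≥0∞))).indicator hlt)
  rw [lintegral_indicator_const hlt', lintegral_indicator_const hlt', one_mul, one_mul,
    Measure.restrict_apply hlt'] at hset
  rw [← hset]
  congr 1
  ext p
  exact frameLength_eq_succ_iff.symm

theorem forced_mul_lintegral_frameLength_typeTwo
    (hR : HasBoundedMoments S C (typeTwoRenewals S)) (π : Policy S C)
    (hh : h ∈ typeTwoRenewals S t) :
    ENNReal.ofReal S.φ *
      ∫⁻ p, (frameLength (typeTwoRenewals S) t p : ℝ≥0∞) ∂π.lawFrom t h = 1 := by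
  have hm := measurable_frameLength hR.meas t
  rw [lintegral_enat_eq_tsum _ hm, ← ENNReal.tsum_mul_left]
  simp only [hR.forced_mul_measure_lt_frameLength_typeTwo π t h]
  rw [← measure_iUnion (f := fun k => {p | frameLength (typeTwoRenewals S) t p = (k + 1 : ℕ)})
    (fun i j hij => ?_) fun k => hm (measurableSet_singleton _)]
  · refine (measure_congr (eventuallyEq_univ.2 ?_)).trans measure_univ
    filter_upwards [hR.ae_frameLength_lt_top π hh] with p hp
    obtain ⟨k, hk⟩ := Nat.exists_eq_add_of_le' (one_le_frameNat hp)
    exact Set.mem_iUnion.2 ⟨k, (coe_frameNat hp).symm.trans (by rw [hk])⟩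
  · refine Set.disjoint_left.2 fun p hp hp' => hij (Nat.succ_injective ?_)
    exact_mod_cast hp.symm.trans hp'

end HasBoundedMoments

end ForcedRenewals

/-! ### The drift-plus-penalty expression -/

section FrameSum

variable {N M L W A Z : Type u} {R : RenewalRule N M L W A Z} {p : Path N M L W A Z} {t : ℕ}

theorem frameSum_congr {F G : ℕ → ℝ} (h : ∀ τ, t ≤ τ → F τ = G τ) :
    frameSum R t p F = frameSum R t p G :=
  Finset.sum_congr rfl fun i _ => h _ (Nat.le_add_right t i)

theorem frameSum_le_frameSum {F G : ℕ → ℝ} (h : ∀ τ, t ≤ τ → F τ ≤ G τ) :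
    frameSum R t p F ≤ frameSum R t p G :=
  Finset.sum_le_sum fun i _ => h _ (Nat.le_add_right t i)

theorem abs_frameSum_le (F : ℕ → ℝ) :
    |frameSum R t p F| ≤ frameSum R t p fun τ => |F τ| :=
  Finset.abs_sum_le_sum_abs _ _

theorem frameSum_const (a : ℝ) : frameSum R t p (fun _ => a) = frameNat R t p * a := by
  simp [frameSum, frameNat]

theorem frameSum_sub (F G : ℕ → ℝ) :
    frameSum R t p (fun τ => F τ - G τ) = frameSum R t p F - frameSum R t p G :=
  Finset.sum_sub_distrib _ _

variable [MeasurableSpace W] [MeasurableSpace A] [MeasurableSpace Z]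

theorem measurable_frameSum (hR : ∀ t, MeasurableSet (R t)) (t : ℕ)
    {F : Path N M L W A Z → ℕ → ℝ} (hF : ∀ τ, Measurable fun p => F p τ) :
    Measurable fun p => frameSum R t p (F p) :=
  measurable_comp_nat (measurable_frameNat hR t)
    (g := fun k p => ∑ i ∈ Finset.range k, F p (t + i))
    fun _ => Finset.measurable_fun_sum _ fun _ _ => hF _

end FrameSum

namespace HasBoundedMoments

variable {N M L W A Z : Type u} [Finite N] [Fintype M] [MeasurableSpace W] [MeasurableSpace A]
  [MeasurableSpace Z] {S : Network N M W A Z} {C : Program S L} {R : RenewalRule N M L W A Z}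
  {t : ℕ} {h : Hist N M L W A Z t}

theorem integrable_frameSum (hR : HasBoundedMoments S C R) (π : Policy S C) (hh : h ∈ R t)
    {G : (A × (W × Bool) × Z) × (M → ℝ) → ℝ} (hG : Measurable G) {a b : ℝ}
    (hGab : ∀ q γ, S.Admissible C.α q γ → G (q, γ) ∈ Set.Icc a b) :
    Integrable (fun p => frameSum R t p fun τ => G (point S p τ, aux p τ)) (π.lawFrom t h) := by
  have hGm (τ : ℕ) : Measurable fun p : Path N M L W A Z => G (point S p τ, aux p τ) :=
    hG.comp (((measurable_point S τ.lt_succ_self).prodMk (measurable_aux τ.lt_succ_self)).mono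
      (Filtration.piLE.le _) le_rfl)
  refine ((hR.integrable_frameNat π hh).mul_const (max |a| |b|)).mono'
    (measurable_frameSum hR.meas t hGm).aestronglyMeasurable ?_
  filter_upwards [(π.evolvesFrom_lawFrom t h).ae_admissible] with p hp
  rw [← frameSum_const]
  refine (abs_frameSum_le _).trans (frameSum_le_frameSum fun τ hτ => ?_)
  exact abs_le_max_abs_abs (hGab _ _ (hp τ hτ)).1 (hGab _ _ (hp τ hτ)).2

theorem integral_frameSum_mem_Icc (hR : HasBoundedMoments S C R) (π : Policy S C)
    (hh : h ∈ R t) {G : (A × (W × Bool) × Z) × (M → ℝ) → ℝ} (hG : Measurable G) {a b : ℝ}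
    (hGab : ∀ q γ, S.Admissible C.α q γ → G (q, γ) ∈ Set.Icc a b) :
    ∫ p, frameSum R t p (fun τ => G (point S p τ, aux p τ)) ∂π.lawFrom t h ∈
      Set.Icc ((∫ p, (frameNat R t p : ℝ) ∂π.lawFrom t h) * a)
        ((∫ p, (frameNat R t p : ℝ) ∂π.lawFrom t h) * b) := by
  have hT := hR.integrable_frameNat π hh
  have hS := hR.integrable_frameSum π hh hG hGab
  have hadm := (π.evolvesFrom_lawFrom t h).ae_admissible
  rw [← integral_mul_const, ← integral_mul_const]
  constructor
  · refine integral_mono_ae (hT.mul_const a) hS ?_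
    filter_upwards [hadm] with p hp
    simp only [← frameSum_const]
    exact frameSum_le_frameSum fun τ hτ => (hGab _ _ (hp τ hτ)).1
  · refine integral_mono_ae hS (hT.mul_const b) ?_
    filter_upwards [hadm] with p hp
    simp only [← frameSum_const]
    exact frameSum_le_frameSum fun τ hτ => (hGab _ _ (hp τ hτ)).2

theorem integrable_frameSum_xhat (hR : HasBoundedMoments S C R) (π : Policy S C)
    (hh : h ∈ R t) (m : M) :
    Integrable (fun p => frameSum R t p fun τ => S.xhat m (point S p τ)) (π.lawFrom t h) :=
  hR.integrable_frameSum π hh (G := fun x => S.xhat m x.1)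
    ((S.xhat_meas m).comp measurable_fst) fun _ _ hq => hq.2.2.2 m

theorem integrable_frameSum_aux (hR : HasBoundedMoments S C R) (π : Policy S C)
    (hh : h ∈ R t) (m : M) :
    Integrable (fun p => frameSum R t p fun τ => aux p τ m) (π.lawFrom t h) :=
  hR.integrable_frameSum π hh (G := fun x => x.2 m) (by fun_prop) fun _ _ hq => hq.1 m

theorem integrable_frameSum_dhat (hR : HasBoundedMoments S C R) (π : Policy S C)
    (hh : h ∈ R t) (n : N) :
    Integrable (fun p => frameSum R t p fun τ => S.dhat n (point S p τ)) (π.lawFrom t h) :=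
  hR.integrable_frameSum π hh (G := fun x => S.dhat n x.1)
    (((S.μhat_meas n).sub (S.Rhat_meas n)).comp measurable_fst)
    (a := 0 - S.Rmax n) (b := S.μmax n - 0)
    fun _ _ hq => ⟨sub_le_sub (hq.2.1 n).1 (hq.2.2.1 n).2, sub_le_sub (hq.2.1 n).2 (hq.2.2.1 n).1⟩

theorem integrable_frameSum_h (hR : HasBoundedMoments S C R) (π : Policy S C)
    (hh : h ∈ R t) (l : L) :
    Integrable (fun p => frameSum R t p fun τ => C.c l - C.zeroExtend.h l (aux p τ))
      (π.lawFrom t h) := by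
  obtain ⟨b, hb⟩ := C.exists_abs_h_le l
  refine hR.integrable_frameSum π hh (G := fun x => C.c l - C.zeroExtend.h l x.2)
    (measurable_const.sub ((C.measurable_zeroExtend_h l).comp measurable_snd))
    (a := C.c l - b) (b := C.c l - -b) fun q γ hq => ?_
  rw [C.zeroExtend_h l hq.1]
  obtain ⟨hbl, hbu⟩ := abs_le.1 (hb γ hq.1)
  exact ⟨sub_le_sub_left hbu _, sub_le_sub_left hbl _⟩

theorem integrable_frameSum_f (hR : HasBoundedMoments S C R) (π : Policy S C) (hh : h ∈ R t) :
    Integrable (fun p => frameSum R t p fun τ => C.zeroExtend.f (aux p τ)) (π.lawFrom t h) := by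
  refine hR.integrable_frameSum π hh (G := fun x => C.zeroExtend.f x.2)
    (C.measurable_zeroExtend_f.comp measurable_snd) (a := C.fmin) (b := C.fmax) fun q γ hq => ?_
  rw [C.zeroExtend_f hq.1]
  exact C.f_bd γ hq.1

end HasBoundedMoments

section Attains

variable {N M L W A Z : Type u} [Fintype M] [MeasurableSpace W] [MeasurableSpace A]
  [MeasurableSpace Z] {S : Network N M W A Z} {C : Program S L} {R : RenewalRule N M L W A Z}

theorem StatPolicy.ae_aux_toPolicy (σ : StatPolicy S) (γ : S.box C.α) {t : ℕ}
    (h : Hist N M L W A Z t) : ∀ᵐ p ∂(σ.toPolicy C γ).lawFrom t h, ∀ τ, t ≤ τ → aux p τ = γ := by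
  have := σ.act_markov
  refine ((σ.toPolicy C γ).evolvesFrom_lawFrom t h).ae_slot (P := fun x => x.2.1.2.2 = (γ : M → ℝ))
    (measurable_snd.fst.snd.snd (measurableSet_singleton (γ : M → ℝ))) fun τ h' Ω => ?_
  have hdirac : ∀ᵐ γ' ∂Measure.dirac (γ : M → ℝ), γ' = (γ : M → ℝ) :=
    (ae_dirac_iff (measurableSet_singleton (γ : M → ℝ))).2 rfl
  have hact : ∀ᵐ d ∂(σ.toPolicy C γ).act τ (h', Ω), d.2 = (γ : M → ℝ) := by
    change ∀ᵐ d ∂(σ.act.comap _ _ ×ₖ Kernel.const _ (Measure.dirac (γ : M → ℝ))) (h', Ω), _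
    rw [Kernel.prod_apply]
    exact measurePreserving_snd.quasiMeasurePreserving.ae hdirac
  filter_upwards [hact] with d hd using ae_of_all _ fun _ => hd

theorem StatPolicy.integral_frameSum_aux (σ : StatPolicy S) (γ : S.box C.α) {t : ℕ}
    (h : Hist N M L W A Z t) (g : (M → ℝ) → ℝ) :
    ∫ p, frameSum R t p (fun τ => g (aux p τ)) ∂(σ.toPolicy C γ).lawFrom t h =
      (∫ p, (frameNat R t p : ℝ) ∂(σ.toPolicy C γ).lawFrom t h) * g γ := by
  rw [← integral_mul_const]
  refine integral_congr_ae ?_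
  filter_upwards [σ.ae_aux_toPolicy γ h] with p hp
  rw [← frameSum_const]
  exact frameSum_congr fun τ hτ => congrArg g (hp τ hτ)

theorem ae_admissible_of_past [Countable N] (π : Policy S C) {t : ℕ} {p₀ : Path N M L W A Z}
    (hp₀ : ∀ τ < t, S.Admissible C.α (point S p₀ τ) (aux p₀ τ)) :
    ∀ᵐ p ∂π.lawFrom t (past t p₀), ∀ τ, S.Admissible C.α (point S p τ) (aux p τ) := by
  have hpast : MeasurableSet[Filtration.piLE t]
      {p : Path N M L W A Z | ∀ τ < t, S.Admissible C.α (point S p τ) (aux p τ)} := by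
    simp only [Set.ofPred_forall]
    exact MeasurableSet.iInter fun τ => MeasurableSet.iInter fun hτ =>
      ((measurable_point S hτ).prodMk (measurable_aux hτ)) (S.measurableSet_admissible C.α)
  filter_upwards [ae_traj_mem_of_mem hpast hp₀, (π.evolvesFrom_lawFrom t _).ae_admissible]
    with p hp hp' τ
  exact (lt_or_ge τ t).elim (hp τ) (hp' τ)

theorem Attains.exists_statPolicy (hR : HasBoundedMoments S C R) {ε : ℝ} {γ : M → ℝ}
    (hγ : Attains C R ε γ) :
    ∃ σ : StatPolicy S, ∀ (γ₀ : S.box C.α) (t : ℕ), ∀ h ∈ R t,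
      (∀ m, ∫ p, frameSum R t p (fun τ => S.xhat m (point S p τ))
          ∂(σ.toPolicy C γ₀).lawFrom t h =
        γ m * ∫ p, (frameNat R t p : ℝ) ∂(σ.toPolicy C γ₀).lawFrom t h) ∧
      ∀ n, ε * ∫ p, (frameNat R t p : ℝ) ∂(σ.toPolicy C γ₀).lawFrom t h ≤
        ∫ p, frameSum R t p (fun τ => S.dhat n (point S p τ))
          ∂(σ.toPolicy C γ₀).lawFrom t h := by
  obtain ⟨⟨σ, hσ⟩, -⟩ := hγ
  refine ⟨σ, fun γ₀ t h hh => ?_⟩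
  have hT := zero_lt_one.trans_le (hR.one_le_integral_frameNat (σ.toPolicy C γ₀) hh)
  obtain ⟨hx, hd⟩ := hσ γ₀ t h hh
  rw [← hR.integral_frameNat _ hh] at hx hd
  exact ⟨fun m => (div_eq_iff hT.ne').1 (hx m), fun n => (le_div_iff₀ hT).1 (hd n)⟩

theorem Attains.mem_box [Finite N] (hR : HasBoundedMoments S C R) (π : Policy S C) {ε : ℝ}
    {γ : M → ℝ} (hγ : Attains C R ε γ) : γ ∈ S.box C.α := by
  obtain ⟨p, hp⟩ :=
    ((π.evolvesFrom_law (Measure.dirac (0 : Backlog N M L))).ae_admissible).exists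
  obtain ⟨σ, hσ⟩ := hγ.exists_statPolicy hR
  have hh : past 0 p ∈ R 0 := hR.renewsAt_zero p
  let π' := σ.toPolicy C ⟨aux p 0, (hp 0 le_rfl).1⟩
  have hT := zero_lt_one.trans_le (hR.one_le_integral_frameNat π' hh)
  intro m
  have hmem := hR.integral_frameSum_mem_Icc π' hh (G := fun x => S.xhat m x.1)
    ((S.xhat_meas m).comp measurable_fst) fun _ _ hq => hq.2.2.2 m
  rw [(hσ _ 0 _ hh).1 m, mul_comm (γ m)] at hmem
  have hmin := le_of_mul_le_mul_left hmem.1 hT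
  have hmax := le_of_mul_le_mul_left hmem.2 hT
  have hα := C.α_nonneg
  constructor <;> linarith

end Attains

section WeightedCost

theorem integrable_and_integral_weighted_sum {X ι₁ ι₂ ι₃ : Type*} [MeasurableSpace X]
    [Fintype ι₁] [Fintype ι₂] [Fintype ι₃] {μ : Measure X} {a₁ : ι₁ → ℝ} {a₂ : ι₂ → ℝ}
    {a₃ : ι₃ → ℝ} {b : ℝ} {F₁ : ι₁ → X → ℝ} {F₂ : ι₂ → X → ℝ} {F₃ : ι₃ → X → ℝ} {G : X → ℝ}
    (h₁ : ∀ i, Integrable (F₁ i) μ) (h₂ : ∀ i, Integrable (F₂ i) μ)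
    (h₃ : ∀ i, Integrable (F₃ i) μ) (hG : Integrable G μ) :
    Integrable (fun x => - ∑ i, a₁ i * F₁ i x - ∑ i, a₂ i * F₂ i x - ∑ i, a₃ i * F₃ i x
      + b * G x) μ ∧
    ∫ x, (- ∑ i, a₁ i * F₁ i x - ∑ i, a₂ i * F₂ i x - ∑ i, a₃ i * F₃ i x + b * G x) ∂μ =
      - ∑ i, a₁ i * ∫ x, F₁ i x ∂μ - ∑ i, a₂ i * ∫ x, F₂ i x ∂μ - ∑ i, a₃ i * ∫ x, F₃ i x ∂μ
        + b * ∫ x, G x ∂μ := by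
  have hs₁ := integrable_finsetSum Finset.univ fun i _ => (h₁ i).const_mul (a₁ i)
  have hs₂ := integrable_finsetSum Finset.univ fun i _ => (h₂ i).const_mul (a₂ i)
  have hs₃ := integrable_finsetSum Finset.univ fun i _ => (h₃ i).const_mul (a₃ i)
  refine ⟨((hs₁.neg.sub hs₂).sub hs₃).add (hG.const_mul b), ?_⟩
  rw [integral_add ((hs₁.fun_neg.sub' hs₂).sub' hs₃) (hG.const_mul b),
    integral_sub (hs₁.fun_neg.sub' hs₂) hs₃, integral_sub hs₁.fun_neg hs₂, integral_neg,
    integral_finsetSum _ fun i _ => (h₁ i).const_mul (a₁ i),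
    integral_finsetSum _ fun i _ => (h₂ i).const_mul (a₂ i),
    integral_finsetSum _ fun i _ => (h₃ i).const_mul (a₃ i)]
  simp only [integral_const_mul]

variable {N M L W A Z : Type u} [Fintype N] [Fintype M] [Fintype L] [MeasurableSpace W]
  [MeasurableSpace A] [MeasurableSpace Z] {S : Network N M W A Z} {C : Program S L}
  {R : RenewalRule N M L W A Z} {t : ℕ}

/-- The drift-plus-penalty expression over a renewal interval as a function of the backlog `θ` at
its start. The zero extensions of `f` and `h` make the integrands measurable. -/
noncomputable def weightedCost (R : RenewalRule N M L W A Z) {C : Program S L} (π : Policy S C)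
    (t : ℕ) (h : Hist N M L W A Z t) (θ : Backlog N M L) : ℝ :=
  - ∑ n, θ.1 n * ∫ p, frameSum R t p (fun τ => S.dhat n (point S p τ)) ∂π.lawFrom t h
    - ∑ m, θ.2.2 m *
        ∫ p, frameSum R t p (fun τ => aux p τ m - S.xhat m (point S p τ)) ∂π.lawFrom t h
    - ∑ l, θ.2.1 l *
        ∫ p, frameSum R t p (fun τ => C.c l - C.zeroExtend.h l (aux p τ)) ∂π.lawFrom t h
    + C.V * ∫ p, frameSum R t p (fun τ => C.zeroExtend.f (aux p τ)) ∂π.lawFrom t h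

theorem HasBoundedMoments.integrable_and_integral_driftTerm_add
    (hR : HasBoundedMoments S C R) (π : Policy S C) {p₀ : Path N M L W A Z}
    (ht : RenewsAt R p₀ t) :
    Integrable (fun p => driftTerm S C.zeroExtend p t (frameNat R t p) +
        C.V * frameSum R t p fun τ => C.zeroExtend.f (aux p τ)) (π.lawFrom t (past t p₀)) ∧
    ∫ p, (driftTerm S C.zeroExtend p t (frameNat R t p) +
        C.V * frameSum R t p fun τ => C.zeroExtend.f (aux p τ)) ∂π.lawFrom t (past t p₀) =
      weightedCost R π t (past t p₀) (backlog S C.zeroExtend p₀ t) := by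
  set θ := backlog S C.zeroExtend p₀ t
  have hbalance (m : M) := ((hR.integrable_frameSum_aux π ht m).sub'
    (hR.integrable_frameSum_xhat π ht m)).congr (ae_of_all _ fun p => (frameSum_sub _ _).symm)
  obtain ⟨hint, heq⟩ := integrable_and_integral_weighted_sum (a₁ := θ.1) (a₂ := θ.2.2)
    (a₃ := θ.2.1) (b := C.V) (hR.integrable_frameSum_dhat π ht) hbalance
    (hR.integrable_frameSum_h π ht) (hR.integrable_frameSum_f π ht)
  have hbacklog : ∀ᵐ p ∂π.lawFrom t (past t p₀), backlog S C.zeroExtend p t = θ :=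
    ae_traj_eq (measurable_backlog C.measurable_zeroExtend_h t) p₀
  have hae := hbacklog.mono fun p hp => show _ = driftTerm S C.zeroExtend p t (frameNat R t p) +
      C.V * frameSum R t p fun τ => C.zeroExtend.f (aux p τ) by
    rw [driftTerm, hp]
  exact ⟨hint.congr hae, (integral_congr_ae hae).symm.trans heq⟩

theorem HasBoundedMoments.driftPlusPenalty_eq_weightedCost (hR : HasBoundedMoments S C R)
    (π : Policy S C) {p₀ : Path N M L W A Z} (ht : RenewsAt R p₀ t)
    (hp₀ : ∀ τ < t, S.Admissible C.α (point S p₀ τ) (aux p₀ τ)) :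
    driftPlusPenalty R π t (past t p₀) =
      weightedCost R π t (past t p₀) (backlog S C.zeroExtend p₀ t) := by
  rw [← (hR.integrable_and_integral_driftTerm_add π ht).2, driftPlusPenalty]
  refine integral_congr_ae ?_
  filter_upwards [ae_admissible_of_past π hp₀] with p hp
  simp only [driftTerm, backlog_zeroExtend fun τ _ => (hp τ).1, C.zeroExtend_h _ (hp _).1,
    C.zeroExtend_f (hp _).1]
  rfl

theorem Attains.exists_policy_weightedCost_le (hR : HasBoundedMoments S C R) {ε : ℝ}
    {γ : M → ℝ} (hγ : Attains C R ε γ) (hbox : γ ∈ S.box C.α) :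
    ∃ π : Policy S C, ∀ (t : ℕ), ∀ h ∈ R t, ∀ θ : Backlog N M L, (∀ n, 0 ≤ θ.1 n) →
      (∀ l, 0 ≤ θ.2.1 l) → weightedCost R π t h θ ≤
        (C.V * C.f γ - ε * ∑ n, θ.1 n) * ∫ p, (frameNat R t p : ℝ) ∂π.lawFrom t h := by
  obtain ⟨σ, hσ⟩ := hγ.exists_statPolicy hR
  refine ⟨σ.toPolicy C ⟨γ, hbox⟩, fun t h hh θ hQ hY => ?_⟩
  obtain ⟨hx, hd⟩ := hσ ⟨γ, hbox⟩ t h hh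
  have hT := zero_le_one.trans (hR.one_le_integral_frameNat (σ.toPolicy C ⟨γ, hbox⟩) hh)
  have haux (g : (M → ℝ) → ℝ) := σ.integral_frameSum_aux (R := R) (t := t) ⟨γ, hbox⟩ h g
  rw [weightedCost]
  set μ := (σ.toPolicy C ⟨γ, hbox⟩).lawFrom t h
  set T := ∫ p, (frameNat R t p : ℝ) ∂μ
  have hbalance (m : M) :
      ∫ p, frameSum R t p (fun τ => aux p τ m - S.xhat m (point S p τ)) ∂μ = 0 := by
    simp only [frameSum_sub]
    rw [integral_sub (hR.integrable_frameSum_aux _ hh m) (hR.integrable_frameSum_xhat _ hh m),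
      hx m, haux fun γ' => γ' m, mul_comm, sub_self]
  have hvirtual : 0 ≤ ∑ l, θ.2.1 l *
      ∫ p, frameSum R t p (fun τ => C.c l - C.zeroExtend.h l (aux p τ)) ∂μ := by
    refine Finset.sum_nonneg fun l _ => mul_nonneg (hY l) ?_
    rw [haux fun γ' => C.c l - C.zeroExtend.h l γ', C.zeroExtend_h l hbox]
    exact mul_nonneg hT (sub_nonneg.2 (hγ.2 l))
  have hqueue : (∑ n, θ.1 n) * (ε * T) ≤
      ∑ n, θ.1 n * ∫ p, frameSum R t p (fun τ => S.dhat n (point S p τ)) ∂μ := by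
    rw [Finset.sum_mul]
    exact Finset.sum_le_sum fun n _ => mul_le_mul_of_nonneg_left (hd n) (hQ n)
  rw [haux C.zeroExtend.f, C.zeroExtend_f hbox]
  simp only [hbalance, mul_zero, Finset.sum_const_zero, sub_zero]
  linarith

end WeightedCost

section FrameDrift

variable {N M L W A Z : Type u} [Fintype N] [Fintype M] [Fintype L] [MeasurableSpace W]
  [MeasurableSpace A] [MeasurableSpace Z] {S : Network N M W A Z} {C : Program S L}
  {R : RenewalRule N M L W A Z} {t : ℕ}

theorem IsDriftConstant.ae_slotCost_le {π : Policy S C} {B₂ : ℝ} (hB : IsDriftConstant R π B₂)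
    (hR : HasBoundedMoments S C R) {h : Hist N M L W A Z t} (hh : h ∈ R t) :
    ∀ᵐ p ∂π.lawFrom t h, ∀ τ, t ≤ τ → slotCost S C.zeroExtend (point S p τ) (aux p τ) ≤
      2 * B₂ / ∫ p, (frameNat R t p : ℝ) ^ 2 ∂π.lawFrom t h := by
  obtain ⟨m, hmoment⟩ := hR.second_moment
  have hfin := ((hmoment π t h hh).trans_lt ENNReal.coe_lt_top).ne
  have hsecond := hB.2 t h hh
  rw [← ENNReal.ofReal_toReal hfin, ← hR.integral_frameNat_sq π hh] at hsecond
  have hpos := zero_lt_one.trans_le (hR.one_le_integral_frameNat_sq π hh)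
  set e := ∫ p, (frameNat R t p : ℝ) ^ 2 ∂π.lawFrom t h
  have hcost : Measurable fun x : Z × Slot M W A Z =>
      slotCost S C.zeroExtend (x.2.1.2.1, x.2.1.1, x.1) x.2.1.2.2 :=
    measurable_slotCost C.measurable_zeroExtend_h (by fun_prop) (by fun_prop)
  suffices hbound : ∀ τ (h' : Hist N M L W A Z τ) Ω, ∀ᵐ d ∂π.act τ (h', Ω),
      slotCost S C.zeroExtend (d.1, Ω, histState S τ h') d.2 ≤ 2 * B₂ / e by
    have hslot := (π.evolvesFrom_lawFrom t h).ae_slot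
      (P := fun x => slotCost S C.zeroExtend (x.2.1.2.1, x.2.1.1, x.1) x.2.1.2.2 ≤ 2 * B₂ / e)
      (measurableSet_le hcost measurable_const)
      fun τ h' Ω => (hbound τ h' Ω).mono fun d hd => ae_of_all _ fun _ => hd
    filter_upwards [hslot] with p hp τ hτ using hp τ hτ
  intro τ h' Ω
  filter_upwards [π.act_mem τ h' Ω] with d ⟨hI, hγ⟩
  have hbound : ENNReal.ofReal e / 2 *
      ENNReal.ofReal (slotCost S C (d.1, Ω, histState S τ h') d.2) ≤ ENNReal.ofReal B₂ :=
    hsecond Ω _ d.1 hI d.2 hγ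
  rw [← ENNReal.ofReal_ofNat, ← ENNReal.ofReal_div_of_pos two_pos,
    ← ENNReal.ofReal_mul (by positivity), ENNReal.ofReal_le_ofReal_iff hB.1.le] at hbound
  have hext : slotCost S C.zeroExtend (d.1, Ω, histState S τ h') d.2 =
      slotCost S C (d.1, Ω, histState S τ h') d.2 := by
    simp only [slotCost, C.zeroExtend_h _ hγ]
    rfl
  rw [hext, le_div_iff₀ hpos]
  linarith

/-- The Lyapunov function at the end of the renewal interval that starts at the time `t`, plus the
penalty `V ∑ (f(γ) - f_min)` which is incurred over this interval. -/
noncomputable def frameValue (S : Network N M W A Z) (C : Program S L)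
    (R : RenewalRule N M L W A Z) (t : ℕ) (p : Path N M L W A Z) : ℝ :=
  lyapunov (backlog S C p (t + frameNat R t p)) +
    C.V * frameSum R t p fun τ => C.f (aux p τ) - C.fmin

theorem frameValue_nonneg {p : Path N M L W A Z} (hp : ∀ τ, t ≤ τ → aux p τ ∈ S.box C.α) :
    0 ≤ frameValue S C R t p :=
  add_nonneg (lyapunov_nonneg _) (mul_nonneg C.V_nonneg (Finset.sum_nonneg fun i _ =>
    sub_nonneg.2 (C.f_bd _ (hp _ (Nat.le_add_right t i))).1))

theorem frameValue_le_driftTerm {p : Path N M L W A Z} {κ : ℝ}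
    (hp : ∀ τ, t ≤ τ → S.Admissible C.α (point S p τ) (aux p τ))
    (hQ : ∀ n, 0 ≤ (backlog S C p t).1 n) (hY : ∀ l, 0 ≤ (backlog S C p t).2.1 l)
    (hκ : ∀ τ, t ≤ τ → slotCost S C (point S p τ) (aux p τ) ≤ κ) :
    frameValue S C R t p ≤ lyapunov (backlog S C p t) + κ / 2 * (frameNat R t p : ℝ) ^ 2 +
      (driftTerm S C p t (frameNat R t p) + C.V * frameSum R t p fun τ => C.f (aux p τ)) -
      C.V * C.fmin * frameNat R t p := by
  rw [frameValue, frameSum_sub, frameSum_const]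
  linarith [lyapunov_add_le_driftTerm (k := frameNat R t p)
    (fun i _ => hp (t + i) (Nat.le_add_right t i)) hQ hY
    fun i _ => hκ (t + i) (Nat.le_add_right t i)]

/-- The factor `E{T²}` in the definition of the drift constant cancels here: the one-slot costs are
at most `2 B₂ / E{T²}`, and over an interval of length `T` they add `T²/2` times as much to the
drift. -/
theorem IsDriftConstant.lintegral_frameValue_le {π : Policy S C} {B₂ : ℝ}
    (hB : IsDriftConstant R π B₂) (hR : HasBoundedMoments S C R) {p₀ : Path N M L W A Z}
    (ht : RenewsAt R p₀ t) (hQ : ∀ n, 0 ≤ (backlog S C.zeroExtend p₀ t).1 n)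
    (hY : ∀ l, 0 ≤ (backlog S C.zeroExtend p₀ t).2.1 l) {b : ℝ}
    (hb : weightedCost R π t (past t p₀) (backlog S C.zeroExtend p₀ t) -
      C.V * C.fmin * ∫ p, (frameNat R t p : ℝ) ∂π.lawFrom t (past t p₀) ≤ b) :
    ∫⁻ p, ENNReal.ofReal (frameValue S C.zeroExtend R t p) ∂π.lawFrom t (past t p₀) ≤
      ENNReal.ofReal (lyapunov (backlog S C.zeroExtend p₀ t) + B₂ + b) ∧
    0 ≤ lyapunov (backlog S C.zeroExtend p₀ t) + B₂ + b := by
  have hsq := hR.integrable_frameNat_sq π ht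
  have hT := hR.integrable_frameNat π ht
  have hpos := zero_lt_one.trans_le (hR.one_le_integral_frameNat_sq π ht)
  obtain ⟨hdrift, hcost⟩ := hR.integrable_and_integral_driftTerm_add π ht
  have hslot := hB.ae_slotCost_le hR ht
  set μ := π.lawFrom t (past t p₀)
  set θ := backlog S C.zeroExtend p₀ t
  set κ := 2 * B₂ / ∫ p, (frameNat R t p : ℝ) ^ 2 ∂μ with hκ
  let bound : Path N M L W A Z → ℝ := fun p => lyapunov θ + κ / 2 * (frameNat R t p : ℝ) ^ 2 +
    (driftTerm S C.zeroExtend p t (frameNat R t p) +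
      C.V * frameSum R t p fun τ => C.zeroExtend.f (aux p τ)) - C.V * C.fmin * frameNat R t p
  have hlyap := (integrable_const (μ := μ) (lyapunov θ)).fun_add (hsq.const_mul (κ / 2))
  have hadd := hlyap.fun_add hdrift
  have hint : Integrable bound μ := hadd.sub' (hT.const_mul _)
  have hmean : ∫ p, bound p ∂μ ≤ lyapunov θ + B₂ + b := by
    simp only [bound]
    rw [integral_sub hadd (hT.const_mul _), integral_add hlyap hdrift,
      integral_add (integrable_const _) (hsq.const_mul _), integral_const_mul,
      integral_const_mul, hcost, hκ]
    have hcancel : 2 * B₂ / (∫ p, (frameNat R t p : ℝ) ^ 2 ∂μ) / 2 *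
        ∫ p, (frameNat R t p : ℝ) ^ 2 ∂μ = B₂ := by
      field_simp
    rw [hcancel]
    simp only [integral_const, probReal_univ, one_smul]
    linarith
  have hle : ∀ᵐ p ∂μ, 0 ≤ frameValue S C.zeroExtend R t p ∧
      frameValue S C.zeroExtend R t p ≤ bound p := by
    have hbacklog : ∀ᵐ p ∂μ, backlog S C.zeroExtend p t = θ :=
      ae_traj_eq (measurable_backlog C.measurable_zeroExtend_h t) p₀
    filter_upwards [hslot, hbacklog, (π.evolvesFrom_lawFrom t (past t p₀)).ae_admissible]
      with p hcost hθ hadm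
    have := frameValue_le_driftTerm (R := R) (C := C.zeroExtend) hadm (hθ ▸ hQ) (hθ ▸ hY) hcost
    exact ⟨frameValue_nonneg fun τ hτ => (hadm τ hτ).1, by rwa [hθ] at this⟩
  have hnonneg : 0 ≤ᵐ[μ] bound := hle.mono fun p hp => hp.1.trans hp.2
  refine ⟨(lintegral_mono_ae (hle.mono fun p hp => ENNReal.ofReal_le_ofReal hp.2)).trans ?_,
    (integral_nonneg_of_ae hnonneg).trans hmean⟩
  rw [← ofReal_integral_eq_lintegral_ofReal hint hnonneg]
  exact ENNReal.ofReal_le_ofReal hmean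

theorem IsDriftConstant.lintegral_frameValue_add_le {π π' : Policy S C} {B₂ : ℝ}
    (hB : IsDriftConstant R π B₂) (hR : HasBoundedMoments S C R) {p₀ : Path N M L W A Z}
    (ht : RenewsAt R p₀ t) (hp₀ : ∀ τ < t, S.Admissible C.α (point S p₀ τ) (aux p₀ τ))
    (hQ : ∀ n, 0 ≤ (backlog S C.zeroExtend p₀ t).1 n)
    (hY : ∀ l, 0 ≤ (backlog S C.zeroExtend p₀ t).2.1 l)
    (hπ : driftPlusPenalty R π t (past t p₀) ≤ driftPlusPenalty R π' t (past t p₀))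
    {a d K : ℝ} (hd : 0 ≤ d)
    (hπ' : weightedCost R π' t (past t p₀) (backlog S C.zeroExtend p₀ t) ≤ a - d)
    (hK : B₂ + a - C.V * C.fmin * ∫ p, (frameNat R t p : ℝ) ∂π.lawFrom t (past t p₀) ≤ K) :
    ∫⁻ p, ENNReal.ofReal (frameValue S C.zeroExtend R t p) ∂π.lawFrom t (past t p₀) +
      ENNReal.ofReal d ≤
    ENNReal.ofReal (lyapunov (backlog S C.zeroExtend p₀ t)) + ENNReal.ofReal K := by
  rw [hR.driftPlusPenalty_eq_weightedCost π ht hp₀,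
    hR.driftPlusPenalty_eq_weightedCost π' ht hp₀] at hπ
  obtain ⟨hle, hnonneg⟩ := hB.lintegral_frameValue_le hR ht hQ hY
    (sub_le_sub_right (hπ.trans hπ') _)
  refine (add_le_add_left hle _).trans ?_
  rw [← ENNReal.ofReal_add hnonneg hd]
  exact (ENNReal.ofReal_le_ofReal (by linarith)).trans ENNReal.ofReal_add_le

end FrameDrift

/-! ### Drift between renewals -/

theorem add_sum_range_le_of_forall_succ_add_le {α : Type*} [AddCommMonoid α] [PartialOrder α]
    [IsOrderedAddMonoid α] {a b d : ℕ → α} (h : ∀ t, a (t + 1) + b t ≤ a t + d t) (n : ℕ) :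
    a n + ∑ t ∈ Finset.range n, b t ≤ a 0 + ∑ t ∈ Finset.range n, d t := by
  induction n with
  | zero => simp
  | succ n ih =>
    rw [Finset.sum_range_succ, Finset.sum_range_succ]
    calc a (n + 1) + (∑ t ∈ Finset.range n, b t + b n)
        = a (n + 1) + b n + ∑ t ∈ Finset.range n, b t := by abel
      _ ≤ a n + d n + ∑ t ∈ Finset.range n, b t := add_le_add_left (h n) _
      _ = a n + ∑ t ∈ Finset.range n, b t + d n := by abel
      _ ≤ a 0 + ∑ t ∈ Finset.range n, d t + d n := add_le_add_left ih _
      _ = a 0 + (∑ t ∈ Finset.range n, d t + d n) := add_assoc _ _ _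

section Law

variable {N M L W A Z : Type u} [MeasurableSpace W] [MeasurableSpace A] [MeasurableSpace Z]
  [Fintype M] {S : Network N M W A Z} {C : Program S L} {R : RenewalRule N M L W A Z}

theorem measurable_initialBacklog :
    Measurable fun p : Path N M L W A Z => backlog S C p 0 :=
  measurable_pi_apply (X := Coord N M L W A Z) 0

theorem map_law_initialBacklog (π : Policy S C) (ρ : Measure (Backlog N M L))
    [IsProbabilityMeasure ρ] : (π.law ρ).map (fun p => backlog S C p 0) = ρ := by
  let ρ₀ : Measure (Coord N M L W A Z 0) := ρ
  let e : Hist N M L W A Z 0 ≃ᵐ Coord N M L W A Z 0 :=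
    MeasurableEquiv.piUnique fun i : Finset.Iic 0 => Coord N M L W A Z i
  have hpast : (π.law ρ).map (past 0) = ρ₀.map e.symm := by
    change (Measure.bind (ρ₀.map e.symm) (Kernel.traj π.step 0)).map (frestrictLe 0) = _
    rw [Measure.map_comp _ _ (measurable_frestrictLe 0), Kernel.traj_map_frestrictLe,
      Kernel.partialTraj_self, Measure.id_comp]
  have hmap := Measure.map_map (μ := π.law ρ) e.measurable
    (measurable_frestrictLe (X := Coord N M L W A Z) 0)
  rw [hpast, e.map_map_symm] at hmap
  exact hmap.symm

/-- The properties which almost all trajectories have: all slots are admissible, the queues `Q` and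
`Y` are nonnegative, and a renewal occurs at time `0` and after every time. -/
structure IsTypical (S : Network N M W A Z) (C : Program S L) (R : RenewalRule N M L W A Z)
    (p : Path N M L W A Z) : Prop where
  admissible : ∀ τ, S.Admissible C.α (point S p τ) (aux p τ)
  queue_nonneg : ∀ t n, 0 ≤ (backlog S C.zeroExtend p t).1 n
  virtual_nonneg : ∀ t l, 0 ≤ (backlog S C.zeroExtend p t).2.1 l
  renewsAt_zero : RenewsAt R p 0
  frameLength_lt_top : ∀ t, frameLength R t p < ⊤

theorem ae_isTypical [Finite N] (hR : HasBoundedMoments S C R) (π : Policy S C)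
    {ρ : Measure (Backlog N M L)} [IsProbabilityMeasure ρ]
    (hρ : ∀ᵐ θ ∂ρ, (∀ n, 0 ≤ θ.1 n) ∧ ∀ l, 0 ≤ θ.2.1 l) :
    ∀ᵐ p ∂π.law ρ, IsTypical S C R p := by
  have hinitial : ∀ᵐ p ∂π.law ρ, (∀ n, 0 ≤ (backlog S C.zeroExtend p 0).1 n) ∧
      ∀ l, 0 ≤ (backlog S C.zeroExtend p 0).2.1 l := by
    rw [← map_law_initialBacklog π ρ] at hρ
    exact ae_of_ae_map measurable_initialBacklog.aemeasurable hρ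
  filter_upwards [hinitial, (π.evolvesFrom_law ρ).ae_admissible,
    hR.ae_frameLength_lt_top_of_evolvesFrom (π.evolvesFrom_law ρ)] with p h₀ hadm hfin
  have hnonneg (t : ℕ) := backlog_nonneg (C := C.zeroExtend) (t := t) h₀
    fun τ _ => hadm τ τ.zero_le
  exact ⟨fun τ => hadm τ τ.zero_le, fun t => (hnonneg t).1, fun t => (hnonneg t).2,
    hR.renewsAt_zero p, hfin⟩

theorem lintegral_lyapunov_initial [Fintype N] [Fintype L] (π : Policy S C)
    {ρ : Measure (Backlog N M L)} [IsProbabilityMeasure ρ] (hρL : Integrable lyapunov ρ) :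
    ∫⁻ p, ENNReal.ofReal (lyapunov (backlog S C.zeroExtend p 0)) ∂π.law ρ =
      ENNReal.ofReal (∫ θ, lyapunov θ ∂ρ) := by
  rw [ofReal_integral_eq_lintegral_ofReal hρL (ae_of_all _ lyapunov_nonneg)]
  conv_rhs => rw [← map_law_initialBacklog π ρ]
  rw [lintegral_map' (by rw [map_law_initialBacklog π ρ]; exact hρL.1.aemeasurable.ennreal_ofReal)
    measurable_initialBacklog.aemeasurable]
  rfl

namespace IsTypical

variable {p : Path N M L W A Z} (hp : IsTypical S C R p)
include hp

theorem backlog_zeroExtend_eq (t : ℕ) : backlog S C.zeroExtend p t = backlog S C p t :=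
  backlog_zeroExtend fun τ _ => (hp.admissible τ).1

theorem penalty_nonneg (s : Finset ℕ) :
    0 ≤ C.V * ∑ τ ∈ s, (C.zeroExtend.f (aux p τ) - C.fmin) :=
  mul_nonneg C.V_nonneg (Finset.sum_nonneg fun τ _ =>
    sub_nonneg.2 (C.zeroExtend.f_bd _ (hp.admissible τ).1).1)

end IsTypical

end Law

section HasFrameDrift

variable {N M L W A Z : Type u} [MeasurableSpace W] [MeasurableSpace A] [MeasurableSpace Z]
  [Fintype M] {S : Network N M W A Z} {C : Program S L} {R : RenewalRule N M L W A Z}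
  {π : Policy S C} {ρ : Measure (Backlog N M L)}

theorem measurable_sum_penalty (s : Finset ℕ) : Measurable fun p : Path N M L W A Z =>
    C.V * ∑ τ ∈ s, (C.zeroExtend.f (aux p τ) - C.fmin) :=
  (Finset.measurable_fun_sum _ fun τ _ => (C.measurable_zeroExtend_f.comp
    ((measurable_aux τ.lt_succ_self).mono (Filtration.piLE.le _) le_rfl)).sub_const _).const_mul _

variable [Fintype N]

theorem measurable_sum_queue (t : ℕ) : Measurable[Filtration.piLE t]
    fun p : Path N M L W A Z => ∑ n, (backlog S C.zeroExtend p t).1 n :=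
  Finset.measurable_fun_sum _ fun n _ => (measurable_pi_apply n).comp
    (measurable_fst.comp (measurable_backlog C.measurable_zeroExtend_h t))

theorem sum_lintegral_enorm_queue_eq {ν : Path N M L W A Z → ℕ} (hν : Measurable ν)
    (htyp : ∀ᵐ p ∂π.law ρ, IsTypical S C R p) :
    ∑ n, ∫⁻ p, ‖(backlog S C p (ν p)).1 n‖ₑ ∂π.law ρ =
      ∫⁻ p, ENNReal.ofReal (∑ n, (backlog S C.zeroExtend p (ν p)).1 n) ∂π.law ρ := by
  have hmeas (n : N) : Measurable fun p => (backlog S C.zeroExtend p (ν p)).1 n :=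
    measurable_comp_nat hν fun k => ((measurable_pi_apply n).comp
      (measurable_backlog C.measurable_zeroExtend_h k).fst).mono (Filtration.piLE.le k) le_rfl
  calc ∑ n, ∫⁻ p, ‖(backlog S C p (ν p)).1 n‖ₑ ∂π.law ρ
    _ = ∑ n, ∫⁻ p, ENNReal.ofReal ((backlog S C.zeroExtend p (ν p)).1 n) ∂π.law ρ := by
      refine Finset.sum_congr rfl fun n _ => lintegral_congr_ae (htyp.mono fun p hp => ?_)
      simp only [← hp.backlog_zeroExtend_eq, Real.enorm_of_nonneg (hp.queue_nonneg _ n)]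
    _ = ∫⁻ p, ∑ n, ENNReal.ofReal ((backlog S C.zeroExtend p (ν p)).1 n) ∂π.law ρ :=
      (lintegral_finsetSum _ fun n _ => (hmeas n).ennreal_ofReal).symm
    _ = ∫⁻ p, ENNReal.ofReal (∑ n, (backlog S C.zeroExtend p (ν p)).1 n) ∂π.law ρ :=
      lintegral_congr_ae <| htyp.mono fun p hp =>
        (ENNReal.ofReal_sum_of_nonneg fun n _ => hp.queue_nonneg _ n).symm

variable [Fintype L]

theorem measurable_lyapunov_backlog (t : ℕ) :
    Measurable fun p : Path N M L W A Z => lyapunov (backlog S C.zeroExtend p t) := by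
  have hΘ : Measurable fun p : Path N M L W A Z => backlog S C.zeroExtend p t :=
    (measurable_backlog C.measurable_zeroExtend_h t).mono (Filtration.piLE.le t) le_rfl
  unfold lyapunov
  fun_prop

theorem measurable_frameValue (hR : HasBoundedMoments S C R) (t : ℕ) :
    Measurable (frameValue S C.zeroExtend R t) :=
  measurable_comp_nat (measurable_frameNat hR.meas t)
    (g := fun k p => lyapunov (backlog S C.zeroExtend p (t + k)) +
      C.V * ∑ i ∈ Finset.range k, (C.zeroExtend.f (aux p (t + i)) - C.fmin)) fun k =>
    (measurable_lyapunov_backlog _).add <| by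
      simpa only [Finset.sum_map, addLeftEmbedding_apply] using
        measurable_sum_penalty (C := C) ((Finset.range k).map (addLeftEmbedding t))

/-- The drift condition over the renewal intervals: the Lyapunov function plus the penalty of an
interval is in the mean at most the Lyapunov function at its start, minus `c` times the sum of the
queues, plus `K`. The sets `E` of trajectories select the renewals to which it is applied. -/
def HasFrameDrift (R : RenewalRule N M L W A Z) (π : Policy S C) (ρ : Measure (Backlog N M L))
    (c K : ℝ) : Prop :=
  ∀ t, ∀ E ⊆ {p | RenewsAt R p t}, MeasurableSet[Filtration.piLE t] E →
    ∫⁻ p in E, ENNReal.ofReal (frameValue S C.zeroExtend R t p) ∂π.law ρ +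
      ENNReal.ofReal c *
        ∫⁻ p in E, ENNReal.ofReal (∑ n, (backlog S C.zeroExtend p t).1 n) ∂π.law ρ ≤
    ∫⁻ p in E, ENNReal.ofReal (lyapunov (backlog S C.zeroExtend p t)) ∂π.law ρ +
      ENNReal.ofReal K * π.law ρ E

theorem hasFrameDrift [IsProbabilityMeasure ρ] (hR : HasBoundedMoments S C R)
    (htyp : ∀ᵐ p ∂π.law ρ, IsTypical S C R p) (hπ : SolvesShortestPath R π ρ) {B₂ : ℝ}
    (hB : IsDriftConstant R π B₂) {ε : ℝ} (hε : 0 ≤ ε) {γ : M → ℝ} (hγ : Attains C R ε γ) {c K : ℝ}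
    (hc : ∀ (π' : Policy S C) t, ∀ h ∈ R t, c ≤ ε * ∫ p, (frameNat R t p : ℝ) ∂π'.lawFrom t h)
    (hK : ∀ (π' : Policy S C) t, ∀ h ∈ R t,
      B₂ + C.V * (C.f γ * ∫ p, (frameNat R t p : ℝ) ∂π'.lawFrom t h -
        C.fmin * ∫ p, (frameNat R t p : ℝ) ∂π.lawFrom t h) ≤ K) :
    HasFrameDrift R π ρ c K := by
  intro t E hER hE
  obtain ⟨π', hπ'⟩ := hγ.exists_policy_weightedCost_le hR (hγ.mem_box hR π)
  have hEm := Filtration.piLE.le t E hE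
  have hQm := ((measurable_sum_queue (S := S) (C := C) t).mono
    (Filtration.piLE.le t) le_rfl).ennreal_ofReal
  have hLm := (measurable_lyapunov_backlog (S := S) (C := C) t).ennreal_ofReal
  rw [(π.evolvesFrom_law ρ).setLIntegral t.zero_le hE (measurable_frameValue hR t).ennreal_ofReal,
    ← lintegral_const_mul _ hQm, ← lintegral_add_right _ (hQm.const_mul _), ← setLIntegral_const,
    ← lintegral_add_left hLm]
  refine lintegral_mono_ae ((ae_restrict_iff' hEm).2 ?_)
  filter_upwards [htyp, hπ π' t] with p hp hopt hpE
  have ht : RenewsAt R p t := hER hpE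
  have hsum := Finset.sum_nonneg fun n (_ : n ∈ Finset.univ) => hp.queue_nonneg t n
  have hT' := mul_nonneg hε (zero_le_one.trans (hR.one_le_integral_frameNat π' ht))
  have hcost := hπ' t _ ht _ (hp.queue_nonneg t) (hp.virtual_nonneg t)
  rw [sub_mul, mul_right_comm ε] at hcost
  refine le_trans (add_le_add_right ?_ _) (hB.lintegral_frameValue_add_le hR ht
    (fun τ _ => hp.admissible τ) (hp.queue_nonneg t) (hp.virtual_nonneg t) (hopt ht)
    (mul_nonneg hT' hsum) hcost (le_trans (le_of_eq (by ring)) (hK π' t _ ht)))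
  rw [← ENNReal.ofReal_mul' hsum]
  exact ENNReal.ofReal_le_ofReal (mul_le_mul_of_nonneg_right (hc π' t _ ht) hsum)

end HasFrameDrift

section Potential

variable {N M L W A Z : Type u} [MeasurableSpace W] [MeasurableSpace A] [MeasurableSpace Z]
  [Fintype N] [Fintype M] [Fintype L] {S : Network N M W A Z} {C : Program S L}
  {R : RenewalRule N M L W A Z} {π : Policy S C} {ρ : Measure (Backlog N M L)} {c K : ℝ}

/-- The Lyapunov function at the first renewal time which is not smaller than `t`, plus the
penalty incurred until then. -/
noncomputable def potential (S : Network N M W A Z) (C : Program S L)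
    (R : RenewalRule N M L W A Z) (t : ℕ) (p : Path N M L W A Z) : ℝ :=
  lyapunov (backlog S C p (nextRenewal R p t)) +
    C.V * ∑ τ ∈ Finset.range (nextRenewal R p t), (C.f (aux p τ) - C.fmin)

theorem IsTypical.ofReal_potential_of_renewsAt {p : Path N M L W A Z} (hp : IsTypical S C R p)
    {t : ℕ} (ht : RenewsAt R p t) : ENNReal.ofReal (potential S C.zeroExtend R t p) =
      ENNReal.ofReal (lyapunov (backlog S C.zeroExtend p t)) +
        ENNReal.ofReal (C.V * ∑ τ ∈ Finset.range t, (C.zeroExtend.f (aux p τ) - C.fmin)) := by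
  rw [← ENNReal.ofReal_add (lyapunov_nonneg _) (hp.penalty_nonneg _), potential,
    nextRenewal_of_renewsAt ht]
  rfl

theorem IsTypical.ofReal_potential_succ {p : Path N M L W A Z} (hp : IsTypical S C R p)
    (t : ℕ) : ENNReal.ofReal (potential S C.zeroExtend R (t + 1) p) =
      ENNReal.ofReal (frameValue S C.zeroExtend R t p) +
        ENNReal.ofReal (C.V * ∑ τ ∈ Finset.range t, (C.zeroExtend.f (aux p τ) - C.fmin)) := by
  rw [← ENNReal.ofReal_add (frameValue_nonneg (C := C.zeroExtend) fun τ _ => (hp.admissible τ).1)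
    (hp.penalty_nonneg _), potential, nextRenewal, Finset.sum_range_add, frameValue]
  congr 1
  simp only [frameSum, frameNat, Program.zeroExtend]
  ring

theorem IsTypical.potential_succ_of_not_renewsAt {p : Path N M L W A Z}
    (hp : IsTypical S C R p) {t : ℕ} (ht : ¬ RenewsAt R p t) :
    potential S C.zeroExtend R (t + 1) p = potential S C.zeroExtend R t p := by
  rw [potential, potential,
    nextRenewal_succ_of_not_renewsAt hp.renewsAt_zero hp.frameLength_lt_top ht]

theorem HasFrameDrift.lintegral_potential_succ_add_le (hR : HasBoundedMoments S C R)
    (htyp : ∀ᵐ p ∂π.law ρ, IsTypical S C R p) (hd : HasFrameDrift R π ρ c K) (t : ℕ) :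
    ∫⁻ p, ENNReal.ofReal (potential S C.zeroExtend R (t + 1) p) ∂π.law ρ +
      ENNReal.ofReal c * ∫⁻ p in {p | RenewsAt R p t},
        ENNReal.ofReal (∑ n, (backlog S C.zeroExtend p t).1 n) ∂π.law ρ ≤
    ∫⁻ p, ENNReal.ofReal (potential S C.zeroExtend R t p) ∂π.law ρ +
      ENNReal.ofReal K * π.law ρ {p | RenewsAt R p t} := by
  have hE := measurableSet_renewsAt hR.meas (R := R) (le_refl t)
  have hEm := Filtration.piLE.le t _ hE
  have hdrift := hd t _ subset_rfl hE
  let penalty (p : Path N M L W A Z) : ℝ≥0∞ :=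
    ENNReal.ofReal (C.V * ∑ τ ∈ Finset.range t, (C.zeroExtend.f (aux p τ) - C.fmin))
  have hpenalty : Measurable penalty := (measurable_sum_penalty _).ennreal_ofReal
  have hsucc : ∫⁻ p in {p | RenewsAt R p t},
        ENNReal.ofReal (potential S C.zeroExtend R (t + 1) p) ∂π.law ρ =
      ∫⁻ p in {p | RenewsAt R p t}, ENNReal.ofReal (frameValue S C.zeroExtend R t p) ∂π.law ρ +
        ∫⁻ p in {p | RenewsAt R p t}, penalty p ∂π.law ρ := by
    rw [← lintegral_add_right _ hpenalty]
    exact lintegral_congr_ae (ae_restrict_of_ae (htyp.mono fun p hp => hp.ofReal_potential_succ t))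
  have hself : ∫⁻ p in {p | RenewsAt R p t},
        ENNReal.ofReal (potential S C.zeroExtend R t p) ∂π.law ρ =
      ∫⁻ p in {p | RenewsAt R p t},
        ENNReal.ofReal (lyapunov (backlog S C.zeroExtend p t)) ∂π.law ρ +
      ∫⁻ p in {p | RenewsAt R p t}, penalty p ∂π.law ρ := by
    rw [← lintegral_add_right _ hpenalty]
    exact lintegral_congr_ae ((ae_restrict_iff' hEm).2
      (htyp.mono fun p hp hpE => hp.ofReal_potential_of_renewsAt hpE))
  have hcompl : ∫⁻ p in {p | RenewsAt R p t}ᶜ,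
        ENNReal.ofReal (potential S C.zeroExtend R (t + 1) p) ∂π.law ρ =
      ∫⁻ p in {p | RenewsAt R p t}ᶜ, ENNReal.ofReal (potential S C.zeroExtend R t p) ∂π.law ρ :=
    lintegral_congr_ae ((ae_restrict_iff' hEm.compl).2 (htyp.mono fun p hp hpE =>
      congrArg ENNReal.ofReal (hp.potential_succ_of_not_renewsAt hpE)))
  have hsplit (s : ℕ) := (lintegral_add_compl (μ := π.law ρ)
    (fun p => ENNReal.ofReal (potential S C.zeroExtend R s p)) hEm).symm
  rw [hsplit (t + 1), hsucc, hcompl, hsplit t, hself]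
  simpa only [add_assoc, add_comm, add_left_comm] using add_le_add_left hdrift
    (∫⁻ p in {p | RenewsAt R p t}, penalty p ∂π.law ρ + ∫⁻ p in {p | RenewsAt R p t}ᶜ,
      ENNReal.ofReal (potential S C.zeroExtend R t p) ∂π.law ρ)

theorem HasFrameDrift.lintegral_potential_le [IsProbabilityMeasure ρ]
    (hR : HasBoundedMoments S C R) (htyp : ∀ᵐ p ∂π.law ρ, IsTypical S C R p)
    (hρL : Integrable lyapunov ρ) (hd : HasFrameDrift R π ρ c K) (t : ℕ) :
    ∫⁻ p, ENNReal.ofReal (potential S C.zeroExtend R t p) ∂π.law ρ +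
      ENNReal.ofReal c * ∑ s ∈ Finset.range t, ∫⁻ p in {p | RenewsAt R p s},
        ENNReal.ofReal (∑ n, (backlog S C.zeroExtend p s).1 n) ∂π.law ρ ≤
    ENNReal.ofReal (∫ θ, lyapunov θ ∂ρ) +
      ENNReal.ofReal K * ∑ s ∈ Finset.range t, π.law ρ {p | RenewsAt R p s} := by
  have hinitial : ∫⁻ p, ENNReal.ofReal (potential S C.zeroExtend R 0 p) ∂π.law ρ =
      ENNReal.ofReal (∫ θ, lyapunov θ ∂ρ) := by
    simp [← lintegral_lyapunov_initial π hρL, potential, nextRenewal]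
  rw [Finset.mul_sum, Finset.mul_sum, ← hinitial]
  exact add_sum_range_le_of_forall_succ_add_le
    (a := fun t => ∫⁻ p, ENNReal.ofReal (potential S C.zeroExtend R t p) ∂π.law ρ)
    (b := fun t => ENNReal.ofReal c * ∫⁻ p in {p | RenewsAt R p t},
      ENNReal.ofReal (∑ n, (backlog S C.zeroExtend p t).1 n) ∂π.law ρ)
    (d := fun t => ENNReal.ofReal K * π.law ρ {p | RenewsAt R p t})
    (hd.lintegral_potential_succ_add_le hR htyp) t

end Potential

section RenewalTimes

variable {N M L W A Z : Type u} {R : RenewalRule N M L W A Z} {p : Path N M L W A Z} {g s : ℕ}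

theorem renewalTime_succ_eq_iff : renewalTime R p (g + 1) = s ↔
    ∃ r ≤ s, renewalTime R p g = r ∧ frameLength R r p = (s - r : ℕ) := by
  constructor
  · intro h
    rw [renewalTime] at h
    obtain ⟨hr, hk⟩ := WithTop.add_ne_top.1 (h.trans_ne (ENat.natCast_ne_top s))
    obtain ⟨r, hr⟩ := ENat.ne_top_iff_exists.1 hr
    rw [← hr, ENat.toNat_natCast] at h hk
    obtain ⟨k, hk⟩ := ENat.ne_top_iff_exists.1 hk
    rw [← hk] at h
    have hrk : r + k = s := by exact_mod_cast h
    exact ⟨r, hrk ▸ Nat.le_add_right r k, hr.symm, by rw [← hk, ← hrk, Nat.add_sub_cancel_left]⟩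
  · rintro ⟨r, hrs, hr, hk⟩
    rw [renewalTime, hr, ENat.toNat_natCast, hk]
    exact_mod_cast Nat.add_sub_cancel' hrs

theorem renewalTime_succ_of_eq (hs : renewalTime R p g = s) (hfin : frameLength R s p < ⊤) :
    renewalTime R p (g + 1) = (s + frameNat R s p : ℕ) := by
  rw [renewalTime, hs, ENat.toNat_natCast, ← coe_frameNat hfin, Nat.cast_add]

theorem renewsAt_of_renewalTime_eq (h0 : RenewsAt R p 0) (hs : renewalTime R p g = s) :
    RenewsAt R p s := by
  cases g with
  | zero =>
    have hs' : (0 : ℕ∞) = s := hs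
    obtain rfl : 0 = s := by exact_mod_cast hs'
    exact h0
  | succ g =>
    obtain ⟨r, hrs, -, hlength⟩ := renewalTime_succ_eq_iff.1 hs
    have hrenews := renewsAt_add_frameNat (hlength.trans_lt (ENat.natCast_lt_top _))
    rwa [frameNat, hlength, ENat.toNat_natCast, Nat.add_sub_cancel' hrs] at hrenews

theorem exists_renewalTime_eq (hfin : ∀ s, frameLength R s p < ⊤) (g : ℕ) :
    ∃ s : ℕ, renewalTime R p g = s := by
  induction g with
  | zero => exact ⟨0, rfl⟩
  | succ g ih =>
    obtain ⟨s, hs⟩ := ih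
    exact ⟨_, renewalTime_succ_of_eq hs (hfin s)⟩

variable [MeasurableSpace W] [MeasurableSpace A] [MeasurableSpace Z]

theorem measurableSet_frameLength_eq (hR : ∀ t, MeasurableSet (R t)) (t k : ℕ) :
    MeasurableSet[Filtration.piLE (t + k)]
      {p : Path N M L W A Z | frameLength R t p = k} := by
  cases k with
  | zero => simpa only [Nat.cast_zero, frameLength_ne_zero] using MeasurableSet.const False
  | succ k =>
    simp only [frameLength_eq_succ_iff]
    exact (Filtration.piLE.mono (Nat.le_succ _) _ (measurableSet_coe_lt_frameLength hR t k)).inter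
      (measurableSet_renewsAt hR le_rfl)

theorem measurableSet_renewalTime_eq (hR : ∀ t, MeasurableSet (R t)) (g s : ℕ) :
    MeasurableSet[Filtration.piLE s] {p : Path N M L W A Z | renewalTime R p g = s} := by
  induction g generalizing s with
  | zero => exact MeasurableSet.const ((0 : ℕ∞) = s)
  | succ g ih =>
    have hunion : {p : Path N M L W A Z | renewalTime R p (g + 1) = s} = ⋃ r, ⋃ (_ : r ≤ s),
        {p | renewalTime R p g = r} ∩ {p | frameLength R r p = (s - r : ℕ)} := by
      ext p
      simp only [Set.mem_ofPred_eq, renewalTime_succ_eq_iff, Set.mem_iUnion, Set.mem_inter_iff,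
        exists_prop]
    rw [hunion]
    refine MeasurableSet.iUnion fun r => MeasurableSet.iUnion fun hr => ?_
    have hlength := measurableSet_frameLength_eq hR r (s - r)
    rw [Nat.add_sub_cancel' hr] at hlength
    exact (Filtration.piLE.mono hr _ (ih r)).inter hlength

theorem measurable_toNat_renewalTime (hR : ∀ t, MeasurableSet (R t)) (g : ℕ) :
    Measurable fun p : Path N M L W A Z => (renewalTime R p g).toNat :=
  (measurable_of_countable ENat.toNat).comp <| ENat.measurable_iff.2 fun s =>
    Filtration.piLE.le _ _ (measurableSet_renewalTime_eq hR g s)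

theorem lintegral_eq_tsum_renewalTime (hR : ∀ t, MeasurableSet (R t))
    {μ : Measure (Path N M L W A Z)} (hμ : ∀ᵐ p ∂μ, ∀ t, frameLength R t p < ⊤) (g : ℕ)
    (F : Path N M L W A Z → ℝ≥0∞) :
    ∫⁻ p, F p ∂μ = ∑' s : ℕ, ∫⁻ p in {p | renewalTime R p g = s}, F p ∂μ := by
  rw [← lintegral_iUnion fun s => Filtration.piLE.le _ _ (measurableSet_renewalTime_eq hR g s),
    ← setLIntegral_univ]
  · refine setLIntegral_congr (eventuallyEq_univ.2 ?_).symm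
    filter_upwards [hμ] with p hp
    exact Set.mem_iUnion.2 (exists_renewalTime_eq hp g)
  · intro i j hij
    refine Set.disjoint_left.2 fun p hi hj => hij ?_
    exact_mod_cast hi.symm.trans hj

theorem lintegral_comp_renewalTime (hR : ∀ t, MeasurableSet (R t)) {μ : Measure (Path N M L W A Z)}
    (hμ : ∀ᵐ p ∂μ, ∀ t, frameLength R t p < ⊤) (g : ℕ) (F : ℕ → Path N M L W A Z → ℝ≥0∞) :
    ∫⁻ p, F (renewalTime R p g).toNat p ∂μ =
      ∑' s : ℕ, ∫⁻ p in {p | renewalTime R p g = s}, F s p ∂μ := by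
  rw [lintegral_eq_tsum_renewalTime hR hμ g]
  refine tsum_congr fun s => setLIntegral_congr_fun
    (Filtration.piLE.le _ _ (measurableSet_renewalTime_eq hR g s)) fun p hp => ?_
  simp only [hp.out, ENat.toNat_natCast]

variable [Fintype N] [Fintype M] [Fintype L] {S : Network N M W A Z} {C : Program S L}
  {π : Policy S C} {ρ : Measure (Backlog N M L)} {c K : ℝ}

theorem HasFrameDrift.lintegral_renewalTime_succ_add_le [IsProbabilityMeasure ρ]
    (hR : HasBoundedMoments S C R) (htyp : ∀ᵐ p ∂π.law ρ, IsTypical S C R p)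
    (hd : HasFrameDrift R π ρ c K) (g : ℕ) :
    ∫⁻ p, ENNReal.ofReal
        (lyapunov (backlog S C.zeroExtend p (renewalTime R p (g + 1)).toNat)) ∂π.law ρ +
      ENNReal.ofReal c * ∫⁻ p,
        ENNReal.ofReal (∑ n, (backlog S C.zeroExtend p (renewalTime R p g).toNat).1 n) ∂π.law ρ ≤
    ∫⁻ p, ENNReal.ofReal
        (lyapunov (backlog S C.zeroExtend p (renewalTime R p g).toNat)) ∂π.law ρ +
      ENNReal.ofReal K := by
  have hfin := htyp.mono fun p hp => hp.frameLength_lt_top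
  have hE (s : ℕ) := measurableSet_renewalTime_eq hR.meas (R := R) g s
  have hconst : ENNReal.ofReal K = ∑' s : ℕ, ENNReal.ofReal K *
      π.law ρ {p | renewalTime R p g = s} := by
    have := lintegral_eq_tsum_renewalTime hR.meas hfin g fun _ => ENNReal.ofReal K
    simpa only [lintegral_const, measure_univ, mul_one, Measure.restrict_apply_univ] using this
  rw [lintegral_eq_tsum_renewalTime hR.meas hfin g,
    lintegral_comp_renewalTime hR.meas hfin g fun s p =>
      ENNReal.ofReal (∑ n, (backlog S C.zeroExtend p s).1 n),
    lintegral_comp_renewalTime hR.meas hfin g fun s p =>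
      ENNReal.ofReal (lyapunov (backlog S C.zeroExtend p s)),
    hconst, ← ENNReal.tsum_mul_left, ← ENNReal.tsum_add, ← ENNReal.tsum_add]
  refine ENNReal.tsum_le_tsum fun s => (add_le_add_left ?_ _).trans (hd s _
    (fun p hp => renewsAt_of_renewalTime_eq (hR.renewsAt_zero p) hp) (hE s))
  refine lintegral_mono_ae ((ae_restrict_iff' (Filtration.piLE.le _ _ (hE s))).2 ?_)
  filter_upwards [htyp] with p hp hs
  rw [renewalTime_succ_of_eq hs (hp.frameLength_lt_top s), ENat.toNat_natCast]
  refine ENNReal.ofReal_le_ofReal (le_add_of_nonneg_right ?_)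
  have hpenalty := hp.penalty_nonneg ((Finset.range (frameNat R s p)).map (addLeftEmbedding s))
  simp only [Finset.sum_map, addLeftEmbedding_apply] at hpenalty
  exact hpenalty

theorem HasFrameDrift.sum_lintegral_renewalTime_le [IsProbabilityMeasure ρ]
    (hR : HasBoundedMoments S C R) (htyp : ∀ᵐ p ∂π.law ρ, IsTypical S C R p)
    (hρL : Integrable lyapunov ρ) (hd : HasFrameDrift R π ρ c K) (G : ℕ) :
    ENNReal.ofReal c * ∑ g ∈ Finset.range G, ∫⁻ p,
      ENNReal.ofReal (∑ n, (backlog S C.zeroExtend p (renewalTime R p g).toNat).1 n) ∂π.law ρ ≤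
    ENNReal.ofReal (∫ θ, lyapunov θ ∂ρ) + ENNReal.ofReal K * G := by
  have htel := add_sum_range_le_of_forall_succ_add_le
    (a := fun g => ∫⁻ p, ENNReal.ofReal
      (lyapunov (backlog S C.zeroExtend p (renewalTime R p g).toNat)) ∂π.law ρ)
    (b := fun g => ENNReal.ofReal c * ∫⁻ p,
      ENNReal.ofReal (∑ n, (backlog S C.zeroExtend p (renewalTime R p g).toNat).1 n) ∂π.law ρ)
    (d := fun _ => ENNReal.ofReal K)
    (hd.lintegral_renewalTime_succ_add_le hR htyp) G
  rw [← Finset.mul_sum, Finset.sum_const, Finset.card_range, nsmul_eq_mul, mul_comm (G : ℝ≥0∞)]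
    at htel
  rw [← lintegral_lyapunov_initial π hρL]
  exact le_add_self.trans htel

end RenewalTimes

/-! ### Rate stability -/

section SquareBound

variable {α : Type*} [MeasurableSpace α] {μ : Measure α} [IsProbabilityMeasure μ]

theorem lintegral_le_lintegral_sq_div_add (X : α → ℝ≥0∞) {s : ℝ≥0} (hs : s ≠ 0) :
    ∫⁻ x, X x ∂μ ≤ (∫⁻ x, X x ^ 2 ∂μ) / s + s := by
  have hle (y : ℝ≥0∞) : y ≤ y ^ 2 * (s : ℝ≥0∞)⁻¹ + s := by
    rcases le_total y s with hy | hy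
    · exact le_add_left hy
    · refine le_add_right ?_
      rw [← div_eq_mul_inv, ENNReal.le_div_iff_mul_le (by simp [hs]) (by simp), sq]
      gcongr
  calc ∫⁻ x, X x ∂μ ≤ ∫⁻ x, (X x ^ 2 * (s : ℝ≥0∞)⁻¹ + s) ∂μ := lintegral_mono fun x => hle (X x)
    _ = (∫⁻ x, X x ^ 2 ∂μ) / s + s := by
      rw [lintegral_add_right _ measurable_const, lintegral_mul_const' _ _ (by simp [hs]),
        lintegral_const, measure_univ, mul_one, div_eq_mul_inv]

theorem tendsto_lintegral_div_of_lintegral_sq_le {X : ℕ → α → ℝ≥0∞} {a b : ℝ≥0∞} (ha : a ≠ ⊤)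
    (hb : b ≠ ⊤) (hX : ∀ t : ℕ, ∫⁻ x, X t x ^ 2 ∂μ ≤ a + b * t) :
    Tendsto (fun t : ℕ => (∫⁻ x, X t x ∂μ) / t) atTop (𝓝 0) := by
  let s (t : ℕ) : ℝ≥0 := NNReal.sqrt t
  have hs : Tendsto (fun t => (s t : ℝ≥0∞)) atTop (𝓝 ⊤) := ENNReal.tendsto_coe_nhds_top.2
    (NNReal.sqrt.tendsto_atTop.comp tendsto_natCast_atTop_atTop)
  have hlim : Tendsto (fun t => (a + b + 1) / (s t : ℝ≥0∞)) atTop (𝓝 0) := by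
    simpa only [ENNReal.div_top] using ENNReal.Tendsto.const_div hs
      (Or.inr (ENNReal.add_ne_top.2 ⟨ENNReal.add_ne_top.2 ⟨ha, hb⟩, ENNReal.one_ne_top⟩))
  refine tendsto_of_tendsto_of_tendsto_of_le_of_le' tendsto_const_nhds hlim
    (Eventually.of_forall fun _ => zero_le) ?_
  filter_upwards [eventually_ge_atTop 1] with t ht
  have hst : s t ≠ 0 := (NNReal.sqrt_pos.2 (by exact_mod_cast ht)).ne'
  have hsq : (t : ℝ≥0∞) = s t * s t := by exact_mod_cast (NNReal.mul_self_sqrt (t : ℝ≥0)).symm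
  have ht1 : (1 : ℝ≥0∞) ≤ t := by exact_mod_cast ht
  have hs0 : (s t : ℝ≥0∞) ≠ 0 := by exact_mod_cast hst
  rw [ENNReal.div_le_iff (by simp [hsq, hst]) (by simp)]
  calc ∫⁻ x, X t x ∂μ ≤ (a + b * t) / s t + s t :=
        (lintegral_le_lintegral_sq_div_add (X t) hst).trans (by gcongr; exact hX t)
    _ ≤ (a + b) * t / s t + s t := by
        rw [add_mul]
        gcongr
        exact le_mul_of_one_le_right zero_le ht1
    _ = (a + b + 1) / s t * t := by
        rw [hsq, ← mul_assoc, ENNReal.mul_div_cancel_right hs0 ENNReal.coe_ne_top, ← mul_assoc,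
          ENNReal.div_mul_cancel hs0 ENNReal.coe_ne_top, add_mul _ 1, one_mul]

end SquareBound

theorem enorm_sq_le_two_mul_ofReal {x y : ℝ} (hxy : x ^ 2 ≤ 2 * y) :
    ‖x‖ₑ ^ 2 ≤ 2 * ENNReal.ofReal y := by
  rw [Real.enorm_eq_ofReal_abs, ← ENNReal.ofReal_pow (abs_nonneg _), sq_abs,
    ← ENNReal.ofReal_ofNat, ← ENNReal.ofReal_mul zero_le_two]
  exact ENNReal.ofReal_le_ofReal hxy

section RateStability

variable {N M L W A Z : Type u} [MeasurableSpace W] [MeasurableSpace A] [MeasurableSpace Z]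
  [Fintype M] {S : Network N M W A Z} {C : Program S L} {R : RenewalRule N M L W A Z}
  {π : Policy S C} {ρ : Measure (Backlog N M L)} [IsProbabilityMeasure ρ]

theorem exists_hasFrameDrift [Fintype N] [Fintype L] (hR : HasBoundedMoments S C R)
    (htyp : ∀ᵐ p ∂π.law ρ, IsTypical S C R p) (hπ : SolvesShortestPath R π ρ) {B₂ : ℝ}
    (hB : IsDriftConstant R π B₂) {γ : M → ℝ} (hγ : Attains C R 0 γ) :
    ∃ K : ℝ, HasFrameDrift R π ρ 0 K := by
  obtain ⟨m, hm⟩ := hR.second_moment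
  have hmean (π' : Policy S C) (t : ℕ) (h : Hist N M L W A Z t) (hh : h ∈ R t) (x : ℝ) :
      x * ∫ p, (frameNat R t p : ℝ) ∂π'.lawFrom t h ≤ |x| * m := by
    refine mul_le_mul (le_abs_self x) ?_ (integral_nonneg fun p => Nat.cast_nonneg _) (abs_nonneg x)
    refine (hR.integral_frameNat_le_integral_sq π' hh).trans ?_
    rw [hR.integral_frameNat_sq π' hh]
    exact ENNReal.toReal_le_coe_of_le_coe (hm π' t h hh)
  refine ⟨B₂ + C.V * (|C.f γ| * m + |-C.fmin| * m), hasFrameDrift hR htyp hπ hB le_rfl hγ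
    (fun _ _ _ _ => (zero_mul _).ge) fun π' t h hh => ?_⟩
  rw [sub_eq_add_neg, ← neg_mul]
  exact add_le_add_right (mul_le_mul_of_nonneg_left
    (add_le_add (hmean π' t h hh _) (hmean π t h hh _)) C.V_nonneg) _

theorem setLIntegral_frameNat_sq_le (hR : HasBoundedMoments S C R) {m : ℝ≥0}
    (hm : ∀ t, ∀ h ∈ R t, ∫⁻ p, (frameLength R t p : ℝ≥0∞) ^ 2 ∂π.lawFrom t h ≤ m) (t : ℕ) :
    ∫⁻ p in {p | RenewsAt R p t}, (frameNat R t p : ℝ≥0∞) ^ 2 ∂π.law ρ ≤ m := by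
  have hE := measurableSet_renewsAt hR.meas (R := R) (le_refl t)
  calc ∫⁻ p in {p | RenewsAt R p t}, (frameNat R t p : ℝ≥0∞) ^ 2 ∂π.law ρ
      = ∫⁻ p in {p | RenewsAt R p t}, ∫⁻ q, (frameNat R t q : ℝ≥0∞) ^ 2
          ∂π.lawFrom t (past t p) ∂π.law ρ :=
        (π.evolvesFrom_law ρ).setLIntegral t.zero_le hE
          ((measurable_from_nat.comp (measurable_frameNat hR.meas t)).pow_const 2)
    _ ≤ ∫⁻ _ in {p | RenewsAt R p t}, m ∂π.law ρ := by
        refine setLIntegral_mono' (Filtration.piLE.le t _ hE) fun _ hp => ?_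
        refine (lintegral_mono_ae ?_).trans (hm t _ hp)
        filter_upwards [hR.ae_frameLength_lt_top π hp] with q hq
        rw [← coe_frameNat hq, ENat.toENNReal_coe]
    _ ≤ m := by
        rw [setLIntegral_const]
        exact mul_le_of_le_one_right zero_le prob_le_one

theorem lintegral_nextRenewal_sub_sq_le (hR : HasBoundedMoments S C R)
    (htyp : ∀ᵐ p ∂π.law ρ, IsTypical S C R p) {m : ℝ≥0}
    (hm : ∀ t, ∀ h ∈ R t, ∫⁻ p, (frameLength R t p : ℝ≥0∞) ^ 2 ∂π.lawFrom t h ≤ m) (t : ℕ) :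
    ∫⁻ p, ((nextRenewal R p t - t : ℕ) : ℝ≥0∞) ^ 2 ∂π.law ρ ≤ m * t := by
  induction t with
  | zero => simp [nextRenewal]
  | succ t ih =>
    have hE := Filtration.piLE.le t _ (measurableSet_renewsAt hR.meas (R := R) (le_refl t))
    have hrenews : ∫⁻ p in {p | RenewsAt R p t},
        ((nextRenewal R p (t + 1) - (t + 1) : ℕ) : ℝ≥0∞) ^ 2 ∂π.law ρ ≤ m := by
      refine (setLIntegral_mono' hE fun p _ => ?_).trans (setLIntegral_frameNat_sq_le hR hm t)
      rw [nextRenewal]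
      gcongr
      lia
    have hwaits : ∫⁻ p in {p | RenewsAt R p t}ᶜ,
        ((nextRenewal R p (t + 1) - (t + 1) : ℕ) : ℝ≥0∞) ^ 2 ∂π.law ρ ≤ m * t := by
      refine (lintegral_mono_ae ((ae_restrict_iff' hE.compl).2 ?_)).trans
        ((setLIntegral_le_lintegral _ _).trans ih)
      filter_upwards [htyp] with p hp hpE
      rw [nextRenewal_succ_of_not_renewsAt hp.renewsAt_zero hp.frameLength_lt_top hpE]
      gcongr
      lia
    rw [← lintegral_add_compl _ hE, Nat.cast_succ, mul_add, mul_one, add_comm]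
    exact add_le_add hwaits hrenews

variable [Fintype N] [Fintype L] {c K : ℝ}

theorem HasFrameDrift.lintegral_lyapunov_nextRenewal_le (hR : HasBoundedMoments S C R)
    (htyp : ∀ᵐ p ∂π.law ρ, IsTypical S C R p) (hρL : Integrable lyapunov ρ)
    (hd : HasFrameDrift R π ρ c K) (t : ℕ) :
    ∫⁻ p, ENNReal.ofReal (lyapunov (backlog S C.zeroExtend p (nextRenewal R p t))) ∂π.law ρ ≤
      ENNReal.ofReal (∫ θ, lyapunov θ ∂ρ) + ENNReal.ofReal K * t := by
  have hcount : ∑ s ∈ Finset.range t, π.law ρ {p | RenewsAt R p s} ≤ t := by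
    simpa using Finset.sum_le_sum (s := Finset.range t)
      fun s _ => (prob_le_one : π.law ρ {p | RenewsAt R p s} ≤ 1)
  calc ∫⁻ p, ENNReal.ofReal (lyapunov (backlog S C.zeroExtend p (nextRenewal R p t))) ∂π.law ρ
      ≤ ∫⁻ p, ENNReal.ofReal (potential S C.zeroExtend R t p) ∂π.law ρ :=
        lintegral_mono_ae <| htyp.mono fun p hp =>
          ENNReal.ofReal_le_ofReal (le_add_of_nonneg_right (hp.penalty_nonneg _))
    _ ≤ _ := le_self_add.trans (hd.lintegral_potential_le hR htyp hρL t)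
    _ ≤ _ := by gcongr

theorem HasFrameDrift.tendsto_lintegral_nextRenewal_div (hR : HasBoundedMoments S C R)
    (htyp : ∀ᵐ p ∂π.law ρ, IsTypical S C R p) (hρL : Integrable lyapunov ρ)
    (hd : HasFrameDrift R π ρ c K) {g : ℕ → Path N M L W A Z → ℝ}
    (hsq : ∀ᵐ p ∂π.law ρ, ∀ t, g t p ^ 2 ≤ 2 * lyapunov (backlog S C.zeroExtend p t)) :
    Tendsto (fun t : ℕ => (∫⁻ p, ‖g (nextRenewal R p t) p‖ₑ ∂π.law ρ) / (t : ℝ≥0∞))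
      atTop (𝓝 0) := by
  refine tendsto_lintegral_div_of_lintegral_sq_le (a := 2 * ENNReal.ofReal (∫ θ, lyapunov θ ∂ρ))
    (b := 2 * ENNReal.ofReal K) (by finiteness) (by finiteness) fun t => ?_
  rw [mul_assoc, ← mul_add]
  refine le_trans ?_ (mul_le_mul_right (hd.lintegral_lyapunov_nextRenewal_le hR htyp hρL t) 2)
  rw [← lintegral_const_mul' _ _ (by finiteness)]
  exact lintegral_mono_ae (hsq.mono fun p hp => enorm_sq_le_two_mul_ofReal (hp _))

theorem HasFrameDrift.tendsto_lintegral_div (hR : HasBoundedMoments S C R)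
    (htyp : ∀ᵐ p ∂π.law ρ, IsTypical S C R p) (hρL : Integrable lyapunov ρ)
    (hd : HasFrameDrift R π ρ c K) {g : ℕ → Path N M L W A Z → ℝ} {b : ℝ}
    (hstep : ∀ᵐ p ∂π.law ρ, ∀ t, |g (t + 1) p - g t p| ≤ b)
    (hsq : ∀ᵐ p ∂π.law ρ, ∀ t, g t p ^ 2 ≤ 2 * lyapunov (backlog S C.zeroExtend p t)) :
    Tendsto (fun t : ℕ => (∫⁻ p, ‖g t p‖ₑ ∂π.law ρ) / (t : ℝ≥0∞)) atTop (𝓝 0) := by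
  obtain ⟨m, hm⟩ := hR.second_moment
  let wait (t : ℕ) (p : Path N M L W A Z) : ℝ≥0∞ := (nextRenewal R p t - t : ℕ)
  have hwaitm (t : ℕ) : Measurable (wait t) := (measurable_from_nat
    (f := fun k : ℕ => ((k - t : ℕ) : ℝ≥0∞))).comp (measurable_nextRenewal hR.meas t)
  have hwait : Tendsto (fun t : ℕ => (∫⁻ p, wait t p ∂π.law ρ) / t) atTop (𝓝 0) :=
    tendsto_lintegral_div_of_lintegral_sq_le (a := 0) (b := m) ENNReal.zero_ne_top
      ENNReal.coe_ne_top fun t => (zero_add (m * (t : ℝ≥0∞))).symm ▸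
        lintegral_nextRenewal_sub_sq_le hR htyp (hm π) t
  have hle : ∀ᵐ p ∂π.law ρ, ∀ t,
      ‖g t p‖ₑ ≤ ‖g (nextRenewal R p t) p‖ₑ + wait t p * ENNReal.ofReal b := by
    filter_upwards [hstep, htyp] with p hp htyp t
    have hb : 0 ≤ b := (abs_nonneg _).trans (hp 0)
    simp only [wait, Real.enorm_eq_ofReal_abs]
    rw [← ENNReal.ofReal_natCast, ← ENNReal.ofReal_mul (Nat.cast_nonneg _),
      ← ENNReal.ofReal_add (abs_nonneg _) (by positivity)]
    exact ENNReal.ofReal_le_ofReal (abs_le_abs_add_of_step (g := fun τ => g τ p)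
      (fun τ _ => hp τ) (le_nextRenewal htyp.frameLength_lt_top))
  have hsum := (hd.tendsto_lintegral_nextRenewal_div hR htyp hρL hsq).add
    (ENNReal.Tendsto.mul_const (b := ENNReal.ofReal b) hwait (Or.inr ENNReal.ofReal_ne_top))
  rw [zero_mul, add_zero] at hsum
  refine tendsto_of_tendsto_of_tendsto_of_le_of_le tendsto_const_nhds hsum
    (fun _ => zero_le) fun t => ?_
  dsimp only
  rw [← ENNReal.mul_div_right_comm, ← ENNReal.add_div,
    ← lintegral_mul_const _ (hwaitm t), ← lintegral_add_right _ ((hwaitm t).mul_const _)]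
  gcongr ?_ / _
  exact lintegral_mono_ae (hle.mono fun p hp => hp t)

section Queues

variable (hR : HasBoundedMoments S C R) (htyp : ∀ᵐ p ∂π.law ρ, IsTypical S C R p)
  (hρL : Integrable lyapunov ρ) (hd : HasFrameDrift R π ρ c K)
include hR htyp hρL hd

theorem HasFrameDrift.tendsto_queue_div (n : N) :
    Tendsto (fun t : ℕ => (∫⁻ p, ‖(backlog S C p t).1 n‖ₑ ∂π.law ρ) / (t : ℝ≥0∞))
      atTop (𝓝 0) := by
  refine hd.tendsto_lintegral_div hR htyp hρL (b := S.μmax n + S.Rmax n)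
    (htyp.mono fun p hp t => ?_) (htyp.mono fun p hp t => ?_)
  · exact abs_queue_step_le (hp.admissible t) (hp.backlog_zeroExtend_eq t ▸ hp.queue_nonneg t n)
  · rw [hp.backlog_zeroExtend_eq]
    exact sq_queue_le_two_mul_lyapunov _ n

theorem HasFrameDrift.tendsto_virtual_div (l : L) :
    Tendsto (fun t : ℕ => (∫⁻ p, ‖(backlog S C p t).2.1 l‖ₑ ∂π.law ρ) / (t : ℝ≥0∞))
      atTop (𝓝 0) := by
  obtain ⟨b, hb⟩ := C.exists_abs_h_le l
  refine hd.tendsto_lintegral_div hR htyp hρL (b := |C.c l| + b)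
    (htyp.mono fun p hp t => ?_) (htyp.mono fun p hp t => ?_)
  · exact abs_virtual_step_le hb (hp.admissible t).1
      (hp.backlog_zeroExtend_eq t ▸ hp.virtual_nonneg t l)
  · rw [hp.backlog_zeroExtend_eq]
    exact sq_virtual_le_two_mul_lyapunov _ l

theorem HasFrameDrift.tendsto_balance_div (m : M) :
    Tendsto (fun t : ℕ => (∫⁻ p, ‖(backlog S C p t).2.2 m‖ₑ ∂π.law ρ) / (t : ℝ≥0∞))
      atTop (𝓝 0) := by
  refine hd.tendsto_lintegral_div hR htyp hρL (b := S.xmax m - S.xmin m + C.α)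
    (htyp.mono fun p hp t => ?_) (htyp.mono fun p hp t => ?_)
  · have hstep : (backlog S C p (t + 1)).2.2 m - (backlog S C p t).2.2 m =
        -(aux p t m - S.xhat m (point S p t)) := by
      simp only [backlog]
      ring
    rw [hstep, abs_neg]
    exact abs_aux_sub_le (hp.admissible t) m
  · rw [hp.backlog_zeroExtend_eq]
    exact sq_balance_le_two_mul_lyapunov _ m

end Queues

end RateStability

/-! ### Time averages -/

theorem limsup_coe_ereal_le {u v : ℕ → ℝ} {a : ℝ} (huv : ∀ᶠ t in atTop, u t ≤ v t)
    (hv : Tendsto v atTop (𝓝 a)) : limsup (fun t => (u t : EReal)) atTop ≤ (a : EReal) := by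
  rw [← ((continuous_coe_real_ereal.tendsto a).comp hv).limsup_eq]
  exact limsup_le_limsup (huv.mono fun t ht => EReal.coe_le_coe_iff.2 ht)

theorem sum_range_one_div {t : ℕ} (ht : 1 ≤ t) : ∑ _τ ∈ Finset.range t, 1 / (t : ℝ) = 1 := by
  have ht0 : (t : ℝ) ≠ 0 := by exact_mod_cast (Nat.one_le_iff_ne_zero.1 ht)
  simp [ht0]

section TimeAverages

variable {N M L W A Z : Type u} [MeasurableSpace W] [MeasurableSpace A] [MeasurableSpace Z]
  [Fintype M] {S : Network N M W A Z} {C : Program S L}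

/-- The expected time average `(1/t) ∑_{τ<t} E{γ(τ)}` of the auxiliary vectors: by Jensen's
inequality the bounds on `h_l(γ(τ))` and `f(γ(τ))` pass to this vector, from which `x̄(t)` differs
by the growth of the queues `W_m`. -/
noncomputable def avgAux (π : Policy S C) (ρ : Measure (Backlog N M L)) (t : ℕ) : M → ℝ :=
  ∑ τ ∈ Finset.range t, (1 / (t : ℝ)) • ∫ p, aux p τ ∂π.law ρ

section Averages

variable [Finite N] (π : Policy S C) (ρ : Measure (Backlog N M L)) [IsProbabilityMeasure ρ]

theorem ae_aux_mem_box (τ : ℕ) : ∀ᵐ p ∂π.law ρ, aux p τ ∈ S.box C.α :=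
  (π.evolvesFrom_law ρ).ae_admissible.mono fun _ hp => (hp τ τ.zero_le).1

theorem integrable_aux_apply (τ : ℕ) (m : M) : Integrable (fun p => aux p τ m) (π.law ρ) := by
  have hmeas : Measurable fun p : Path N M L W A Z => aux p τ :=
    (measurable_aux τ.lt_succ_self).mono (Filtration.piLE.le _) le_rfl
  exact .of_mem_Icc _ _ ((measurable_pi_apply m).comp hmeas).aemeasurable
    ((ae_aux_mem_box π ρ τ).mono fun _ hp => hp m)

theorem ae_xhat_mem_Icc (τ : ℕ) (m : M) :
    ∀ᵐ p ∂π.law ρ, S.xhat m (point S p τ) ∈ Set.Icc (S.xmin m) (S.xmax m) :=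
  (π.evolvesFrom_law ρ).ae_admissible.mono fun _ hp => (hp τ τ.zero_le).2.2.2 m

theorem integrable_xhat (τ : ℕ) (m : M) :
    Integrable (fun p => S.xhat m (point S p τ)) (π.law ρ) := by
  have hmeas : Measurable fun p : Path N M L W A Z => point S p τ :=
    (measurable_point S τ.lt_succ_self).mono (Filtration.piLE.le _) le_rfl
  exact .of_mem_Icc _ _ ((S.xhat_meas m).comp hmeas).aemeasurable (ae_xhat_mem_Icc π ρ τ m)

theorem integrable_comp_aux {g : (M → ℝ) → ℝ} (hg : ContinuousOn g (S.box C.α)) (τ : ℕ) :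
    Integrable (fun p => g (aux p τ)) (π.law ρ) := by
  obtain ⟨b, hb⟩ := (S.isCompact_box C.α).exists_bound_of_continuousOn hg
  have hbox := ae_aux_mem_box π ρ τ
  have hmeas : Measurable fun p : Path N M L W A Z => aux p τ :=
    (measurable_aux τ.lt_succ_self).mono (Filtration.piLE.le _) le_rfl
  have hmap : ((π.law ρ).map fun p => aux p τ).restrict (S.box C.α) =
      (π.law ρ).map fun p => aux p τ :=
    Measure.restrict_eq_self_of_ae_mem
      ((ae_map_iff hmeas.aemeasurable (S.measurableSet_box _)).2 hbox)
  exact .of_bound ((hmap ▸ hg.aestronglyMeasurable (S.measurableSet_box _)).comp_measurable hmeas)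
    b (hbox.mono fun _ hp => hb _ hp)

theorem integral_aux_mem_box (τ : ℕ) : ∫ p, aux p τ ∂π.law ρ ∈ S.box C.α :=
  (S.convex_box _).integral_mem (S.isCompact_box _).isClosed (ae_aux_mem_box π ρ τ)
    (.of_eval fun m => integrable_aux_apply π ρ τ m)

theorem avgAux_mem_box {t : ℕ} (ht : 1 ≤ t) : avgAux π ρ t ∈ S.box C.α :=
  (S.convex_box _).sum_mem (fun _ _ => by positivity) (sum_range_one_div ht)
    fun τ _ => integral_aux_mem_box π ρ τ

theorem comp_avgAux_le {g : (M → ℝ) → ℝ} (hg : ConvexOn ℝ (S.box C.α) g)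
    (hgc : ContinuousOn g (S.box C.α)) {t : ℕ} (ht : 1 ≤ t) :
    g (avgAux π ρ t) ≤ (1 / (t : ℝ)) * ∑ τ ∈ Finset.range t, ∫ p, g (aux p τ) ∂π.law ρ :=
  calc g (avgAux π ρ t)
    _ ≤ ∑ τ ∈ Finset.range t, (1 / (t : ℝ)) * g (∫ p, aux p τ ∂π.law ρ) :=
      hg.map_sum_le (fun _ _ => by positivity) (sum_range_one_div ht)
        fun τ _ => integral_aux_mem_box π ρ τ
    _ ≤ ∑ τ ∈ Finset.range t, (1 / (t : ℝ)) * ∫ p, g (aux p τ) ∂π.law ρ := by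
      gcongr with τ
      exact hg.map_integral_le hgc (S.isCompact_box _).isClosed (ae_aux_mem_box π ρ τ)
        (.of_eval fun m => integrable_aux_apply π ρ τ m) (integrable_comp_aux π ρ hgc τ)
    _ = _ := (Finset.mul_sum ..).symm

theorem avgPenalty_mem_box {t : ℕ} (ht : 1 ≤ t) : avgPenalty π ρ t ∈ S.box C.α := by
  intro m
  have hmem : ∑ τ ∈ Finset.range t, (1 / (t : ℝ)) • ∫ p, S.xhat m (point S p τ) ∂π.law ρ ∈
      Set.Icc (S.xmin m) (S.xmax m) :=
    (convex_Icc _ _).sum_mem (fun _ _ => by positivity) (sum_range_one_div ht) fun τ _ =>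
      (convex_Icc _ _).integral_mem isClosed_Icc (ae_xhat_mem_Icc π ρ τ m)
        (integrable_xhat π ρ τ m)
  simp only [smul_eq_mul, ← Finset.mul_sum] at hmem
  exact ⟨(sub_le_self _ C.α_nonneg).trans hmem.1, hmem.2.trans (le_add_of_nonneg_right C.α_nonneg)⟩

theorem comp_avgPenalty_le {g : (M → ℝ) → ℝ} (hg : ConvexOn ℝ (S.box C.α) g) {β : ℝ}
    (hlip : ∀ γ ∈ S.box C.α, ∀ γ' ∈ S.box C.α, |g γ - g γ'| ≤ β * ‖WithLp.toLp 2 (γ - γ')‖)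
    {t : ℕ} (ht : 1 ≤ t) :
    g (avgPenalty π ρ t) ≤ (1 / (t : ℝ)) * ∑ τ ∈ Finset.range t, ∫ p, g (aux p τ) ∂π.law ρ +
      β * ‖WithLp.toLp 2 (avgPenalty π ρ t - avgAux π ρ t)‖ := by
  have hjensen := comp_avgAux_le π ρ hg (continuousOn_of_abs_sub_le_mul_norm hlip) ht
  have hdist := (le_abs_self _).trans
    (hlip _ (avgPenalty_mem_box π ρ ht) _ (avgAux_mem_box π ρ ht))
  linarith

end Averages

section Queues

theorem sum_xhat_sub_aux (p : Path N M L W A Z) (m : M) (t : ℕ) :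
    ∑ τ ∈ Finset.range t, (S.xhat m (point S p τ) - aux p τ m) =
      (backlog S C p t).2.2 m - (backlog S C p 0).2.2 m := by
  rw [← Finset.sum_range_sub fun τ => (backlog S C p τ).2.2 m]
  refine Finset.sum_congr rfl fun τ _ => ?_
  simp only [backlog]
  ring

theorem sum_h_sub_le_virtual {p : Path N M L W A Z} {l : L} (h0 : 0 ≤ (backlog S C p 0).2.1 l)
    (t : ℕ) : ∑ τ ∈ Finset.range t, (C.h l (aux p τ) - C.c l) ≤ (backlog S C p t).2.1 l := by
  induction t with
  | zero => simpa using h0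
  | succ t ih =>
    rw [Finset.sum_range_succ]
    refine le_trans ?_ (le_max_left _ _)
    linarith

end Queues

section Balance

variable {π : Policy S C} {ρ : Measure (Backlog N M L)} [IsProbabilityMeasure ρ]

theorem avgPenalty_sub_avgAux [Finite N] (t : ℕ) (m : M) :
    avgPenalty π ρ t m - avgAux π ρ t m = (1 / (t : ℝ)) *
      ∫ p, ((backlog S C p t).2.2 m - (backlog S C p 0).2.2 m) ∂π.law ρ := by
  have hx (τ : ℕ) := integrable_xhat π ρ τ m
  have hγ (τ : ℕ) := integrable_aux_apply π ρ τ m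
  have hsub (τ : ℕ) : Integrable (fun p => S.xhat m (point S p τ) - aux p τ m) (π.law ρ) :=
    (hx τ).sub (hγ τ)
  have havg : avgAux π ρ t m = (1 / (t : ℝ)) * ∑ τ ∈ Finset.range t, ∫ p, aux p τ m ∂π.law ρ := by
    simp only [avgAux, Finset.sum_apply, Pi.smul_apply, smul_eq_mul, Finset.mul_sum,
      eval_integral fun m => integrable_aux_apply π ρ _ m]
  simp only [← sum_xhat_sub_aux]
  rw [integral_finsetSum _ fun τ _ => hsub τ, havg, avgPenalty, ← mul_sub,
    ← Finset.sum_sub_distrib]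
  simp only [integral_sub (hx _) (hγ _)]

theorem enorm_avgPenalty_sub_avgAux_le [Finite N] (t : ℕ) (m : M) :
    ‖avgPenalty π ρ t m - avgAux π ρ t m‖ₑ ≤
      (∫⁻ p, ‖(backlog S C p t).2.2 m‖ₑ ∂π.law ρ) / t +
        (∫⁻ p, ‖(backlog S C p 0).2.2 m‖ₑ ∂π.law ρ) / t := by
  rcases t.eq_zero_or_pos with rfl | ht
  · simp [avgPenalty, avgAux]
  have ht0 : (0 : ℝ) < t := by exact_mod_cast ht
  have hinv : ‖1 / (t : ℝ)‖ₑ = (t : ℝ≥0∞)⁻¹ := by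
    rw [Real.enorm_of_nonneg (by positivity), one_div, ENNReal.ofReal_inv_of_pos ht0,
      ENNReal.ofReal_natCast]
  have hmeas : Measurable fun p : Path N M L W A Z => (backlog S C p 0).2.2 m :=
    (measurable_pi_apply m).comp measurable_initialBacklog.snd.snd
  rw [avgPenalty_sub_avgAux, enorm_mul, hinv, ← ENNReal.add_div, ENNReal.div_eq_inv_mul,
    ← lintegral_add_right _ hmeas.enorm]
  gcongr
  exact (enorm_integral_le_lintegral_enorm _).trans (lintegral_mono fun p => enorm_sub_le)

theorem lintegral_initial_balance_ne_top [Fintype N] [Fintype L] (hρL : Integrable lyapunov ρ)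
    (m : M) : ∫⁻ p, ‖(backlog S C p 0).2.2 m‖ₑ ∂π.law ρ ≠ ⊤ := by
  have hsq : ∫⁻ p, ‖(backlog S C p 0).2.2 m‖ₑ ^ 2 ∂π.law ρ ≤
      2 * ENNReal.ofReal (∫ θ, lyapunov θ ∂ρ) := by
    rw [← lintegral_lyapunov_initial π hρL, ← lintegral_const_mul' _ _ (by finiteness)]
    exact lintegral_mono fun p =>
      enorm_sq_le_two_mul_ofReal (sq_balance_le_two_mul_lyapunov _ m)
  refine ne_top_of_le_ne_top ?_ (lintegral_le_lintegral_sq_div_add _ one_ne_zero)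
  rw [ENNReal.coe_one, div_one]
  exact ENNReal.add_ne_top.2 ⟨ne_top_of_le_ne_top (by finiteness) hsq, ENNReal.one_ne_top⟩

theorem tendsto_avgPenalty_sub_avgAux [Fintype N] [Fintype L] (hρL : Integrable lyapunov ρ)
    (hW : ∀ m, Tendsto (fun t : ℕ => (∫⁻ p, ‖(backlog S C p t).2.2 m‖ₑ ∂π.law ρ) / (t : ℝ≥0∞))
      atTop (𝓝 0)) :
    Tendsto (fun t => ‖WithLp.toLp 2 (avgPenalty π ρ t - avgAux π ρ t)‖) atTop (𝓝 0) := by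
  have hdiff : Tendsto (fun t => avgPenalty π ρ t - avgAux π ρ t) atTop (𝓝 0) := by
    refine tendsto_pi_nhds.2 fun m => ?_
    rw [Pi.zero_apply, tendsto_zero_iff_enorm_tendsto_zero]
    have hinit := ENNReal.Tendsto.const_div ENNReal.tendsto_nat_nhds_top
      (Or.inr (lintegral_initial_balance_ne_top (π := π) hρL m))
    rw [ENNReal.div_top] at hinit
    exact tendsto_of_tendsto_of_tendsto_of_le_of_le tendsto_const_nhds
      (by simpa only [add_zero] using (hW m).add hinit) (fun _ => zero_le)
      fun t => enorm_avgPenalty_sub_avgAux_le t m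
  have hnorm : Continuous fun γ : M → ℝ => ‖WithLp.toLp 2 γ‖ := (PiLp.continuous_toLp 2 _).norm
  simpa only [Function.comp_def, WithLp.toLp_zero, norm_zero] using (hnorm.tendsto 0).comp hdiff

end Balance

section Constraints

variable [Finite N] {R : RenewalRule N M L W A Z} {π : Policy S C}
  {ρ : Measure (Backlog N M L)} [IsProbabilityMeasure ρ]

theorem sum_integral_h_sub_le (htyp : ∀ᵐ p ∂π.law ρ, IsTypical S C R p) {l : L} {t : ℕ}
    (hfin : ∫⁻ p, ‖(backlog S C p t).2.1 l‖ₑ ∂π.law ρ ≠ ⊤) :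
    ∑ τ ∈ Finset.range t, ∫ p, C.h l (aux p τ) ∂π.law ρ - t * C.c l ≤
      (∫⁻ p, ‖(backlog S C p t).2.1 l‖ₑ ∂π.law ρ).toReal := by
  have hint (τ : ℕ) := integrable_comp_aux π ρ (C.continuousOn_h l) τ
  have hsub (τ : ℕ) : Integrable (fun p => C.h l (aux p τ) - C.c l) (π.law ρ) :=
    (hint τ).sub (integrable_const _)
  have hmeas : AEStronglyMeasurable (fun p => (backlog S C p t).2.1 l) (π.law ρ) := by
    have hmeas' : Measurable fun p : Path N M L W A Z => (backlog S C.zeroExtend p t).2.1 l :=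
      (measurable_pi_apply l).comp ((measurable_backlog C.measurable_zeroExtend_h t).mono
        (Filtration.piLE.le t) le_rfl).snd.fst
    exact hmeas'.aestronglyMeasurable.congr
      (htyp.mono fun p hp => by simp only [hp.backlog_zeroExtend_eq])
  have hY : Integrable (fun p => (backlog S C p t).2.1 l) (π.law ρ) := ⟨hmeas, hfin.lt_top⟩
  calc ∑ τ ∈ Finset.range t, ∫ p, C.h l (aux p τ) ∂π.law ρ - t * C.c l
    _ = ∫ p, ∑ τ ∈ Finset.range t, (C.h l (aux p τ) - C.c l) ∂π.law ρ := by
      rw [integral_finsetSum _ fun τ _ => hsub τ]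
      simp only [integral_sub (hint _) (integrable_const _), Finset.sum_sub_distrib,
        integral_const, probReal_univ, one_smul, Finset.sum_const, Finset.card_range, nsmul_eq_mul]
    _ ≤ ∫ p, (backlog S C p t).2.1 l ∂π.law ρ :=
      integral_mono_ae (integrable_finsetSum _ fun τ _ => hsub τ) hY <| htyp.mono fun p hp =>
        sum_h_sub_le_virtual (hp.backlog_zeroExtend_eq 0 ▸ hp.virtual_nonneg 0 l) t
    _ ≤ ∫ p, ‖(backlog S C p t).2.1 l‖ ∂π.law ρ :=
      integral_mono hY hY.norm fun p => le_abs_self _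
    _ = _ := integral_norm_eq_lintegral_enorm hmeas

theorem limsup_h_avgPenalty_le (htyp : ∀ᵐ p ∂π.law ρ, IsTypical S C R p)
    (hdiff : Tendsto (fun t => ‖WithLp.toLp 2 (avgPenalty π ρ t - avgAux π ρ t)‖) atTop (𝓝 0))
    {l : L}
    (hY : Tendsto (fun t : ℕ => (∫⁻ p, ‖(backlog S C p t).2.1 l‖ₑ ∂π.law ρ) / (t : ℝ≥0∞))
      atTop (𝓝 0)) :
    limsup (fun t : ℕ => ((C.h l (avgPenalty π ρ t) : ℝ) : EReal)) atTop ≤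
      ((C.c l : ℝ) : EReal) := by
  have hlim : Tendsto (fun t : ℕ => C.c l +
      ((∫⁻ p, ‖(backlog S C p t).2.1 l‖ₑ ∂π.law ρ) / (t : ℝ≥0∞)).toReal +
      C.β * ‖WithLp.toLp 2 (avgPenalty π ρ t - avgAux π ρ t)‖) atTop (𝓝 (C.c l)) := by
    have hY' := (ENNReal.tendsto_toReal ENNReal.zero_ne_top).comp hY
    simpa using (hY'.const_add (C.c l)).add (hdiff.const_mul C.β)
  refine limsup_coe_ereal_le ?_ hlim
  filter_upwards [eventually_ge_atTop 1, hY.eventually (gt_mem_nhds ENNReal.zero_lt_top)]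
    with t ht hlt
  have ht0 : (0 : ℝ) < t := by exact_mod_cast ht
  have hfin : ∫⁻ p, ‖(backlog S C p t).2.1 l‖ₑ ∂π.law ρ ≠ ⊤ := fun htop => by
    rw [htop, ENNReal.top_div_of_ne_top (ENNReal.natCast_ne_top t)] at hlt
    exact lt_irrefl _ hlt
  refine (comp_avgPenalty_le π ρ (C.h_convex l) (C.h_lip l) ht).trans (add_le_add_left ?_ _)
  rw [ENNReal.toReal_div, ENNReal.toReal_natCast, one_div, inv_mul_le_iff₀ ht0, mul_add,
    mul_div_cancel₀ _ ht0.ne']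
  linarith [sum_integral_h_sub_le htyp hfin]

end Constraints

end TimeAverages

/-! ### Type-2 renewals -/

section TypeTwo

variable {N M L W A Z : Type u} [MeasurableSpace W] [MeasurableSpace A] [MeasurableSpace Z]
  [Fintype M] {S : Network N M W A Z} {C : Program S L} {π : Policy S C}
  {ρ : Measure (Backlog N M L)} [IsProbabilityMeasure ρ]

section RenewalFrequency

theorem integral_frameNat_typeTwo (hR : HasBoundedMoments S C (typeTwoRenewals S))
    (π : Policy S C) {t : ℕ} {h : Hist N M L W A Z t} (hh : h ∈ typeTwoRenewals S t) :
    ∫ p, (frameNat (typeTwoRenewals S) t p : ℝ) ∂π.lawFrom t h = 1 / S.φ := by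
  have hmean := congrArg ENNReal.toReal (hR.forced_mul_lintegral_frameLength_typeTwo π hh)
  rw [ENNReal.toReal_mul, ENNReal.toReal_ofReal S.φ_pos.le, ← hR.integral_frameNat π hh,
    ENNReal.toReal_one] at hmean
  exact eq_one_div_of_mul_eq_one_right hmean

theorem law_renewsAt_succ_typeTwo (hR : HasBoundedMoments S C (typeTwoRenewals S)) (t : ℕ) :
    π.law ρ {p | RenewsAt (typeTwoRenewals S) p (t + 1)} = ENNReal.ofReal S.φ := by
  simpa only [lintegral_one, Measure.restrict_apply_univ, measure_univ, mul_one] using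
    (π.evolvesFrom_law ρ).setLIntegral_typeTwo (hR.measurableSet_zero π) t.zero_le
      (measurable_const (a := (1 : ℝ≥0∞)))

theorem sum_law_renewsAt_typeTwo_le (hR : HasBoundedMoments S C (typeTwoRenewals S)) (t : ℕ) :
    ∑ s ∈ Finset.range t, π.law ρ {p | RenewsAt (typeTwoRenewals S) p s} ≤
      1 + ENNReal.ofReal S.φ * t := by
  cases t with
  | zero => simp
  | succ t =>
    simp only [Finset.sum_range_succ', law_renewsAt_succ_typeTwo hR, Finset.sum_const,
      Finset.card_range, nsmul_eq_mul]
    rw [add_comm, mul_comm]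
    gcongr
    exacts [prob_le_one, t.le_succ]

-- The forced renewal in slot `t` is independent of the backlog at time `t`.
theorem forced_mul_lintegral_queue_le [Fintype N]
    (hR : HasBoundedMoments S C (typeTwoRenewals S))
    (htyp : ∀ᵐ p ∂π.law ρ, IsTypical S C (typeTwoRenewals S) p) (n : N) (t : ℕ) :
    ENNReal.ofReal S.φ * ∫⁻ p, ‖(backlog S C p t).1 n‖ₑ ∂π.law ρ ≤
      ∫⁻ p in {p | RenewsAt (typeTwoRenewals S) p (t + 1)},
        ENNReal.ofReal (∑ n, (backlog S C.zeroExtend p (t + 1)).1 n) ∂π.law ρ +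
      ENNReal.ofReal (S.μmax n) := by
  set E := {p : Path N M L W A Z | RenewsAt (typeTwoRenewals S) p (t + 1)}
  have hmeas : Measurable[Filtration.piLE t] fun p : Path N M L W A Z =>
      ‖(backlog S C.zeroExtend p t).1 n‖ₑ :=
    measurable_enorm.comp <| (measurable_pi_apply n).comp <|
      measurable_fst.comp (measurable_backlog C.measurable_zeroExtend_h t)
  calc ENNReal.ofReal S.φ * ∫⁻ p, ‖(backlog S C p t).1 n‖ₑ ∂π.law ρ
    _ = ENNReal.ofReal S.φ * ∫⁻ p, ‖(backlog S C.zeroExtend p t).1 n‖ₑ ∂π.law ρ := by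
      congr 1
      exact lintegral_congr_ae (htyp.mono fun p hp => by simp only [hp.backlog_zeroExtend_eq])
    _ = ∫⁻ p in E, ‖(backlog S C.zeroExtend p t).1 n‖ₑ ∂π.law ρ :=
      ((π.evolvesFrom_law ρ).setLIntegral_typeTwo (hR.measurableSet_zero π) t.zero_le hmeas).symm
    _ ≤ ∫⁻ p in E, (ENNReal.ofReal (∑ n, (backlog S C.zeroExtend p (t + 1)).1 n) +
          ENNReal.ofReal (S.μmax n)) ∂π.law ρ := by
      refine lintegral_mono_ae (ae_restrict_of_ae (htyp.mono fun p hp => ?_))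
      have hqueue := Finset.single_le_sum (fun i _ => hp.queue_nonneg (t + 1) i)
        (Finset.mem_univ n)
      rw [Real.enorm_of_nonneg (hp.queue_nonneg t n)]
      exact (ENNReal.ofReal_le_ofReal ((queue_le_succ_add (C := C.zeroExtend) (hp.admissible t)
        n).trans (add_le_add_left hqueue _))).trans ENNReal.ofReal_add_le
    _ ≤ _ := by
      rw [lintegral_add_right _ measurable_const, setLIntegral_const]
      gcongr
      exact mul_le_of_le_one_right zero_le prob_le_one

end RenewalFrequency

variable [Fintype N] [Fintype L]

theorem hasFrameDrift_typeTwo (hR : HasBoundedMoments S C (typeTwoRenewals S))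
    (htyp : ∀ᵐ p ∂π.law ρ, IsTypical S C (typeTwoRenewals S) p)
    (hπ : SolvesShortestPath (typeTwoRenewals S) π ρ) {B₂ : ℝ}
    (hB : IsDriftConstant (typeTwoRenewals S) π B₂) {ε : ℝ} (hε : 0 ≤ ε) {γ : M → ℝ}
    (hγ : Attains C (typeTwoRenewals S) ε γ) :
    HasFrameDrift (typeTwoRenewals S) π ρ (ε / S.φ) (B₂ + C.V * (C.f γ - C.fmin) / S.φ) := by
  refine hasFrameDrift hR htyp hπ hB hε hγ (fun π' t h hh => ?_) fun π' t h hh => ?_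
  · rw [integral_frameNat_typeTwo hR π' hh, mul_one_div]
  · rw [integral_frameNat_typeTwo hR π' hh, integral_frameNat_typeTwo hR π hh]
    exact le_of_eq (by ring)

section Penalty

theorem IsTypical.sum_penalty_le_potential {R : RenewalRule N M L W A Z} {p : Path N M L W A Z}
    (hp : IsTypical S C R p) (t : ℕ) :
    C.V * ∑ τ ∈ Finset.range t, (C.f (aux p τ) - C.fmin) ≤ potential S C.zeroExtend R t p := by
  have hbox (τ : ℕ) := (hp.admissible τ).1
  simp only [potential, C.zeroExtend_f (hbox _)]
  refine le_add_of_nonneg_of_le (lyapunov_nonneg _) (mul_le_mul_of_nonneg_left ?_ C.V_nonneg)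
  exact Finset.sum_le_sum_of_subset_of_nonneg
    (Finset.range_mono (le_nextRenewal hp.frameLength_lt_top))
    fun τ _ _ => sub_nonneg.2 (C.f_bd _ (hbox τ)).1

theorem HasFrameDrift.lintegral_potential_typeTwo_le
    (hR : HasBoundedMoments S C (typeTwoRenewals S))
    (htyp : ∀ᵐ p ∂π.law ρ, IsTypical S C (typeTwoRenewals S) p) (hρL : Integrable lyapunov ρ)
    {c K : ℝ} (hK : 0 ≤ K) (hd : HasFrameDrift (typeTwoRenewals S) π ρ c K) (t : ℕ) :
    ∫⁻ p, ENNReal.ofReal (potential S C.zeroExtend (typeTwoRenewals S) t p) ∂π.law ρ ≤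
      ENNReal.ofReal (∫ θ, lyapunov θ ∂ρ + K * (1 + S.φ * t)) := by
  have hφ : (0 : ℝ) < S.φ := S.φ_pos
  have hA : 0 ≤ ∫ θ, lyapunov θ ∂ρ := integral_nonneg fun _ => lyapunov_nonneg _
  rw [ENNReal.ofReal_add hA (by positivity), ENNReal.ofReal_mul hK,
    ENNReal.ofReal_add zero_le_one (by positivity), ENNReal.ofReal_mul hφ.le, ENNReal.ofReal_one,
    ENNReal.ofReal_natCast]
  refine (le_add_of_nonneg_right zero_le).trans ((hd.lintegral_potential_le hR htyp hρL t).trans ?_)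
  gcongr
  exact sum_law_renewsAt_typeTwo_le hR t

theorem HasFrameDrift.sum_integral_penalty_le
    (hR : HasBoundedMoments S C (typeTwoRenewals S))
    (htyp : ∀ᵐ p ∂π.law ρ, IsTypical S C (typeTwoRenewals S) p) (hρL : Integrable lyapunov ρ)
    {c K : ℝ} (hK : 0 ≤ K) (hd : HasFrameDrift (typeTwoRenewals S) π ρ c K) (t : ℕ) :
    C.V * (∑ τ ∈ Finset.range t, ∫ p, C.f (aux p τ) ∂π.law ρ - t * C.fmin) ≤
      ∫ θ, lyapunov θ ∂ρ + K * (1 + S.φ * t) := by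
  have hφ : (0 : ℝ) < S.φ := S.φ_pos
  have hA : 0 ≤ ∫ θ, lyapunov θ ∂ρ := integral_nonneg fun _ => lyapunov_nonneg _
  have hint (τ : ℕ) := integrable_comp_aux π ρ C.continuousOn_f τ
  have hsub (τ : ℕ) : Integrable (fun p => C.f (aux p τ) - C.fmin) (π.law ρ) :=
    (hint τ).sub (integrable_const _)
  have hpen : C.V * (∑ τ ∈ Finset.range t, ∫ p, C.f (aux p τ) ∂π.law ρ - t * C.fmin) =
      ∫ p, C.V * ∑ τ ∈ Finset.range t, (C.f (aux p τ) - C.fmin) ∂π.law ρ := by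
    rw [integral_const_mul, integral_finsetSum _ fun τ _ => hsub τ]
    simp only [integral_sub (hint _) (integrable_const _), Finset.sum_sub_distrib,
      integral_const, probReal_univ, one_smul, Finset.sum_const, Finset.card_range, nsmul_eq_mul]
  have hnonneg : 0 ≤ᵐ[π.law ρ] fun p =>
      C.V * ∑ τ ∈ Finset.range t, (C.f (aux p τ) - C.fmin) :=
    htyp.mono fun p hp => mul_nonneg C.V_nonneg <| Finset.sum_nonneg fun τ _ =>
      sub_nonneg.2 (C.f_bd _ (hp.admissible τ).1).1
  rw [hpen, ← ENNReal.ofReal_le_ofReal_iff (by positivity), ofReal_integral_eq_lintegral_ofReal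
    ((integrable_finsetSum _ fun τ _ => hsub τ).const_mul _) hnonneg]
  exact (lintegral_mono_ae (htyp.mono fun p hp =>
    ENNReal.ofReal_le_ofReal (hp.sum_penalty_le_potential t))).trans
      (hd.lintegral_potential_typeTwo_le hR htyp hρL hK t)

theorem limsup_f_avgPenalty_le (hR : HasBoundedMoments S C (typeTwoRenewals S))
    (htyp : ∀ᵐ p ∂π.law ρ, IsTypical S C (typeTwoRenewals S) p) (hρL : Integrable lyapunov ρ)
    (hπ : SolvesShortestPath (typeTwoRenewals S) π ρ) {B₂ : ℝ}
    (hB : IsDriftConstant (typeTwoRenewals S) π B₂)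
    (hdiff : Tendsto (fun t => ‖WithLp.toLp 2 (avgPenalty π ρ t - avgAux π ρ t)‖) atTop (𝓝 0))
    (hV : 0 < C.V) {γ : M → ℝ} (hγ : Attains C (typeTwoRenewals S) 0 γ) :
    limsup (fun t : ℕ => ((C.f (avgPenalty π ρ t) : ℝ) : EReal)) atTop ≤
      ((C.f γ + (S.φ : ℝ) * B₂ / C.V : ℝ) : EReal) := by
  have hφ : (0 : ℝ) < S.φ := S.φ_pos
  have hfγ := (C.f_bd γ (hγ.mem_box hR π)).1
  set A := ∫ θ, lyapunov θ ∂ρ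
  set K := B₂ + C.V * (C.f γ - C.fmin) / S.φ with hK_def
  have hK : 0 ≤ K := add_nonneg hB.1.le (div_nonneg (mul_nonneg hV.le (sub_nonneg.2 hfγ)) hφ.le)
  have hbound : Tendsto (fun t : ℕ => C.fmin + ((A + K) / C.V / t + K * S.φ / C.V) +
      C.β * ‖WithLp.toLp 2 (avgPenalty π ρ t - avgAux π ρ t)‖) atTop
      (𝓝 (C.f γ + (S.φ : ℝ) * B₂ / C.V)) := by
    have hlim : C.fmin + (0 + K * S.φ / C.V) + C.β * 0 = C.f γ + (S.φ : ℝ) * B₂ / C.V := by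
      rw [hK_def]
      field_simp
      ring
    exact hlim ▸ (((tendsto_const_div_atTop_nhds_zero_nat ((A + K) / C.V)).add_const
      (K * S.φ / C.V)).const_add C.fmin).add (hdiff.const_mul C.β)
  refine limsup_coe_ereal_le ?_ hbound
  filter_upwards [eventually_ge_atTop 1] with t ht
  have ht0 : (0 : ℝ) < t := by exact_mod_cast ht
  have hsum := (le_div_iff₀' hV).2 <| HasFrameDrift.sum_integral_penalty_le hR htyp hρL hK
    (hasFrameDrift_typeTwo hR htyp hπ hB le_rfl hγ) t
  refine (comp_avgPenalty_le π ρ C.f_convex C.f_lip ht).trans (add_le_add_left ?_ _)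
  rw [one_div, inv_mul_le_iff₀ ht0]
  calc ∑ τ ∈ Finset.range t, ∫ p, C.f (aux p τ) ∂π.law ρ
    _ ≤ t * C.fmin + (A + K * (1 + S.φ * t)) / C.V := by linarith
    _ = t * (C.fmin + ((A + K) / C.V / t + K * S.φ / C.V)) := by
      field_simp
      ring

theorem limsup_f_avgPenalty_le_optimalValue (hR : HasBoundedMoments S C (typeTwoRenewals S))
    (htyp : ∀ᵐ p ∂π.law ρ, IsTypical S C (typeTwoRenewals S) p) (hρL : Integrable lyapunov ρ)
    (hπ : SolvesShortestPath (typeTwoRenewals S) π ρ) {B₂ : ℝ}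
    (hB : IsDriftConstant (typeTwoRenewals S) π B₂)
    (hdiff : Tendsto (fun t => ‖WithLp.toLp 2 (avgPenalty π ρ t - avgAux π ρ t)‖) atTop (𝓝 0))
    (hV : 0 < C.V) (hne : ∃ γ : M → ℝ, Attains C (typeTwoRenewals S) 0 γ) :
    limsup (fun t : ℕ => ((C.f (avgPenalty π ρ t) : ℝ) : EReal)) atTop ≤
      ((optimalValue C (typeTwoRenewals S) + (S.φ : ℝ) * B₂ / C.V : ℝ) : EReal) := by
  refine EReal.le_of_forall_lt_iff_le.1 fun z hz => ?_
  have hopt : optimalValue C (typeTwoRenewals S) < z - (S.φ : ℝ) * B₂ / C.V :=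
    lt_sub_iff_add_lt.2 (EReal.coe_lt_coe_iff.1 hz)
  obtain ⟨_, ⟨γ, hγ, rfl⟩, hfγ⟩ := exists_lt_of_csInf_lt (Set.Nonempty.image C.f hne) hopt
  exact (limsup_f_avgPenalty_le hR htyp hρL hπ hB hdiff hV hγ).trans
    (EReal.coe_le_coe_iff.2 (lt_sub_iff_add_lt.1 hfγ).le)

end Penalty

section StrongStability

theorem HasFrameDrift.sum_lintegral_queue_renewsAt_le {R : RenewalRule N M L W A Z}
    (hR : HasBoundedMoments S C R) (htyp : ∀ᵐ p ∂π.law ρ, IsTypical S C R p)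
    (hρL : Integrable lyapunov ρ) {c K : ℝ} (hd : HasFrameDrift R π ρ c K) (t : ℕ) :
    ENNReal.ofReal c * ∑ τ ∈ Finset.range t, ∫⁻ p in {p | RenewsAt R p (τ + 1)},
        ENNReal.ofReal (∑ n, (backlog S C.zeroExtend p (τ + 1)).1 n) ∂π.law ρ ≤
      ENNReal.ofReal (∫ θ, lyapunov θ ∂ρ) + ENNReal.ofReal K * (t + 1) := by
  have hpot := hd.lintegral_potential_le hR htyp hρL (t + 1)
  rw [Finset.sum_range_succ'] at hpot
  refine (mul_le_mul_right (le_add_of_nonneg_right zero_le) _).trans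
    ((le_add_of_nonneg_left zero_le).trans (hpot.trans ?_))
  gcongr
  exact (Finset.sum_le_sum fun s _ => prob_le_one).trans (by simp)

theorem sum_lintegral_queue_le (hR : HasBoundedMoments S C (typeTwoRenewals S))
    (htyp : ∀ᵐ p ∂π.law ρ, IsTypical S C (typeTwoRenewals S) p) (hρL : Integrable lyapunov ρ)
    {c K : ℝ} (hc : 0 < c) (hd : HasFrameDrift (typeTwoRenewals S) π ρ c K) (n : N) (t : ℕ) :
    ∑ τ ∈ Finset.range t, ∫⁻ p, ‖(backlog S C p τ).1 n‖ₑ ∂π.law ρ ≤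
      ((ENNReal.ofReal (∫ θ, lyapunov θ ∂ρ) + ENNReal.ofReal K * (t + 1)) / ENNReal.ofReal c +
        t * ENNReal.ofReal (S.μmax n)) / ENNReal.ofReal S.φ := by
  rw [ENNReal.le_div_iff_mul_le (Or.inl (ENNReal.ofReal_pos.2 S.φ_pos).ne')
    (Or.inl ENNReal.ofReal_ne_top), mul_comm, Finset.mul_sum]
  refine (Finset.sum_le_sum fun τ _ => forced_mul_lintegral_queue_le hR htyp n τ).trans ?_
  rw [Finset.sum_add_distrib, Finset.sum_const, Finset.card_range, nsmul_eq_mul]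
  gcongr
  rw [ENNReal.le_div_iff_mul_le (Or.inl (ENNReal.ofReal_pos.2 hc).ne')
    (Or.inl ENNReal.ofReal_ne_top), mul_comm]
  exact hd.sum_lintegral_queue_renewsAt_le hR htyp hρL t

theorem limsup_avg_queue_lt_top (hR : HasBoundedMoments S C (typeTwoRenewals S))
    (htyp : ∀ᵐ p ∂π.law ρ, IsTypical S C (typeTwoRenewals S) p) (hρL : Integrable lyapunov ρ)
    {c K : ℝ} (hc : 0 < c) (hd : HasFrameDrift (typeTwoRenewals S) π ρ c K) (n : N) :
    limsup (fun t : ℕ =>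
      (∑ τ ∈ Finset.range t, ∫⁻ p, ‖(backlog S C p τ).1 n‖ₑ ∂(π.law ρ)) / (t : ℝ≥0∞)) atTop
        < ⊤ := by
  set A := ENNReal.ofReal (∫ θ, lyapunov θ ∂ρ)
  set b := ((A + ENNReal.ofReal K * 2) / ENNReal.ofReal c + ENNReal.ofReal (S.μmax n)) /
    ENNReal.ofReal S.φ
  have hb : b < ⊤ := by
    have hφ : ENNReal.ofReal S.φ ≠ 0 := (ENNReal.ofReal_pos.2 S.φ_pos).ne'
    have hc0 : ENNReal.ofReal c ≠ 0 := (ENNReal.ofReal_pos.2 hc).ne'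
    finiteness
  refine (limsup_le_of_le (a := b) isCobounded_le_of_bot ?_).trans_lt hb
  filter_upwards [eventually_ge_atTop 1] with t ht
  have ht1 : (1 : ℝ≥0∞) ≤ t := by exact_mod_cast ht
  refine ENNReal.div_le_of_le_mul ((sum_lintegral_queue_le hR htyp hρL hc hd n t).trans ?_)
  calc ((A + ENNReal.ofReal K * (t + 1)) / ENNReal.ofReal c + t * ENNReal.ofReal (S.μmax n)) /
        ENNReal.ofReal S.φ
    _ ≤ ((A * t + ENNReal.ofReal K * (t + t)) / ENNReal.ofReal c +
          t * ENNReal.ofReal (S.μmax n)) / ENNReal.ofReal S.φ := by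
      gcongr
      exact le_mul_of_one_le_right zero_le ht1
    _ = b * t := by
      simp only [b, div_eq_mul_inv]
      ring

theorem HasFrameDrift.avg_queue_renewalTime_le {R : RenewalRule N M L W A Z}
    (hR : HasBoundedMoments S C R) (htyp : ∀ᵐ p ∂π.law ρ, IsTypical S C R p)
    (hρL : Integrable lyapunov ρ) {c K : ℝ} (hc : 0 < c) (hK : 0 ≤ K)
    (hd : HasFrameDrift R π ρ c K) {G : ℕ} (hG : 0 < G) :
    (∑ g ∈ Finset.range G, ∑ n,
      ∫⁻ p, ‖(backlog S C p (renewalTime R p g).toNat).1 n‖ₑ ∂(π.law ρ)) / (G : ℝ≥0∞) ≤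
    ENNReal.ofReal ((∫ θ, lyapunov θ ∂ρ + K * G) / c / G) := by
  have hA : 0 ≤ ∫ θ, lyapunov θ ∂ρ := integral_nonneg fun _ => lyapunov_nonneg _
  have hG0 : (0 : ℝ) < G := by exact_mod_cast hG
  have hsum := hd.sum_lintegral_renewalTime_le hR htyp hρL G
  rw [ENNReal.ofReal_div_of_pos hG0, ENNReal.ofReal_div_of_pos hc,
    ENNReal.ofReal_add hA (by positivity), ENNReal.ofReal_mul hK, ENNReal.ofReal_natCast]
  simp only [sum_lintegral_enorm_queue_eq (measurable_toNat_renewalTime hR.meas _) htyp]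
  gcongr
  rwa [ENNReal.le_div_iff_mul_le (Or.inl (ENNReal.ofReal_pos.2 hc).ne')
    (Or.inl ENNReal.ofReal_ne_top), mul_comm]

theorem avg_queue_renewalTime_typeTwo_le (hR : HasBoundedMoments S C (typeTwoRenewals S))
    (htyp : ∀ᵐ p ∂π.law ρ, IsTypical S C (typeTwoRenewals S) p) (hρL : Integrable lyapunov ρ)
    (hπ : SolvesShortestPath (typeTwoRenewals S) π ρ) {B₂ : ℝ}
    (hB : IsDriftConstant (typeTwoRenewals S) π B₂) {ε : ℝ} (hε : 0 < ε) {γ : M → ℝ}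
    (hγ : Attains C (typeTwoRenewals S) ε γ) {G : ℕ} (hG : 0 < G) :
    (∑ g ∈ Finset.range G, ∑ n,
      ∫⁻ p, ‖(backlog S C p (renewalTime (typeTwoRenewals S) p g).toNat).1 n‖ₑ ∂(π.law ρ)) /
        (G : ℝ≥0∞) ≤
    ENNReal.ofReal (((S.φ : ℝ) * B₂ + C.V * (C.fmax - C.fmin)) / ε +
      (S.φ : ℝ) * (∫ θ, lyapunov θ ∂ρ) / (ε * G)) := by
  have hφ : (0 : ℝ) < S.φ := S.φ_pos
  have hV := C.V_nonneg
  obtain ⟨hfmin, hfmax⟩ := C.f_bd γ (hγ.mem_box hR π)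
  have hK : 0 ≤ B₂ + C.V * (C.f γ - C.fmin) / S.φ :=
    add_nonneg hB.1.le (div_nonneg (mul_nonneg hV (sub_nonneg.2 hfmin)) hφ.le)
  refine ((hasFrameDrift_typeTwo hR htyp hπ hB hε.le hγ).avg_queue_renewalTime_le hR htyp hρL
    (div_pos hε hφ) hK hG).trans (ENNReal.ofReal_le_ofReal ?_)
  calc (∫ θ, lyapunov θ ∂ρ + (B₂ + C.V * (C.f γ - C.fmin) / S.φ) * G) / (ε / S.φ) / G
    _ = (S.φ * B₂ + C.V * (C.f γ - C.fmin)) / ε + S.φ * (∫ θ, lyapunov θ ∂ρ) / (ε * G) := by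
      field_simp
      ring
    _ ≤ (S.φ * B₂ + C.V * (C.fmax - C.fmin)) / ε + S.φ * (∫ θ, lyapunov θ ∂ρ) / (ε * G) := by
      gcongr

end StrongStability

end TypeTwo

end MarkovNet

open MarkovNet in
theorem mainTheorem3_general {N M L W A Z : Type u} [Fintype N] [Fintype M] [Fintype L]
    [MeasurableSpace W] [MeasurableSpace A] [MeasurableSpace Z]
    (S : Network N M W A Z) (C : Program S L)
    (R : RenewalRule N M L W A Z) (hR : HasBoundedMoments S C R)
    (hA3 : ∃ γopt : M → ℝ, Attains C R 0 γopt)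
    (ρ : Measure (Backlog N M L)) [IsProbabilityMeasure ρ]
    (hρ : ∀ᵐ θ ∂ρ, (∀ n, 0 ≤ θ.1 n) ∧ ∀ l, 0 ≤ θ.2.1 l)
    (hρL : Integrable lyapunov ρ)
    (π : Policy S C) (hπ : SolvesShortestPath R π ρ)
    (B₂ : ℝ) (hB₂ : IsDriftConstant R π B₂) :
    ((∀ n, Tendsto (fun t : ℕ =>
        (∫⁻ p, ‖(backlog S C p t).1 n‖ₑ ∂(π.law ρ)) / (t : ℝ≥0∞)) atTop (𝓝 0)) ∧
      (∀ l, Tendsto (fun t : ℕ =>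
        (∫⁻ p, ‖(backlog S C p t).2.1 l‖ₑ ∂(π.law ρ)) / (t : ℝ≥0∞)) atTop (𝓝 0)) ∧
      (∀ m, Tendsto (fun t : ℕ =>
        (∫⁻ p, ‖(backlog S C p t).2.2 m‖ₑ ∂(π.law ρ)) / (t : ℝ≥0∞)) atTop (𝓝 0))) ∧
    (∀ l, limsup (fun t : ℕ => ((C.h l (avgPenalty π ρ t) : ℝ) : EReal)) atTop ≤
      ((C.c l : ℝ) : EReal)) ∧
    (R = typeTwoRenewals S → 0 < C.V →
      limsup (fun t : ℕ => ((C.f (avgPenalty π ρ t) : ℝ) : EReal)) atTop ≤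
        ((optimalValue C R + (S.φ : ℝ) * B₂ / C.V : ℝ) : EReal)) ∧
    (R = typeTwoRenewals S → ∀ ε : ℝ, 0 < ε → (∃ γstar : M → ℝ, Attains C R ε γstar) →
      (∀ n, limsup (fun t : ℕ =>
        (∑ τ ∈ Finset.range t, ∫⁻ p, ‖(backlog S C p τ).1 n‖ₑ ∂(π.law ρ)) / (t : ℝ≥0∞)) atTop
          < ⊤) ∧
      ∀ G : ℕ, 0 < G →
        (∑ g ∈ Finset.range G, ∑ n,
          ∫⁻ p, ‖(backlog S C p (renewalTime R p g).toNat).1 n‖ₑ ∂(π.law ρ)) / (G : ℝ≥0∞) ≤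
        ENNReal.ofReal (((S.φ : ℝ) * B₂ + C.V * (C.fmax - C.fmin)) / ε +
          (S.φ : ℝ) * (∫ θ, lyapunov θ ∂ρ) / (ε * G))) := by
  have htyp := ae_isTypical hR π hρ
  obtain ⟨γ₀, hγ₀⟩ := hA3
  obtain ⟨K, hdrift⟩ := exists_hasFrameDrift hR htyp hπ hB₂ hγ₀
  have hQ := hdrift.tendsto_queue_div hR htyp hρL
  have hY := hdrift.tendsto_virtual_div hR htyp hρL
  have hW := hdrift.tendsto_balance_div hR htyp hρL
  have hdiff := tendsto_avgPenalty_sub_avgAux hρL hW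
  refine ⟨⟨hQ, hY, hW⟩, fun l => limsup_h_avgPenalty_le htyp hdiff (hY l), ?_, ?_⟩
  · rintro rfl hV
    exact limsup_f_avgPenalty_le_optimalValue hR htyp hρL hπ hB₂ hdiff hV ⟨γ₀, hγ₀⟩
  · rintro rfl ε hε ⟨γ, hγ⟩
    have hdriftε := hasFrameDrift_typeTwo hR htyp hπ hB₂ hε.le hγ
    exact ⟨limsup_avg_queue_lt_top hR htyp hρL (div_pos hε S.φ_pos) hdriftε,
      fun G hG => avg_queue_renewalTime_typeTwo_le hR htyp hρL hπ hB₂ hε hγ hG⟩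

open MarkovNet in
theorem mainTheorem3 {N M L W A Z : Type u} [Fintype N] [Fintype M] [Fintype L]
    [MeasurableSpace W] [MeasurableSpace A]
    [MeasurableSpace Z] [Countable Z] [DiscreteMeasurableSpace Z]
    (S : Network N M W A Z) (C : Program S L)
    (R : RenewalRule N M L W A Z) (hR : IsRenewalDefinition S C R)
    (hA3 : ∃ γopt : M → ℝ, Attains C R 0 γopt)
    (ρ : Measure (Backlog N M L)) [IsProbabilityMeasure ρ]
    (hρ : ∀ᵐ θ ∂ρ, (∀ n, 0 ≤ θ.1 n) ∧ ∀ l, 0 ≤ θ.2.1 l)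
    (hρL : Integrable lyapunov ρ)
    (π : Policy S C) (hπ : SolvesShortestPath R π ρ)
    (B₂ : ℝ) (hB₂ : IsDriftConstant R π B₂) :
    ((∀ n, Tendsto (fun t : ℕ =>
        (∫⁻ p, ‖(backlog S C p t).1 n‖ₑ ∂(π.law ρ)) / (t : ℝ≥0∞)) atTop (𝓝 0)) ∧
      (∀ l, Tendsto (fun t : ℕ =>
        (∫⁻ p, ‖(backlog S C p t).2.1 l‖ₑ ∂(π.law ρ)) / (t : ℝ≥0∞)) atTop (𝓝 0)) ∧
      (∀ m, Tendsto (fun t : ℕ =>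
        (∫⁻ p, ‖(backlog S C p t).2.2 m‖ₑ ∂(π.law ρ)) / (t : ℝ≥0∞)) atTop (𝓝 0))) ∧
    (∀ l, limsup (fun t : ℕ => ((C.h l (avgPenalty π ρ t) : ℝ) : EReal)) atTop ≤
      ((C.c l : ℝ) : EReal)) ∧
    (R = typeTwoRenewals S → 0 < C.V →
      limsup (fun t : ℕ => ((C.f (avgPenalty π ρ t) : ℝ) : EReal)) atTop ≤
        ((optimalValue C R + (S.φ : ℝ) * B₂ / C.V : ℝ) : EReal)) ∧
    (R = typeTwoRenewals S → ∀ ε : ℝ, 0 < ε → (∃ γstar : M → ℝ, Attains C R ε γstar) →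
      (∀ n, limsup (fun t : ℕ =>
        (∑ τ ∈ Finset.range t, ∫⁻ p, ‖(backlog S C p τ).1 n‖ₑ ∂(π.law ρ)) / (t : ℝ≥0∞)) atTop
          < ⊤) ∧
      ∀ G : ℕ, 0 < G →
        (∑ g ∈ Finset.range G, ∑ n,
          ∫⁻ p, ‖(backlog S C p (renewalTime R p g).toNat).1 n‖ₑ ∂(π.law ρ)) / (G : ℝ≥0∞) ≤
        ENNReal.ofReal (((S.φ : ℝ) * B₂ + C.V * (C.fmax - C.fmin)) / ε +
          (S.φ : ℝ) * (∫ θ, lyapunov θ ∂ρ) / (ε * G))) :=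
  mainTheorem3_general S C R hR.hasBoundedMoments hA3 ρ hρ hρL π hπ B₂ hB₂
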